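/- **Proposition 5.1.** Let $M$ be a smooth two-dimensional Riemannian manifold with metric $\mathbf g$, and consider Newtonian dynamical systems on $M$, given in local coordinates by $$\ddot x^k+\sum_{i,j}\Gamma^k_{ij}\,\dot x^i\dot x^j=F^k(x,\dot x),\qquad k=1,2,$$ where $\Gamma^k_{ij}$ are the components of the metric connection and the force field $\mathbf F$ assigns to every point $(p,\mathbf v)$ of the tangent bundle $TM$ a vector $\mathbf F(p,\mathbf v)\in T_pM$, smoothly at all points with $\mathbf v\neq 0$. * The system *admits the normal shift of hypersurfaces* if for every hypersurface $S$ in $M$ (for $\dim M=2$: a smooth regular curve) with a smooth unit normal field $\mathbf n$, every point $p_0\in S$ and every real $\nu_0\neq 0$ there are a neighbourhood $S'$ of $p_0$ in $S$, a smooth nowhere vanishing function $\nu$ on $S'$ with $\nu(p_0)=\nu_0$ and a number $\varepsilon>0$ such that the trajectories starting at the points $p\in S'$ with initial velocities $\nu(p)\,\mathbf n(p)$ are defined for $|t|<\varepsilon$, depend smoothly on $(p,t)$, and for all $|t|<\varepsilon$ the displacement $f_t\colon S'\to M$ along them is an immersion, whose image $S_t$ is orthogonal to the trajectories. * The system *admits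 normal blow-up of points* if for every $p_0\in M$ and every $\nu_0>0$ there is $\varepsilon>0$ such that the trajectories starting at $p_0$ with initial velocities $\nu_0\,\mathbf n$, where $\mathbf n$ runs over the unit circle $\sigma\subset T_{p_0}M$, are defined for $|t|<\varepsilon$, depend smoothly on $(\mathbf n,t)$, and for all $0<t<\varepsilon$ the displacement $f_t\colon\sigma\to M$ along them is an injective immersion, whose image $S_t$ is orthogonal to the trajectories. * The *weak normality equations* are the following equations, required at all points $(p,\mathbf v)\in TM$ with $\mathbf v\neq 0$, for $k=1,2$: $$\sum_i\Bigl(v^{-1}F_i+\sum_j\tilde\nabla_i(N^jF_j)\Bigr)P^i_k=0,$$ $$\sum_{i,j}\bigl(\nabla_iF_j+\nabla_jF_i-2v^{-2}F_iF_j\bigr)N^jP^i_k+\sum_{i,j}\Bigl(\frac{F^j\,\tilde\nabla_jF_i}{v}-\sum_r\frac{N^rN^j\,\tilde\nabla_jF_r}{v}\,F_i\Bigr)P^i_k=0.$$ Here $v=|\mathbf v|$, $N^i=v^i/v$, $N_i=\sum_jg_{ij}N^j$, $F_i=\sum_jg_{ij}F^j$, $P^i_k=\delta^i_k-N^iN_k$,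 $\tilde\nabla_i=\partial/\partial v^i$ is the velocity gradient, and $\nabla_iF_j=\dfrac{\partial F_j}{\partial x^i}-\sum_{a,b}\Gamma^b_{ia}v^a\dfrac{\partial F_j}{\partial v^b}-\sum_a\Gamma^a_{ij}F_a$ is the spatial gradient. Then the class of systems admitting the normal shift of hypersurfaces coincides with the class of systems admitting normal blow-up of points, and both coincide with the class of systems whose force field satisfies the weak normality equations. -/

import Mathlib

open scoped Manifold ContDiff Bundle

noncomputable section

namespace NewtonianDynamics

/-- The model space `ℝ²` of local coordinates `x = (x¹, x²)`. -/
abbrev Coord : Type := EuclideanSpace ℝ (Fin 2)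

/-- The `i`-th coordinate vector of `ℝ²`. -/
abbrev basisVec (i : Fin 2) : Coord := EuclideanSpace.single i (1 : ℝ)

/-- The partial derivative `∂h/∂yⁱ` of a function on `ℝ²`. -/
def partialDeriv (i : Fin 2) (h : Coord → ℝ) (y : Coord) : ℝ := fderiv ℝ h y (basisVec i)

section Coordinates

variable {M : Type*} [TopologicalSpace M] [ChartedSpace Coord M]

/-- A force field on `M`: an extended vector field, that is, to every point `(p, v)` of the tangent
bundle a vector of the tangent space at `p` is assigned.  It is smooth at all points with `v ≠ 0`
(so force fields that are smooth on the whole tangent bundle are included, as well as those that are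
singular at zero velocity). -/
structure ForceField (M : Type*) [TopologicalSpace M] [ChartedSpace Coord M]
    [IsManifold (𝓡 2) ∞ M] where
  /-- The force vector at the point `p` for the velocity `v`. -/
  toFun : ∀ p : M, TangentSpace (𝓡 2) p → TangentSpace (𝓡 2) p
  /-- Smoothness away from the zero section. -/
  smooth : ContMDiffOn (𝓡 2).tangent (𝓡 2).tangent ∞
    (fun q : TangentBundle (𝓡 2) M => (⟨q.1, toFun q.1 q.2⟩ : TangentBundle (𝓡 2) M))
    {q | q.2 ≠ 0}

/-- The tangent vector `∑ wⁱ ∂/∂xⁱ` at the point with coordinates `x` in the chart `e`. -/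
def tangentVector (e : OpenPartialHomeomorph M Coord) (x w : Coord) :
    TangentSpace (𝓡 2) (e.symm x) :=
  mfderiv (𝓡 2) (𝓡 2) e.symm x w

section Metric

variable [Bundle.RiemannianBundle (fun p : M => TangentSpace (𝓡 2) p)]

/-- The scalar product `(w | z) = ∑ gᵢⱼ(x) wⁱ zʲ` of two tangent vectors given by their components
at the point with coordinates `x`. -/
def scalarProd (e : OpenPartialHomeomorph M Coord) (x w z : Coord) : ℝ :=
  inner ℝ (tangentVector e x w) (tangentVector e x z)

/-- The components `gᵢⱼ` of the metric in the chart `e`. -/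
def metric (e : OpenPartialHomeomorph M Coord) (x : Coord) : Matrix (Fin 2) (Fin 2) ℝ :=
  Matrix.of fun i j => scalarProd e x (basisVec i) (basisVec j)

/-- The components `Γᵏᵢⱼ` of the metric connection in the chart `e`. -/
def christoffel (e : OpenPartialHomeomorph M Coord) (x : Coord) (k i j : Fin 2) : ℝ :=
  (1 / 2) * ∑ s, (metric e x)⁻¹ k s *
    (partialDeriv i (fun y => metric e y s j) x + partialDeriv j (fun y => metric e y i s) x
      - partialDeriv s (fun y => metric e y i j) x)

/-- The modulus `|v|` of the vector with components `vⁱ`. -/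
def speed (e : OpenPartialHomeomorph M Coord) (x v : Coord) : ℝ := √(scalarProd e x v v)

/-- The contravariant components `Nⁱ = vⁱ / |v|`. -/
def dirUp (e : OpenPartialHomeomorph M Coord) (x v : Coord) (i : Fin 2) : ℝ := v i / speed e x v

/-- The covariant components `Nᵢ = ∑ gᵢⱼ Nʲ`. -/
def dirDown (e : OpenPartialHomeomorph M Coord) (x v : Coord) (i : Fin 2) : ℝ :=
  ∑ j, metric e x i j * dirUp e x v j

/-- The components `Pⁱₖ = δⁱₖ - Nⁱ Nₖ` of the orthogonal projector onto the line perpendicular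
to `v`. -/
def proj (e : OpenPartialHomeomorph M Coord) (x v : Coord) (i k : Fin 2) : ℝ :=
  (if i = k then 1 else 0) - dirUp e x v i * dirDown e x v k

end Metric

variable [IsManifold (𝓡 2) ∞ M]

/-- The contravariant components `Fᵏ(x, v)` of the force in the chart `e`. -/
def forceUp (F : ForceField M) (e : OpenPartialHomeomorph M Coord) (x v : Coord) : Coord :=
  mfderiv (𝓡 2) (𝓡 2) e (e.symm x) (F.toFun (e.symm x) (tangentVector e x v))

variable [Bundle.RiemannianBundle (fun p : M => TangentSpace (𝓡 2) p)]

/-- The covariant components `Fᵢ = ∑ gᵢⱼ Fʲ`. -/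
def forceDown (F : ForceField M) (e : OpenPartialHomeomorph M Coord) (x v : Coord) (i : Fin 2) : ℝ :=
  ∑ j, metric e x i j * forceUp F e x v j

/-- The velocity gradient `∇̃ᵢ Fⱼ = ∂Fⱼ/∂vⁱ`. -/
def velGrad (F : ForceField M) (e : OpenPartialHomeomorph M Coord) (x v : Coord) (i j : Fin 2) : ℝ :=
  partialDeriv i (fun w => forceDown F e x w j) v

/-- The spatial gradient
`∇ᵢ Fⱼ = ∂Fⱼ/∂xⁱ - ∑ Γᵇᵢₐ vᵃ ∂Fⱼ/∂vᵇ - ∑ Γᵃᵢⱼ Fₐ` of the extended covector field `Fⱼ`. -/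
def spatGrad (F : ForceField M) (e : OpenPartialHomeomorph M Coord) (x v : Coord) (i j : Fin 2) : ℝ :=
  partialDeriv i (fun y => forceDown F e y v j) x
    - ∑ a, ∑ b, christoffel e x b i a * v a * velGrad F e x v b j
    - ∑ a, christoffel e x a i j * forceDown F e x v a

/-- The weak normality equations at all points `(p, v)` of the tangent bundle with `v ≠ 0`,
written in arbitrary local coordinates. -/
def WeakNormality (F : ForceField M) : Prop :=
  ∀ e ∈ IsManifold.maximalAtlas (𝓡 2) ∞ M, ∀ x ∈ e.target, ∀ v : Coord, v ≠ 0 → ∀ k : Fin 2,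
    (∑ i, ((speed e x v)⁻¹ * forceDown F e x v i
        + partialDeriv i (fun w => ∑ j, dirUp e x w j * forceDown F e x w j) v)
        * proj e x v i k = 0) ∧
    (∑ i, ∑ j, (spatGrad F e x v i j + spatGrad F e x v j i
          - 2 * (speed e x v)⁻¹ ^ 2 * forceDown F e x v i * forceDown F e x v j)
          * dirUp e x v j * proj e x v i k
      + ∑ i, ∑ j, (forceUp F e x v j * velGrad F e x v j i / speed e x v
          - ∑ r, dirUp e x v r * dirUp e x v j * velGrad F e x v j r / speed e x v
              * forceDown F e x v i) * proj e x v i k = 0)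

/-- The curve `x(t)`, `t ∈ s`, runs in the domain of the local coordinates `e` and satisfies there
the equations of Newtonian dynamics `ẍᵏ + ∑ Γᵏᵢⱼ ẋⁱ ẋʲ = Fᵏ(x, ẋ)`. -/
def IsTrajectoryOn (F : ForceField M) (e : OpenPartialHomeomorph M Coord) (x : ℝ → Coord)
    (s : Set ℝ) : Prop :=
  ContDiffOn ℝ 2 x s ∧ ∀ t ∈ s, x t ∈ e.target ∧ ∀ k : Fin 2,
    deriv (deriv x) t k + ∑ i, ∑ j, christoffel e (x t) k i j * deriv x t i * deriv x t j
      = forceUp F e (x t) (deriv x t) k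

/-- A cooriented piece of a hypersurface in the domain of the local coordinates `e`.  In dimension
two a hypersurface is a smooth regular curve: `r(u)`, `u ∈ J`, are the coordinates of its points, and
`n(u)` are the components of a smooth unit normal vector field on it. -/
structure IsHypersurface (e : OpenPartialHomeomorph M Coord) (J : Set ℝ) (r n : ℝ → Coord) :
    Prop where
  isOpen : IsOpen J
  smooth : ContDiffOn ℝ ∞ r J
  mem_target : ∀ u ∈ J, r u ∈ e.target
  regular : ∀ u ∈ J, deriv r u ≠ 0
  normal_smooth : ContDiffOn ℝ ∞ n J
  normal_unit : ∀ u ∈ J, scalarProd e (r u) (n u) (n u) = 1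
  normal_perp : ∀ u ∈ J, scalarProd e (r u) (n u) (deriv r u) = 0

/-- The functions `x(u, t)`, `u ∈ J`, `|t| < ε`, define a normal shift along trajectories of the
dynamical system, with initial data `x(u, 0) = r(u)`, `∂ₜx(u, 0) = ν(u) n(u)`: for every `t`
the map `u ↦ x(u, t)` is an immersed smooth hypersurface, and it is orthogonal to the trajectories
`t ↦ x(u, t)`. -/
structure IsNormalShift (F : ForceField M) (e : OpenPartialHomeomorph M Coord) (J : Set ℝ) (ε : ℝ)
    (r n : ℝ → Coord) (ν : ℝ → ℝ) (x : ℝ → ℝ → Coord) : Prop where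
  smooth : ContDiffOn ℝ ∞ (fun q : ℝ × ℝ => x q.1 q.2) (J ×ˢ Set.Ioo (-ε) ε)
  trajectory : ∀ u ∈ J, IsTrajectoryOn F e (x u) (Set.Ioo (-ε) ε)
  initial_point : ∀ u ∈ J, x u 0 = r u
  initial_velocity : ∀ u ∈ J, deriv (x u) 0 = ν u • n u
  immersion : ∀ u ∈ J, ∀ t ∈ Set.Ioo (-ε) ε, deriv (fun w => x w t) u ≠ 0
  normal : ∀ u ∈ J, ∀ t ∈ Set.Ioo (-ε) ε,
    scalarProd e (x u t) (deriv (x u) t) (deriv (fun w => x w t) u) = 0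

/-- The dynamical system admits the normal shift of hypersurfaces: for every hypersurface `S` with a
unit normal field `n`, every point `p₀` (with parameter `u₀`) of `S` and every number `ν₀ ≠ 0` there
are a neighbourhood of `p₀` in `S` and a smooth nonvanishing function `ν` on it with `ν(p₀) = ν₀`
such that the initial velocities `ν n` determine a normal shift of this neighbourhood.  As the
condition is local on `S`, the hypersurface is taken inside a coordinate domain, for all
coordinates. -/
def AdmitsNormalShift (F : ForceField M) : Prop :=
  ∀ e ∈ IsManifold.maximalAtlas (𝓡 2) ∞ M, ∀ (J : Set ℝ) (r n : ℝ → Coord),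
    IsHypersurface e J r n → ∀ u₀ ∈ J, ∀ ν₀ : ℝ, ν₀ ≠ 0 →
      ∃ J' ⊆ J, IsOpen J' ∧ u₀ ∈ J' ∧
        ∃ ν : ℝ → ℝ, ContDiffOn ℝ ∞ ν J' ∧ (∀ u ∈ J', ν u ≠ 0) ∧ ν u₀ = ν₀ ∧
          ∃ ε > 0, ∃ x : ℝ → ℝ → Coord, IsNormalShift F e J' ε r n ν x

/-- The point `n(θ) = cos θ · a + sin θ · b` of the unit circle in a tangent plane with orthonormal
basis `a`, `b`. -/
def circlePoint (a b : Coord) (θ : ℝ) : Coord := Real.cos θ • a + Real.sin θ • b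

/-- The functions `x(θ, t)` define a normal blow-up of the point `p₀` along trajectories of the
dynamical system, with initial data `x(θ, 0) = x(p₀)`, `∂ₜx(θ, 0) = ν₀ n(θ)`, where `n(θ)` runs over
the unit circle in the tangent plane at `p₀`: for `0 < t < ε` the map `n(θ) ↦ x(θ, t)` is an
injective smooth immersion of the circle, and its image is orthogonal to the trajectories. -/
structure IsNormalBlowUp (F : ForceField M) (e : OpenPartialHomeomorph M Coord) (p₀ : M)
    (a b : Coord) (ν₀ ε : ℝ) (x : ℝ → ℝ → Coord) : Prop where
  smooth : ContDiffOn ℝ ∞ (fun q : ℝ × ℝ => x q.1 q.2) (Set.univ ×ˢ Set.Ioo (-ε) ε)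
  periodic : ∀ θ, ∀ t ∈ Set.Ioo (-ε) ε, x (θ + 2 * Real.pi) t = x θ t
  trajectory : ∀ θ, IsTrajectoryOn F e (x θ) (Set.Ioo (-ε) ε)
  initial_point : ∀ θ, x θ 0 = e p₀
  initial_velocity : ∀ θ, deriv (x θ) 0 = ν₀ • circlePoint a b θ
  immersion : ∀ θ, ∀ t ∈ Set.Ioo 0 ε, deriv (fun w => x w t) θ ≠ 0
  injective : ∀ t ∈ Set.Ioo 0 ε, ∀ θ θ', x θ t = x θ' t → circlePoint a b θ = circlePoint a b θ'
  normal : ∀ θ, ∀ t ∈ Set.Ioo 0 ε,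
    scalarProd e (x θ t) (deriv (x θ) t) (deriv (fun w => x w t) θ) = 0

/-- The dynamical system admits normal blow-up of points: for every point `p₀` and every constant
`ν₀ > 0` the initial velocities `ν₀ n`, where `n` runs over all unit vectors at `p₀`, determine a
normal blow-up of `p₀`.  Arbitrary coordinates near `p₀` and an arbitrary orthonormal basis of the
tangent plane are used for describing it. -/
def AdmitsNormalBlowUp (F : ForceField M) : Prop :=
  ∀ p₀ : M, ∀ e ∈ IsManifold.maximalAtlas (𝓡 2) ∞ M, p₀ ∈ e.source →
    ∀ a b : Coord, scalarProd e (e p₀) a a = 1 → scalarProd e (e p₀) b b = 1 →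
      scalarProd e (e p₀) a b = 0 →
      ∀ ν₀ > 0, ∃ ε > 0, ∃ x : ℝ → ℝ → Coord, IsNormalBlowUp F e p₀ a b ν₀ ε x

end Coordinates

end NewtonianDynamics

end

/-!
Consider a smooth one-parameter family of trajectories `t ↦ X(u, t)`. The curves `t = const` are
orthogonal to the trajectories if and only if the deviation `φ = (∂ₜX | ∂ᵤX)` vanishes. Let
`T = |∂ₜX|² / 2` and let `τ = ∂ᵤX` be the variation vector. Newton's equations give
`∂ₜφ = ∂ᵤT + ∑ Fᵢ τⁱ`, and, as `∂ₜT = ∑ Fᵢ vⁱ` is the power of the force, `∂ₜ²φ` is an expression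
`∑ posCoeffᵢ τⁱ + ∑ velCoeffᵢ (∇ₜτ)ⁱ` that contains only first derivatives of the force
(`IsTrajectoryFamily.hasDerivAt_deviationDeriv`). The components of `τ` and of `∇ₜτ` along the
velocity are expressed by `φ` and `∂ₜφ`, because `(v | ∇ₜτ) = ∂ᵤT`. What remains is
`∂ₜ²φ = A ∂ₜφ + B φ + ∑ posCoeff'ᵢ Pτⁱ + ∑ velCoeffᵢ P(∇ₜτ)ⁱ` with the orthogonal projector `P`
(`IsTrajectoryFamily.hasDerivAt_deviationDeriv'`), and the weak normality equations say exactly that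
the covectors `velCoeff` and `posCoeff'` vanish on the vectors perpendicular to `v`
(`weakNormality_iff`).

If the weak normality equations hold, `φ` satisfies a homogeneous linear equation along each
trajectory, and it vanishes as soon as `φ` and `∂ₜφ` vanish for `t = 0`
(`IsTrajectoryFamily.deviation_eq_zero`). For the blow-up of a point both conditions are automatic,
since `τ = 0` and `T` is constant at the initial moment. For the shift of a curve `φ = 0` since the
initial velocity is `ν n`, and `∂ₜφ = 0` is an ordinary differential equation for the function `ν`
(`exists_initial_speed`). That the shifted curve is immersed for small `t` follows from continuity;
the blow-up for small `t > 0` is a `C¹`-small perturbation of the ellipse `t ν₀ n(θ)`, hence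
immersed and embedded (`exists_immersion_injective`).

Conversely, if `φ` vanishes identically, then `∑ posCoeff'ᵢ τⁱ + ∑ velCoeffᵢ P(∇ₜτ)ⁱ = 0`
(`IsTrajectoryFamily.sum_perpPart_eq_zero`). At the initial moment of a blow-up `τ = 0` while `∇ₜτ`
is a nonzero vector perpendicular to `v`; this gives the equation for `velCoeff`, hence the equation
for `posCoeff'` along the trajectories for `t > 0`, and in the limit `t → 0` everywhere. For the
normal shift, two curves with a common tangent but different curvatures have the same `τ` and
different `P(∇ₜτ)` at the initial moment, which separates the two equations.

Trajectories that depend smoothly on their initial data come from `SmoothFlow`: the Picard operator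
is smooth on the Banach space of continuous curves, and the implicit function theorem applies to its
fixed point. All computations are done in one arbitrary chart, in which the conditions are stated.
-/

set_option linter.unusedSectionVars false

namespace SmoothFlow

open Set Filter Topology

/-! ### Smooth dependence of solutions of differential equations on initial data -/

section Superposition

variable {K : Type} [TopologicalSpace K] [CompactSpace K]
  {E F : Type} [NormedAddCommGroup E] [NormedSpace ℝ E] [NormedAddCommGroup F] [NormedSpace ℝ F]

/-- Pointwise application `(A, h) ↦ (s ↦ B (A s) (h s))` of a bilinear map to continuous functions,
as a bilinear map. -/
noncomputable def pointwiseₗ {G : Type} [NormedAddCommGroup G] [NormedSpace ℝ G]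
    (B : G →L[ℝ] E →L[ℝ] F) : C(K, G) →ₗ[ℝ] C(K, E) →ₗ[ℝ] C(K, F) :=
  LinearMap.mk₂ ℝ (fun (A : C(K, G)) (h : C(K, E)) =>
      (⟨fun s => B (A s) (h s), by fun_prop⟩ : C(K, F)))
    (fun A B h => by ext s; simp) (fun c A h => by ext s; simp)
    (fun A h k => by ext s; simp) (fun c A h => by ext s; simp)

/-- Pointwise application of a bilinear map to continuous functions, as a bounded bilinear map. -/
noncomputable def pointwise {G : Type} [NormedAddCommGroup G] [NormedSpace ℝ G]
    (B : G →L[ℝ] E →L[ℝ] F) : C(K, G) →L[ℝ] C(K, E) →L[ℝ] C(K, F) :=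
  LinearMap.mkContinuous₂ (pointwiseₗ B) ‖B‖ (by
    intro A h
    rw [ContinuousMap.norm_le _ (by positivity)]
    intro s
    calc ‖B (A s) (h s)‖ ≤ ‖B‖ * ‖A s‖ * ‖h s‖ := B.le_opNorm₂ _ _
      _ ≤ ‖B‖ * ‖A‖ * ‖h‖ := by
        gcongr
        · exact A.norm_coe_le_norm s
        · exact h.norm_coe_le_norm s)

lemma pointwise_apply {G : Type} [NormedAddCommGroup G] [NormedSpace ℝ G]
    (B : G →L[ℝ] E →L[ℝ] F) (A : C(K, G)) (h : C(K, E)) (s : K) :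
    pointwise B A h s = B (A s) (h s) := rfl

/-- The superposition operator `γ ↦ f ∘ γ` on continuous functions is differentiable, with the
derivative `h ↦ (s ↦ Df(γ s) (h s))`: on the compact range of `γ` the derivative of `f` is uniformly
continuous. -/
lemma hasFDerivAt_comp {f : E → F} (hf : ContDiff ℝ 1 f) (γ : C(K, E)) :
    HasFDerivAt (fun γ : C(K, E) => (⟨f, hf.continuous⟩ : C(E, F)).comp γ)
      (pointwise (.id ℝ (E →L[ℝ] F)) ((⟨fderiv ℝ f, hf.continuous_fderiv one_ne_zero⟩ : C(E, E →L[ℝ] F)).comp γ))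
      γ := by
  rw [hasFDerivAt_iff_isLittleO_nhds_zero, Asymptotics.isLittleO_iff]
  intro c hc
  have hcpt : IsCompact (range γ) := isCompact_range γ.continuous
  have huc := hcpt.uniformContinuousAt_of_continuousAt (fderiv ℝ f)
    (fun x _ => (hf.continuous_fderiv one_ne_zero).continuousAt) (Metric.dist_mem_uniformity hc)
  obtain ⟨δ, hδ, hδ'⟩ := Metric.mem_uniformity_dist.1 huc
  filter_upwards [Metric.ball_mem_nhds (0 : C(K, E)) hδ] with h hh
  rw [ContinuousMap.norm_le _ (by positivity)]
  intro s
  have hs : ‖h s‖ < δ := (h.norm_coe_le_norm s).trans_lt (by simpa using hh)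
  have key := (convex_ball (γ s) δ).norm_image_sub_le_of_norm_fderiv_le' (𝕜 := ℝ) (f := f)
    (φ := fderiv ℝ f (γ s)) (C := c) (x := γ s) (y := γ s + h s)
    (fun x _ => (hf.differentiable one_ne_zero) x) (fun x hx => by
      have := hδ' (a := γ s) (b := x) (by rw [dist_comm]; exact hx) (mem_range_self s)
      rw [← dist_eq_norm, dist_comm]; exact this.le) (Metric.mem_ball_self hδ) (by simpa using hs)
  simp only [ContinuousMap.coe_sub, Pi.sub_apply, ContinuousMap.comp_apply, ContinuousMap.coe_mk,
    ContinuousMap.coe_add, Pi.add_apply, pointwise_apply]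
  simp only [add_sub_cancel_left] at key
  exact key.trans (by gcongr; exact h.norm_coe_le_norm s)

/-- The superposition operator of a `C^n` map is `C^n` on the Banach space of continuous
functions. -/
lemma contDiff_comp_nat (n : ℕ) : ∀ {F : Type} [NormedAddCommGroup F] [NormedSpace ℝ F]
    {f : E → F} (hf : ContDiff ℝ n f),
    ContDiff ℝ n (fun γ : C(K, E) => (⟨f, hf.continuous⟩ : C(E, F)).comp γ) := by
  induction n with
  | zero =>
    intro F _ _ f hf
    simp only [Nat.cast_zero] at hf ⊢
    rw [contDiff_zero]
    exact ContinuousMap.continuous_postcomp _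
  | succ n ih =>
    intro F _ _ f hf
    have h1 : ContDiff ℝ 1 f := hf.of_le (by exact_mod_cast Nat.le_add_left 1 n)
    push_cast at hf ⊢
    rw [contDiff_succ_iff_hasFDerivAt]
    have h2 : ContDiff ℝ n (fderiv ℝ f) := (contDiff_succ_iff_fderiv.1 hf).2.2
    exact ⟨fun γ => pointwise (.id ℝ (E →L[ℝ] F)) ((⟨fderiv ℝ f, h2.continuous⟩ : C(E, E →L[ℝ] F)).comp γ),
      (pointwise (K := K) (.id ℝ (E →L[ℝ] F))).contDiff.comp (ih h2), fun γ => hasFDerivAt_comp h1 γ⟩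

lemma contDiff_comp {f : E → F} (hf : ContDiff ℝ ∞ f) :
    ContDiff ℝ ∞ (fun γ : C(K, E) => (⟨f, hf.continuous⟩ : C(E, F)).comp γ) :=
  contDiff_infty.2 fun n => contDiff_comp_nat n (hf.of_le (by exact_mod_cast le_top))

end Superposition

section Flow

variable {E : Type} [NormedAddCommGroup E] [NormedSpace ℝ E]

/-- The operator `γ ↦ (s ↦ ∫₀ˢ γ)` on continuous functions on `[0, 1]`. -/
noncomputable def primitive : C(Icc (0 : ℝ) 1, E) →L[ℝ] C(Icc (0 : ℝ) 1, E) :=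
  LinearMap.mkContinuous
    { toFun := fun γ => ⟨fun s => ∫ τ in (0 : ℝ)..s, IccExtend zero_le_one γ τ, by
        have h : Continuous (IccExtend zero_le_one γ) := γ.continuous.Icc_extend'
        exact (intervalIntegral.continuous_primitive (fun a b => h.intervalIntegrable a b) 0).comp
          continuous_subtype_val⟩
      map_add' := fun γ η => by
        ext s
        exact intervalIntegral.integral_add (γ.continuous.Icc_extend'.intervalIntegrable _ _)
          (η.continuous.Icc_extend'.intervalIntegrable _ _)
      map_smul' := fun c γ => by
        ext s
        exact intervalIntegral.integral_smul _ _ } 1 (by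
    intro γ
    rw [ContinuousMap.norm_le _ (by positivity)]
    intro s
    have h := intervalIntegral.norm_integral_le_of_norm_le_const (a := (0 : ℝ)) (b := s)
      (C := ‖γ‖) (f := IccExtend zero_le_one γ) (fun τ _ => γ.norm_coe_le_norm _)
    refine h.trans ?_
    rw [one_mul, sub_zero, abs_of_nonneg s.2.1]
    exact mul_le_of_le_one_right (norm_nonneg _) s.2.2)

lemma norm_primitive_le (γ : C(Icc (0 : ℝ) 1, E)) : ‖primitive γ‖ ≤ ‖γ‖ := by
  simpa using (primitive (E := E)).le_of_opNorm_le (LinearMap.mkContinuous_norm_le _ zero_le_one _) γ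

variable {K : NNReal} {f : E → E}

/-- The Picard operator `γ ↦ (s ↦ x + ε ∫₀ˢ f ∘ γ)` on curves parametrized by `[0, 1]`; its fixed
point is the solution with initial value `x`, run at the speed `ε`. -/
noncomputable def picardMap (hf : Continuous f) (p : E × ℝ) (γ : C(Icc (0 : ℝ) 1, E)) :
    C(Icc (0 : ℝ) 1, E) :=
  ContinuousLinearMap.const ℝ (Icc (0 : ℝ) 1) p.1
    + p.2 • primitive ((⟨f, hf⟩ : C(E, E)).comp γ)

lemma picardMap_apply (hf : Continuous f) (p : E × ℝ) (γ : C(Icc (0 : ℝ) 1, E))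
    (s : Icc (0 : ℝ) 1) :
    picardMap hf p γ s = p.1 + p.2 • ∫ τ in (0 : ℝ)..s, f (IccExtend zero_le_one γ τ) := rfl

lemma norm_picardMap_sub_le (hf : LipschitzWith K f) (p : E × ℝ) (γ η : C(Icc (0 : ℝ) 1, E)) :
    ‖picardMap hf.continuous p γ - picardMap hf.continuous p η‖ ≤ |p.2| * K * ‖γ - η‖ := by
  have h1 : picardMap hf.continuous p γ - picardMap hf.continuous p η
      = p.2 • primitive ((⟨f, hf.continuous⟩ : C(E, E)).comp γ
        - (⟨f, hf.continuous⟩ : C(E, E)).comp η) := by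
    simp [picardMap, smul_sub]
  rw [h1, norm_smul, mul_assoc, Real.norm_eq_abs]
  gcongr
  refine (norm_primitive_le _).trans ?_
  rw [ContinuousMap.norm_le _ (by positivity)]
  intro s
  calc ‖f (γ s) - f (η s)‖ ≤ K * ‖γ s - η s‖ := hf.norm_sub_le _ _
    _ ≤ K * ‖γ - η‖ := by gcongr; exact (γ - η).norm_coe_le_norm s

lemma exists_picardMap_eq [CompleteSpace E] (hf : LipschitzWith K f) {p : E × ℝ} (hp : |p.2| * K < 1) :
    ∃ γ, picardMap hf.continuous p γ = γ := by
  have hc : ContractingWith ⟨|p.2| * K, by positivity⟩ (picardMap hf.continuous p) :=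
    ⟨by exact_mod_cast hp, LipschitzWith.of_dist_le_mul fun γ η => by
      rw [dist_eq_norm, dist_eq_norm]; exact norm_picardMap_sub_le hf p γ η⟩
  exact ⟨hc.fixedPoint, hc.fixedPoint_isFixedPt⟩

lemma picardMap_eq_unique (hf : LipschitzWith K f) {p : E × ℝ} (hp : |p.2| * K < 1)
    {γ η : C(Icc (0 : ℝ) 1, E)} (hγ : picardMap hf.continuous p γ = γ)
    (hη : picardMap hf.continuous p η = η) : γ = η := by
  have h := norm_picardMap_sub_le hf p γ η
  rw [hγ, hη] at h
  have h0 : ‖γ - η‖ = 0 := by nlinarith [norm_nonneg (γ - η)]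
  exact sub_eq_zero.1 (norm_eq_zero.1 h0)

lemma contDiff_picardMap (hf : ContDiff ℝ ∞ f) :
    ContDiff ℝ ∞ (fun q : (E × ℝ) × C(Icc (0 : ℝ) 1, E) => picardMap hf.continuous q.1 q.2) := by
  unfold picardMap
  have h1 : ContDiff ℝ ∞ (fun q : (E × ℝ) × C(Icc (0 : ℝ) 1, E) =>
      ContinuousLinearMap.const ℝ (Icc (0 : ℝ) 1) q.1.1) :=
    (ContinuousLinearMap.const (M := E) ℝ (Icc (0 : ℝ) 1)).contDiff.comp (contDiff_fst.comp contDiff_fst)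
  have h2 : ContDiff ℝ ∞ (fun q : (E × ℝ) × C(Icc (0 : ℝ) 1, E) =>
      primitive ((⟨f, hf.continuous⟩ : C(E, E)).comp q.2)) :=
    primitive.contDiff.comp ((contDiff_comp hf).comp contDiff_snd)
  exact h1.add ((contDiff_snd.comp contDiff_fst).smul h2)

/-- The fixed point of the Picard operator depends smoothly on the parameters: `γ - T γ` has the
invertible derivative `1 - DT` with respect to `γ`, so that the implicit function theorem applies.
-/
lemma contDiffAt_of_picardMap_eq [CompleteSpace E] (hf : LipschitzWith K f) (hs : ContDiff ℝ ∞ f)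
    {σ : E × ℝ → C(Icc (0 : ℝ) 1, E)}
    (hσ : ∀ p : E × ℝ, |p.2| * K < 1 → picardMap hf.continuous p (σ p) = σ p)
    {p : E × ℝ} (hp : |p.2| * K < 1) : ContDiffAt ℝ ∞ σ p := by
  set Φ : (E × ℝ) × C(Icc (0 : ℝ) 1, E) → C(Icc (0 : ℝ) 1, E) :=
    fun q => q.2 - picardMap hf.continuous q.1 q.2 with hΦ
  have hΦs : ContDiff ℝ ∞ Φ := contDiff_snd.sub (contDiff_picardMap hs)
  have hne : (∞ : ℕ∞ω) ≠ 0 := by simp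
  set A : C(Icc (0 : ℝ) 1, E) →L[ℝ] C(Icc (0 : ℝ) 1, E) :=
    fderiv ℝ (fun γ => picardMap hf.continuous p γ) (σ p) with hA
  have hTs : ContDiff ℝ ∞ (fun γ => picardMap hf.continuous p γ) :=
    (contDiff_picardMap hs).comp (contDiff_const.prodMk contDiff_id)
  have hAn : ‖A‖ < 1 := by
    refine lt_of_le_of_lt ?_ hp
    have hL : LipschitzWith ⟨|p.2| * K, by positivity⟩ (fun γ => picardMap hf.continuous p γ) :=
      LipschitzWith.of_dist_le_mul fun γ η => by
        rw [dist_eq_norm, dist_eq_norm]; exact norm_picardMap_sub_le hf p γ η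
    exact norm_fderiv_le_of_lipschitz ℝ hL
  have hinr : fderiv ℝ Φ (p, σ p) ∘L .inr ℝ (E × ℝ) C(Icc (0 : ℝ) 1, E) = 1 - A := by
    have h1 : HasFDerivAt (fun γ => Φ (p, γ))
        (fderiv ℝ Φ (p, σ p) ∘L .inr ℝ (E × ℝ) C(Icc (0 : ℝ) 1, E)) (σ p) :=
      ((hΦs.differentiable hne) (p, σ p)).hasFDerivAt.comp (σ p) (hasFDerivAt_prodMk_right p (σ p))
    have h2 : HasFDerivAt (fun γ => Φ (p, γ)) (1 - A) (σ p) :=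
      (hasFDerivAt_id (σ p)).sub ((hTs.differentiable hne) (σ p)).hasFDerivAt
    exact h1.unique h2
  have hinv : (fderiv ℝ Φ (p, σ p) ∘L .inr ℝ (E × ℝ) C(Icc (0 : ℝ) 1, E)).IsInvertible := by
    rw [hinr]
    exact ⟨ContinuousLinearEquiv.unitsEquiv ℝ _ (Units.oneSub A hAn), rfl⟩
  have hc : ContDiffAt ℝ ∞ Φ (p, σ p) := hΦs.contDiffAt
  -- by uniqueness of fixed points the implicit function is `σ`
  refine (hc.contDiffAt_implicitFunction hne hinv).congr_of_eventuallyEq ?_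
  have hopen : ∀ᶠ q : E × ℝ in 𝓝 p, |q.2| * K < 1 :=
    (continuous_snd.abs.mul continuous_const).continuousAt.eventually_lt continuousAt_const hp
  filter_upwards [hc.eventually_apply_implicitFunction hne hinv, hopen] with q hq hq'
  have h0 : Φ (p, σ p) = 0 := by simp only [hΦ, hσ p hp, sub_self]
  rw [h0] at hq
  exact picardMap_eq_unique hf hq' (hσ q hq') (sub_eq_zero.1 hq).symm

/-- A smooth globally Lipschitz vector field has a smooth local flow, defined for a time that does
not depend on the initial point. The time `t` is treated as a parameter of the Picard operator on
curves over `[0, 1]`; the flow is the fixed point evaluated at `1`, so that it is smooth jointly in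
the initial point and in time. -/
theorem exists_contDiffOn_flow [CompleteSpace E] (hf : LipschitzWith K f) (hs : ContDiff ℝ ∞ f) :
    ∃ δ > 0, ∃ φ : E → ℝ → E, ContDiffOn ℝ ∞ (fun q : E × ℝ => φ q.1 q.2) (univ ×ˢ Ioo (-δ) δ) ∧
      (∀ x, φ x 0 = x) ∧ ∀ x, ∀ t ∈ Ioo (-δ) δ, HasDerivAt (φ x) (f (φ x t)) t := by
  have hK : (0 : ℝ) < K + 1 := by positivity
  have hδ : ∀ t : ℝ, t ∈ Ioo (-(1 / ((K : ℝ) + 1))) (1 / (K + 1)) → |t| * K < 1 := by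
    intro t ht
    have h1 : |t| < 1 / (K + 1) := abs_lt.2 ht
    rw [lt_div_iff₀ hK] at h1
    nlinarith [abs_nonneg t]
  have hex : ∀ p : E × ℝ, ∃ γ : C(Icc (0 : ℝ) 1, E), |p.2| * K < 1 →
      picardMap hf.continuous p γ = γ := by
    intro p
    by_cases hp : |p.2| * K < 1
    · obtain ⟨γ, hγ⟩ := exists_picardMap_eq hf hp
      exact ⟨γ, fun _ => hγ⟩
    · exact ⟨0, fun h => absurd h hp⟩
  choose σ hσ using hex
  let one : Icc (0 : ℝ) 1 := ⟨1, by simp⟩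
  have hsm : ContDiffOn ℝ ∞ (fun q : E × ℝ => σ (q.1, q.2) one)
      (univ ×ˢ Ioo (-(1 / ((K : ℝ) + 1))) (1 / (K + 1))) := by
    intro q hq
    have := contDiffAt_of_picardMap_eq hf hs hσ (hδ _ hq.2)
    exact ((ContinuousMap.evalCLM ℝ one).contDiff.contDiffAt.comp q this).contDiffWithinAt
  -- by uniqueness of the fixed point, the solution at speed `t s` is `r ↦ σ (x, t) (s r)`
  have hscale : ∀ x, ∀ t ∈ Ioo (-(1 / ((K : ℝ) + 1))) (1 / (K + 1)), ∀ s : Icc (0 : ℝ) 1,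
      σ (x, t) s = σ (x, t * s) one := by
    intro x t ht s
    have hts : |t * s| * K < 1 := by
      have h1 := hδ t ht
      rw [abs_mul, abs_of_nonneg s.2.1]
      have h2 : |t| * s ≤ |t| := mul_le_of_le_one_right (abs_nonneg t) s.2.2
      nlinarith [K.2, mul_le_mul_of_nonneg_right h2 K.2]
    let η : C(Icc (0 : ℝ) 1, E) := ⟨fun r => σ (x, t) ⟨s * r, mul_nonneg s.2.1 r.2.1,
      mul_le_one₀ s.2.2 r.2.1 r.2.2⟩, by fun_prop⟩
    have hη : picardMap hf.continuous (x, t * s) η = η := by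
      ext r
      have h1 := congrArg (fun γ : C(Icc (0 : ℝ) 1, E) => γ ⟨s * r, mul_nonneg s.2.1 r.2.1,
        mul_le_one₀ s.2.2 r.2.1 r.2.2⟩) (hσ (x, t) (hδ t ht))
      simp only [picardMap_apply] at h1 ⊢
      show _ = σ (x, t) ⟨s * r, _⟩
      rw [← h1, mul_smul]
      congr 2
      have h2 := intervalIntegral.smul_integral_comp_mul_left
        (fun τ => f (IccExtend zero_le_one (σ (x, t)) τ)) (s : ℝ) (a := 0) (b := r)
      rw [mul_zero] at h2
      rw [← h2]
      congr 1
      apply intervalIntegral.integral_congr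
      intro τ hτ
      rw [uIcc_of_le r.2.1] at hτ
      have hτ1 : τ ∈ Icc (0 : ℝ) 1 := ⟨hτ.1, hτ.2.trans r.2.2⟩
      have hτ2 : (s : ℝ) * τ ∈ Icc (0 : ℝ) 1 :=
        ⟨mul_nonneg s.2.1 hτ1.1, mul_le_one₀ s.2.2 hτ1.1 hτ1.2⟩
      simp only
      rw [IccExtend_of_mem _ _ hτ1, IccExtend_of_mem _ _ hτ2]
      rfl
    have h3 := picardMap_eq_unique hf hts (hσ (x, t * s) hts) hη
    rw [h3]
    show _ = σ (x, t) ⟨s * 1, _⟩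
    congr 1
    ext
    simp
  refine ⟨1 / (K + 1), by positivity, fun x t => σ (x, t) one, hsm, ?_, ?_⟩
  · intro x
    have h := congrArg (fun γ : C(Icc (0 : ℝ) 1, E) => γ one) (hσ (x, 0) (by simp))
    simp only [picardMap_apply, zero_smul, add_zero] at h
    exact h.symm
  · intro x t ht
    set I := Ioo (-(1 / ((K : ℝ) + 1))) (1 / (K + 1)) with hI
    have hcont : ContinuousOn (fun t => σ (x, t) one) I :=
      hsm.continuousOn.comp (f := fun t : ℝ => (x, t)) (by fun_prop) (fun t ht => ⟨mem_univ _, ht⟩)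
    have hfc : ContinuousOn (fun t => f (σ (x, t) one)) I := hf.continuous.comp_continuousOn hcont
    have h0I : (0 : ℝ) ∈ I := ⟨by simp; positivity, by positivity⟩
    have hint : ∀ t ∈ I, σ (x, t) one = x + ∫ τ in (0 : ℝ)..t, f (σ (x, τ) one) := by
      intro t ht
      have h := congrArg (fun γ : C(Icc (0 : ℝ) 1, E) => γ one) (hσ (x, t) (hδ t ht))
      simp only [picardMap_apply] at h
      rw [← h]
      congr 1
      have h2 := intervalIntegral.smul_integral_comp_mul_left
        (fun τ => f (σ (x, τ) one)) t (a := 0) (b := 1)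
      rw [mul_zero, mul_one] at h2
      rw [← h2]
      congr 1
      apply intervalIntegral.integral_congr
      intro τ hτ
      rw [uIcc_of_le zero_le_one] at hτ
      simp only
      rw [IccExtend_of_mem _ _ hτ, hscale x t ht]
    have hder : HasDerivAt (fun t => x + ∫ τ in (0 : ℝ)..t, f (σ (x, τ) one))
        (f (σ (x, t) one)) t := by
      refine HasDerivAt.const_add x (intervalIntegral.integral_hasDerivAt_right ?_ ?_ ?_)
      · apply ContinuousOn.intervalIntegrable
        exact hfc.mono ((convex_Ioo _ _).ordConnected.uIcc_subset h0I ht)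
      · exact hfc.stronglyMeasurableAtFilter isOpen_Ioo t ht
      · exact hfc.continuousAt (isOpen_Ioo.mem_nhds ht)
    refine hder.congr_of_eventuallyEq ?_
    filter_upwards [isOpen_Ioo.mem_nhds ht] with t' ht'
    exact hint t' ht'

end Flow

section LocalFlow

variable {E : Type} [NormedAddCommGroup E] [NormedSpace ℝ E] [FiniteDimensional ℝ E]

/-- A vector field that is smooth near a compact set agrees near this set with a globally Lipschitz
smooth vector field. -/
lemma exists_lipschitz_extension {Ω C : Set E} (hΩ : IsOpen Ω) (hC : IsCompact C) (hCΩ : C ⊆ Ω)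
    {f : E → E} (hf : ContDiffOn ℝ ∞ f Ω) :
    ∃ (g : E → E) (K : NNReal) (W : Set E), ContDiff ℝ ∞ g ∧ LipschitzWith K g ∧ IsOpen W ∧ C ⊆ W ∧
      W ⊆ Ω ∧ EqOn g f W := by
  -- multiply the field by a cutoff function
  obtain ⟨V, hV, hCV, hVΩ, hVc⟩ := exists_open_between_and_isCompact_closure hC hΩ hCΩ
  obtain ⟨χ, h0, h1, -⟩ := exists_contMDiffMap_zero_one_nhds_of_isClosed 𝓘(ℝ, E) (n := (⊤ : ℕ∞))
    hV.isClosed_compl hC.isClosed (disjoint_compl_left_iff_subset.2 hCV)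
  have hχ : ContDiff ℝ ∞ χ := χ.contMDiff.contDiff
  have hz : ∀ x ∉ V, ∀ᶠ y in 𝓝 x, χ y = 0 := fun x hx => (mem_nhdsSet_iff_forall.1 h0) x hx
  have hg : ContDiff ℝ ∞ (fun x => χ x • f x) := by
    rw [contDiff_iff_contDiffAt]
    intro x
    by_cases hx : x ∈ V
    · exact hχ.contDiffAt.smul (hf.contDiffAt (hΩ.mem_nhds (hVΩ (subset_closure hx))))
    · refine (contDiffAt_const (c := (0 : E))).congr_of_eventuallyEq ?_
      filter_upwards [hz x hx] with y hy
      simp [hy]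
  have hcs : HasCompactSupport (fun x => χ x • f x) := by
    refine HasCompactSupport.intro hVc fun x hx => ?_
    have := (hz x fun h => hx (subset_closure h)).self_of_nhds
    simp [this]
  obtain ⟨K, hK⟩ := hg.lipschitzWith_of_hasCompactSupport hcs (by simp)
  obtain ⟨U, hU, hCU, hU1⟩ := mem_nhdsSet_iff_exists.1 h1
  refine ⟨_, K, U ∩ Ω, hg, hK, hU.inter hΩ, subset_inter hCU hCΩ, inter_subset_right, ?_⟩
  intro x hx
  have : χ x = 1 := hU1 hx.1
  simp [this]

/-- The local flow of a smooth vector field near a compact set of initial points. -/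
theorem exists_contDiffOn_local_flow {Ω C : Set E} (hΩ : IsOpen Ω) (hC : IsCompact C) (hCΩ : C ⊆ Ω)
    {f : E → E} (hf : ContDiffOn ℝ ∞ f Ω) :
    ∃ W, IsOpen W ∧ C ⊆ W ∧ ∃ δ > 0, ∃ φ : E → ℝ → E,
      ContDiffOn ℝ ∞ (fun q : E × ℝ => φ q.1 q.2) (W ×ˢ Ioo (-δ) δ) ∧ (∀ x, φ x 0 = x) ∧
      ∀ x ∈ W, ∀ t ∈ Ioo (-δ) δ, φ x t ∈ Ω ∧ HasDerivAt (φ x) (f (φ x t)) t := by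
  obtain ⟨g, K, V, hg, hK, hV, hCV, hVΩ, hgf⟩ := exists_lipschitz_extension hΩ hC hCΩ hf
  obtain ⟨δ, hδ, φ, hφ, hφ0, hφd⟩ := exists_contDiffOn_flow hK hg
  have hopen : IsOpen ((univ ×ˢ Ioo (-δ) δ) ∩ (fun q : E × ℝ => φ q.1 q.2) ⁻¹' V) :=
    hφ.continuousOn.isOpen_inter_preimage (isOpen_univ.prod isOpen_Ioo) hV
  obtain ⟨W, T, hW, hT, hCW, h0T, hWT⟩ := generalized_tube_lemma hC (isCompact_singleton (x := (0 : ℝ)))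
    hopen (by
      rintro ⟨x, t⟩ ⟨hx, ht⟩
      obtain rfl : t = 0 := ht
      exact ⟨⟨mem_univ _, by simpa using hδ⟩, by simpa [hφ0] using hCV hx⟩)
  obtain ⟨η, hη, hηT⟩ := Metric.isOpen_iff.1 hT 0 (h0T rfl)
  have hsub : ∀ x ∈ W, ∀ t ∈ Ioo (-η) η, t ∈ Ioo (-δ) δ ∧ φ x t ∈ V := by
    intro x hx t ht
    have : (x, t) ∈ W ×ˢ T := ⟨hx, hηT (by rw [Real.ball_eq_Ioo]; simpa using ht)⟩
    exact ⟨(hWT this).1.2, (hWT this).2⟩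
  refine ⟨W, hW, hCW, η, hη, φ, hφ.mono ?_, hφ0, ?_⟩
  · rintro ⟨x, t⟩ ⟨hx, ht⟩
    exact ⟨mem_univ _, (hsub x hx t ht).1⟩
  · intro x hx t ht
    obtain ⟨h1, h2⟩ := hsub x hx t ht
    refine ⟨hVΩ h2, ?_⟩
    rw [← hgf h2]
    exact hφd x t h1

end LocalFlow

end SmoothFlow

namespace NewtonianDynamics

open Set Filter Topology

noncomputable section

/-! ### The metric and the force in local coordinates -/

lemma contMDiff_tangentPair :
    ContMDiff 𝓘(ℝ, Coord × Coord) (𝓡 2).tangent ∞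
      (fun q : Coord × Coord => (⟨q.1, q.2⟩ : TangentBundle (𝓡 2) Coord)) := by
  intro q
  rw [Bundle.contMDiffAt_totalSpace]
  refine ⟨contDiff_fst.contMDiff.contMDiffAt, ?_⟩
  convert! (contDiff_snd (𝕜 := ℝ) (E := Coord) (F := Coord)
    (n := ∞)).contMDiff.contMDiffAt (x := q) using 1
  ext y
  simp

section

variable {M : Type*} [TopologicalSpace M] [ChartedSpace Coord M] [IsManifold (𝓡 2) ∞ M]
  {e : OpenPartialHomeomorph M Coord}

omit [IsManifold (𝓡 2) ∞ M] in
lemma mdifferentiable_of_mem_maximalAtlas (he : e ∈ IsManifold.maximalAtlas (𝓡 2) ∞ M) :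
    e.MDifferentiable (𝓡 2) (𝓡 2) :=
  ⟨(contMDiffOn_of_mem_maximalAtlas he).mdifferentiableOn (by simp),
    (contMDiffOn_symm_of_mem_maximalAtlas he).mdifferentiableOn (by simp)⟩

lemma tangentVector_ne_zero (he : e ∈ IsManifold.maximalAtlas (𝓡 2) ∞ M) {x v : Coord}
    (hx : x ∈ e.target) (hv : v ≠ 0) : tangentVector e x v ≠ 0 := by
  have h := (mdifferentiable_of_mem_maximalAtlas he).symm.ker_mfderiv_eq_bot (x := x) hx
  intro h0
  exact hv ((LinearMap.ker_eq_bot'.1 h) v h0)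

lemma contMDiffOn_tangentVector (he : e ∈ IsManifold.maximalAtlas (𝓡 2) ∞ M) :
    ContMDiffOn 𝓘(ℝ, Coord × Coord) (𝓡 2).tangent ∞
      (fun q : Coord × Coord => (⟨e.symm q.1, tangentVector e q.1 q.2⟩ : TangentBundle (𝓡 2) M))
      (e.target ×ˢ univ) := by
  have h1 : IsManifold (𝓡 2) 1 M := IsManifold.of_le (n := ∞) (by simp)
  have h : ContMDiffOn (𝓡 2).tangent (𝓡 2).tangent ∞
      (tangentMapWithin (𝓡 2) (𝓡 2) e.symm e.target)
      ((Bundle.TotalSpace.proj : TangentBundle (𝓡 2) Coord → Coord) ⁻¹' e.target) :=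
    (contMDiffOn_symm_of_mem_maximalAtlas he).contMDiffOn_tangentMapWithin (m := ∞)
      (by simp) e.open_target.uniqueMDiffOn
  have h2 : ContMDiffOn 𝓘(ℝ, Coord × Coord) (𝓡 2).tangent ∞
      (fun q : Coord × Coord => tangentMapWithin (𝓡 2) (𝓡 2) e.symm e.target
        (⟨q.1, q.2⟩ : TangentBundle (𝓡 2) Coord)) (e.target ×ˢ univ) :=
    h.comp contMDiff_tangentPair.contMDiffOn (fun q hq => hq.1)
  refine h2.congr ?_
  rintro q hq
  have hd : MDifferentiableAt (𝓡 2) (𝓡 2) e.symm q.1 :=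
    (mdifferentiable_of_mem_maximalAtlas he).symm.mdifferentiableAt hq.1
  exact (tangentMapWithin_eq_tangentMap (p := (⟨q.1, q.2⟩ : TangentBundle (𝓡 2) Coord))
    (e.open_target.uniqueMDiffOn q.1 hq.1) hd).symm

lemma contDiffOn_forceUp (F : ForceField M) (he : e ∈ IsManifold.maximalAtlas (𝓡 2) ∞ M) :
    ContDiffOn ℝ ∞ (fun q : Coord × Coord => forceUp F e q.1 q.2)
      {q | q.1 ∈ e.target ∧ q.2 ≠ 0} := by
  have h1 : IsManifold (𝓡 2) 1 M := IsManifold.of_le (n := ∞) (by simp)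
  have h := (contMDiffOn_of_mem_maximalAtlas he).contMDiffOn_tangentMapWithin (m := ∞)
    (by simp) e.open_source.uniqueMDiffOn
  rw [← contMDiffOn_iff_contDiffOn]
  have hV : ContMDiffOn 𝓘(ℝ, Coord × Coord) (𝓡 2).tangent ∞
      (fun q : Coord × Coord => (⟨e.symm q.1, tangentVector e q.1 q.2⟩ : TangentBundle (𝓡 2) M))
      {q | q.1 ∈ e.target ∧ q.2 ≠ 0} :=
    (contMDiffOn_tangentVector he).mono fun q hq => ⟨hq.1, mem_univ _⟩
  have hF : ContMDiffOn 𝓘(ℝ, Coord × Coord) (𝓡 2).tangent ∞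
      (fun q : Coord × Coord => (⟨e.symm q.1, F.toFun (e.symm q.1) (tangentVector e q.1 q.2)⟩ :
        TangentBundle (𝓡 2) M)) {q | q.1 ∈ e.target ∧ q.2 ≠ 0} :=
    F.smooth.comp hV (fun q hq => tangentVector_ne_zero he hq.1 hq.2)
  have h2 := h.comp hF (fun q hq => e.map_target hq.1)
  refine ((contMDiff_snd_tangentBundle_modelSpace Coord (𝓡 2)).comp_contMDiffOn h2).congr ?_
  rintro q hq
  have hd : MDifferentiableAt (𝓡 2) (𝓡 2) e (e.symm q.1) :=
    (mdifferentiable_of_mem_maximalAtlas he).mdifferentiableAt (e.map_target hq.1)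
  have h3 := tangentMapWithin_eq_tangentMap
    (p := (⟨e.symm q.1, F.toFun (e.symm q.1) (tangentVector e q.1 q.2)⟩ : TangentBundle (𝓡 2) M))
    (e.open_source.uniqueMDiffOn _ (e.map_target hq.1)) hd
  exact (congrArg (fun p : TangentBundle (𝓡 2) Coord => (p.2 : Coord)) h3).symm

variable [Bundle.RiemannianBundle (fun p : M => TangentSpace (𝓡 2) p)]

omit [IsManifold (𝓡 2) ∞ M] in
lemma scalarProd_eq_sum (e : OpenPartialHomeomorph M Coord) (x w z : Coord) :
    scalarProd e x w z = ∑ i, ∑ j, metric e x i j * w i * z j := by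
  have hw : ∀ w : Coord, w = ∑ i, w i • basisVec i := by
    intro w; ext k; fin_cases k <;> simp
  have ht : ∀ w : Coord, tangentVector e x w = ∑ i, w i • tangentVector e x (basisVec i) := by
    intro w
    let L : Coord →L[ℝ] TangentSpace (𝓡 2) (e.symm x) := mfderiv (𝓡 2) (𝓡 2) e.symm x
    show L w = ∑ i, w i • L (basisVec i)
    conv_lhs => rw [hw w]
    simp only [map_sum, map_smul]
  unfold scalarProd
  rw [ht w, ht z, sum_inner]
  simp only [inner_sum, real_inner_smul_left, real_inner_smul_right]
  refine Finset.sum_congr rfl fun i _ => Finset.sum_congr rfl fun j _ => ?_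
  simp only [metric, scalarProd, Matrix.of_apply]
  ring

omit [IsManifold (𝓡 2) ∞ M] in
lemma metric_symm (e : OpenPartialHomeomorph M Coord) (x : Coord) (i j : Fin 2) :
    metric e x i j = metric e x j i := by
  simp only [metric, scalarProd, Matrix.of_apply]
  exact real_inner_comm _ _

lemma scalarProd_self_pos (he : e ∈ IsManifold.maximalAtlas (𝓡 2) ∞ M) {x v : Coord}
    (hx : x ∈ e.target) (hv : v ≠ 0) : 0 < scalarProd e x v v :=
  real_inner_self_pos.2 (tangentVector_ne_zero he hx hv)

lemma contDiffOn_metric [IsContMDiffRiemannianBundle (𝓡 2) ∞ Coord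
      (fun p : M => TangentSpace (𝓡 2) p)]
    (he : e ∈ IsManifold.maximalAtlas (𝓡 2) ∞ M) (i j : Fin 2) :
    ContDiffOn ℝ ∞ (fun x => metric e x i j) e.target := by
  rw [← contMDiffOn_iff_contDiffOn]
  have h : ∀ w : Coord, ContMDiffOn 𝓘(ℝ, Coord) (𝓡 2).tangent ∞
      (fun x : Coord => (⟨e.symm x, tangentVector e x w⟩ : TangentBundle (𝓡 2) M)) e.target := by
    intro w
    refine (contMDiffOn_tangentVector he).comp (f := fun x : Coord => (x, w)) ?_
      (fun x hx => ⟨hx, mem_univ _⟩)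
    exact (contDiff_id.prodMk contDiff_const).contMDiff.contMDiffOn
  exact (h (basisVec i)).inner_bundle (h (basisVec j))

end

lemma coord_eq_sum (w : Coord) : w = ∑ i, w i • basisVec i := by
  ext k; fin_cases k <;> simp

/-- A linear functional on `ℝ²` is determined by its values on the coordinate vectors. -/
lemma sum_mul_apply_basisVec (L : Coord →L[ℝ] ℝ) (z : Coord) : ∑ i, z i * L (basisVec i) = L z := by
  conv_rhs => rw [coord_eq_sum z]
  simp only [map_sum, map_smul, smul_eq_mul]

lemma sum_mul_partialDeriv (h : Coord → ℝ) (y z : Coord) :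
    ∑ i, z i * partialDeriv i h y = fderiv ℝ h y z :=
  sum_mul_apply_basisVec _ z

lemma ContDiffOn.partialDeriv {h : Coord → ℝ} {s : Set Coord} (hs : IsOpen s)
    (hh : ContDiffOn ℝ ∞ h s) (i : Fin 2) :
    ContDiffOn ℝ ∞ (fun y => NewtonianDynamics.partialDeriv i h y) s :=
  (hh.fderiv_of_isOpen hs (m := ∞) (by simp)).clm_apply contDiffOn_const

section

variable {M : Type*} [TopologicalSpace M] {e : OpenPartialHomeomorph M Coord}

/-- The domain of coordinates `(x, v)` of tangent vectors on which the force is smooth. -/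
def phaseDomain (e : OpenPartialHomeomorph M Coord) : Set (Coord × Coord) :=
  {q | q.1 ∈ e.target ∧ q.2 ≠ 0}

lemma isOpen_phaseDomain (e : OpenPartialHomeomorph M Coord) : IsOpen (phaseDomain e) :=
  (e.open_target.preimage continuous_fst).inter (isOpen_ne.preimage continuous_snd)

lemma contDiffOn_phase_fst {E : Type*} [NormedAddCommGroup E] [NormedSpace ℝ E] {h : Coord → E}
    (hh : ContDiffOn ℝ ∞ h e.target) :
    ContDiffOn ℝ ∞ (fun q : Coord × Coord => h q.1) (phaseDomain e) :=
  hh.comp contDiffOn_fst fun _ hq => hq.1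

end

section

variable {M : Type*} [TopologicalSpace M] [ChartedSpace Coord M]
  [Bundle.RiemannianBundle (fun p : M => TangentSpace (𝓡 2) p)]

lemma scalarProd_comm (e : OpenPartialHomeomorph M Coord) (x w z : Coord) :
    scalarProd e x w z = scalarProd e x z w := real_inner_comm _ _

lemma scalarProd_add_left (e : OpenPartialHomeomorph M Coord) (x w w' z : Coord) :
    scalarProd e x (w + w') z = scalarProd e x w z + scalarProd e x w' z := by
  simp only [scalarProd_eq_sum, Fin.sum_univ_two, PiLp.add_apply]; ring

lemma scalarProd_smul_left (e : OpenPartialHomeomorph M Coord) (x w z : Coord) (c : ℝ) :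
    scalarProd e x (c • w) z = c * scalarProd e x w z := by
  simp only [scalarProd_eq_sum, Fin.sum_univ_two, PiLp.smul_apply, smul_eq_mul]; ring

lemma scalarProd_add_right (e : OpenPartialHomeomorph M Coord) (x w w' z : Coord) :
    scalarProd e x z (w + w') = scalarProd e x z w + scalarProd e x z w' := by
  simp only [scalarProd_eq_sum, Fin.sum_univ_two, PiLp.add_apply]; ring

lemma scalarProd_smul_right (e : OpenPartialHomeomorph M Coord) (x w z : Coord) (c : ℝ) :
    scalarProd e x z (c • w) = c * scalarProd e x z w := by
  simp only [scalarProd_eq_sum, Fin.sum_univ_two, PiLp.smul_apply, smul_eq_mul]; ring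

lemma ne_zero_of_scalarProd_self_eq_one {e : OpenPartialHomeomorph M Coord} {x w : Coord}
    (h : scalarProd e x w w = 1) : w ≠ 0 := by
  rintro rfl
  rw [← zero_smul ℝ (0 : Coord), scalarProd_smul_left, zero_mul] at h
  exact zero_ne_one h

variable [IsManifold (𝓡 2) ∞ M] {e : OpenPartialHomeomorph M Coord}

lemma speed_pos (he : e ∈ IsManifold.maximalAtlas (𝓡 2) ∞ M) {x v : Coord}
    (hx : x ∈ e.target) (hv : v ≠ 0) : 0 < speed e x v :=
  Real.sqrt_pos.2 (scalarProd_self_pos he hx hv)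

lemma speed_sq (he : e ∈ IsManifold.maximalAtlas (𝓡 2) ∞ M) {x v : Coord}
    (hx : x ∈ e.target) (hv : v ≠ 0) : speed e x v ^ 2 = scalarProd e x v v :=
  Real.sq_sqrt (scalarProd_self_pos he hx hv).le

lemma metric_det_pos (he : e ∈ IsManifold.maximalAtlas (𝓡 2) ∞ M) {x : Coord}
    (hx : x ∈ e.target) : 0 < (metric e x).det := by
  have hb0 : (basisVec 0 : Coord) ≠ 0 := by
    intro h; have := congrArg (fun w : Coord => w 0) h; simp at this
  have h00 : 0 < metric e x 0 0 := scalarProd_self_pos he hx hb0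
  -- the square of the length of this vector is `g₀₀ det g`
  let w : Coord := -metric e x 0 1 • basisVec 0 + metric e x 0 0 • basisVec 1
  have hw : w ≠ 0 := by
    intro h; have := congrArg (fun w : Coord => w 1) h; simp [w] at this; exact h00.ne' this
  have hp := scalarProd_self_pos he hx hw
  rw [scalarProd_eq_sum] at hp
  simp only [Fin.sum_univ_two, w, PiLp.add_apply, PiLp.smul_apply, smul_eq_mul,
    PiLp.single_apply] at hp
  simp at hp
  rw [metric_symm e x 1 0] at hp
  rw [Matrix.det_fin_two, metric_symm e x 1 0]
  have : 0 < metric e x 0 0 * (metric e x 0 0 * metric e x 1 1 - metric e x 0 1 * metric e x 0 1) := by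
    nlinarith
  exact (mul_pos_iff_of_pos_left h00).1 this

lemma christoffel_symm (e : OpenPartialHomeomorph M Coord) (x : Coord) (k i j : Fin 2) :
    christoffel e x k i j = christoffel e x k j i := by
  unfold christoffel
  congr 1
  refine Finset.sum_congr rfl fun s _ => ?_
  have h : ∀ a b, (fun y => metric e y a b) = fun y => metric e y b a :=
    fun a b => funext fun y => metric_symm e y a b
  rw [h s j, h i s, h i j]
  ring

/-- The metric connection with the lowered upper index. -/
lemma sum_metric_mul_christoffel (he : e ∈ IsManifold.maximalAtlas (𝓡 2) ∞ M) {x : Coord}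
    (hx : x ∈ e.target) (l i j : Fin 2) :
    ∑ k, metric e x l k * christoffel e x k i j =
      (1 / 2) * (partialDeriv i (fun y => metric e y l j) x + partialDeriv j (fun y => metric e y i l) x
      - partialDeriv l (fun y => metric e y i j) x) := by
  have hdet := (metric_det_pos he hx).ne'
  have hinv : metric e x * (metric e x)⁻¹ = 1 := Matrix.mul_nonsing_inv _ (isUnit_iff_ne_zero.2 hdet)
  have h : ∀ s, ∑ k, metric e x l k * (metric e x)⁻¹ k s = if l = s then 1 else 0 := by
    intro s
    have := congrFun (congrFun hinv l) s
    rw [Matrix.mul_apply, Matrix.one_apply] at this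
    exact this
  unfold christoffel
  have h0 := h 0
  have h1 := h 1
  simp only [Fin.sum_univ_two] at h0 h1 ⊢
  set A := partialDeriv i (fun y => metric e y 0 j) x + partialDeriv j (fun y => metric e y i 0) x
      - partialDeriv 0 (fun y => metric e y i j) x with hA
  set B := partialDeriv i (fun y => metric e y 1 j) x + partialDeriv j (fun y => metric e y i 1) x
      - partialDeriv 1 (fun y => metric e y i j) x with hB
  have : metric e x l 0 * (1 / 2 * ((metric e x)⁻¹ 0 0 * A + (metric e x)⁻¹ 0 1 * B)) +
      metric e x l 1 * (1 / 2 * ((metric e x)⁻¹ 1 0 * A + (metric e x)⁻¹ 1 1 * B))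
      = 1 / 2 * ((if l = 0 then 1 else 0) * A + (if l = 1 then 1 else 0) * B) := by
    rw [← h0, ← h1]; ring
  rw [this]
  fin_cases l <;> simp [hA, hB]

variable [IsContMDiffRiemannianBundle (𝓡 2) ∞ Coord (fun p : M => TangentSpace (𝓡 2) p)]

lemma contDiffOn_inv_metric (he : e ∈ IsManifold.maximalAtlas (𝓡 2) ∞ M) (i j : Fin 2) :
    ContDiffOn ℝ ∞ (fun x => (metric e x)⁻¹ i j) e.target := by
  have hg := contDiffOn_metric (M := M) he
  have hdet : ContDiffOn ℝ ∞ (fun x => (metric e x).det) e.target := by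
    simp only [Matrix.det_fin_two]
    exact ((hg 0 0).mul (hg 1 1)).sub ((hg 0 1).mul (hg 1 0))
  have hinv := hdet.inv fun x hx => (metric_det_pos he hx).ne'
  have h : ∀ x, (metric e x)⁻¹ i j = (metric e x).det⁻¹ * (metric e x).adjugate i j := by
    intro x
    rw [Matrix.inv_def, Ring.inverse_eq_inv', Matrix.smul_apply, smul_eq_mul]
  simp only [h, Matrix.adjugate_fin_two]
  refine hinv.mul ?_
  fin_cases i <;> fin_cases j <;> simp
  · exact hg 1 1
  · exact (hg 0 1).neg
  · exact (hg 1 0).neg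
  · exact hg 0 0

lemma contDiffOn_christoffel (he : e ∈ IsManifold.maximalAtlas (𝓡 2) ∞ M) (k i j : Fin 2) :
    ContDiffOn ℝ ∞ (fun x => christoffel e x k i j) e.target := by
  have hg := contDiffOn_metric (M := M) he
  unfold christoffel
  refine contDiffOn_const.mul (ContDiffOn.sum fun s _ => (contDiffOn_inv_metric he k s).mul ?_)
  exact ((ContDiffOn.partialDeriv e.open_target (hg s j) i).add
    (ContDiffOn.partialDeriv e.open_target (hg i s) j)).sub
    (ContDiffOn.partialDeriv e.open_target (hg i j) s)

lemma contDiff_coord (i : Fin 2) : ContDiff ℝ ∞ (fun w : Coord => w i) :=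
  (EuclideanSpace.proj i : Coord →L[ℝ] ℝ).contDiff

lemma contDiffOn_forceDown (F : ForceField M) (he : e ∈ IsManifold.maximalAtlas (𝓡 2) ∞ M)
    (i : Fin 2) :
    ContDiffOn ℝ ∞ (fun q : Coord × Coord => forceDown F e q.1 q.2 i) (phaseDomain e) := by
  unfold forceDown
  exact ContDiffOn.sum fun j _ => (contDiffOn_phase_fst (contDiffOn_metric he i j)).mul
    ((contDiff_coord j).comp_contDiffOn (contDiffOn_forceUp F he))

/-- The acceleration `ẍᵏ = Fᵏ - ∑ Γᵏᵢⱼ vⁱ vʲ` of the trajectory through the point `x` with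
velocity `v`. -/
def accel (F : ForceField M) (e : OpenPartialHomeomorph M Coord) (x v : Coord) : Coord :=
  forceUp F e x v - ∑ k, (∑ i, ∑ j, christoffel e x k i j * v i * v j) • basisVec k

lemma accel_apply (F : ForceField M) (e : OpenPartialHomeomorph M Coord) (x v : Coord) (k : Fin 2) :
    accel F e x v k = forceUp F e x v k - ∑ i, ∑ j, christoffel e x k i j * v i * v j := by
  unfold accel
  fin_cases k <;> simp

lemma contDiffOn_accel (F : ForceField M) (he : e ∈ IsManifold.maximalAtlas (𝓡 2) ∞ M) :
    ContDiffOn ℝ ∞ (fun q : Coord × Coord => accel F e q.1 q.2) (phaseDomain e) := by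
  unfold accel
  refine (contDiffOn_forceUp F he).sub (ContDiffOn.sum fun k _ => ?_)
  refine ContDiffOn.smul (f := fun q : Coord × Coord =>
    ∑ i, ∑ j, christoffel e q.1 k i j * q.2 i * q.2 j) ?_ contDiffOn_const
  refine ContDiffOn.sum fun i _ => ContDiffOn.sum fun j _ => ?_
  exact ((contDiffOn_phase_fst (contDiffOn_christoffel he k i j)).mul
    ((contDiff_coord i).comp contDiff_snd).contDiffOn).mul
    ((contDiff_coord j).comp contDiff_snd).contDiffOn

end

/-! ### The weak normality equations as conditions on two covectors -/

section

variable {M : Type*} [TopologicalSpace M] [ChartedSpace Coord M]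
  [Bundle.RiemannianBundle (fun p : M => TangentSpace (𝓡 2) p)]
  [IsManifold (𝓡 2) ∞ M] {e : OpenPartialHomeomorph M Coord}
  [IsContMDiffRiemannianBundle (𝓡 2) ∞ Coord (fun p : M => TangentSpace (𝓡 2) p)]

/-- The covector `∑ⱼ vʲ ∇̃ᵢFⱼ + 2 Fᵢ`, by which the covariant derivative of the variation vector
enters the second derivative of the deviation. -/
def velCoeff (F : ForceField M) (e : OpenPartialHomeomorph M Coord) (x v : Coord) (i : Fin 2) : ℝ :=
  ∑ j, v j * velGrad F e x v i j + 2 * forceDown F e x v i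

/-- The covector `∑ⱼ vʲ (∇ᵢFⱼ + ∇ⱼFᵢ) + ∑ⱼ Fʲ ∇̃ⱼFᵢ`, by which the variation vector itself enters
the second derivative of the deviation. -/
def posCoeff (F : ForceField M) (e : OpenPartialHomeomorph M Coord) (x v : Coord) (i : Fin 2) : ℝ :=
  ∑ j, v j * (spatGrad F e x v i j + spatGrad F e x v j i)
    + ∑ j, forceUp F e x v j * velGrad F e x v j i

/-- The value of `velCoeff` on `v / |v|²`: the coefficient of the first derivative of the deviation
in the equation for its second derivative. -/
def radialCoeff (F : ForceField M) (e : OpenPartialHomeomorph M Coord) (x v : Coord) : ℝ :=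
  (∑ i, velCoeff F e x v i * v i) / scalarProd e x v v

/-- The covector `posCoeff` after the part of `velCoeff` along the velocity has been expressed by
the deviation and its derivative. -/
def posCoeff' (F : ForceField M) (e : OpenPartialHomeomorph M Coord) (x v : Coord) (i : Fin 2) : ℝ :=
  posCoeff F e x v i - radialCoeff F e x v * forceDown F e x v i

/-- The projector acts on the vectors perpendicular to `v` as the identity. -/
lemma sum_mul_proj {x v z : Coord} (hz : scalarProd e x v z = 0) (a : Fin 2 → ℝ) :
    ∑ k, (∑ i, a i * proj e x v i k) * z k = ∑ i, a i * z i := by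
  have h : ∑ k, dirDown e x v k * z k = 0 := by
    have : ∑ k, dirDown e x v k * z k = scalarProd e x v z / speed e x v := by
      rw [scalarProd_eq_sum]
      simp only [dirDown, dirUp, Fin.sum_univ_two, metric_symm e x 1 0]
      ring
    rw [this, hz, zero_div]
  have h2 : ∑ k, (∑ i, a i * proj e x v i k) * z k
      = ∑ i, a i * z i - (∑ i, a i * dirUp e x v i) * ∑ k, dirDown e x v k * z k := by
    simp only [proj, Fin.sum_univ_two]
    simp
    ring
  rw [h2, h, mul_zero, sub_zero]

/-- The columns of the projector, as vectors. -/
def projVec (e : OpenPartialHomeomorph M Coord) (x v : Coord) (k : Fin 2) : Coord :=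
  ∑ i, proj e x v i k • basisVec i

lemma projVec_apply (e : OpenPartialHomeomorph M Coord) (x v : Coord) (i k : Fin 2) :
    projVec e x v k i = proj e x v i k := by
  unfold projVec
  fin_cases i <;> simp

lemma scalarProd_projVec (he : e ∈ IsManifold.maximalAtlas (𝓡 2) ∞ M) {x v : Coord}
    (hx : x ∈ e.target) (hv : v ≠ 0) (k : Fin 2) : scalarProd e x v (projVec e x v k) = 0 := by
  have hs := (speed_pos he hx hv).ne'
  have h : scalarProd e x v (projVec e x v k)
      = dirDown e x v k / speed e x v * (speed e x v ^ 2 - scalarProd e x v v) := by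
    simp only [scalarProd_eq_sum, projVec_apply, proj, dirDown, dirUp, Fin.sum_univ_two]
    fin_cases k <;> simp [metric_symm e x 1 0] <;> field_simp <;> ring
  rw [h, speed_sq he hx hv, sub_self, mul_zero]

lemma differentiableAt_forceDown (F : ForceField M) (he : e ∈ IsManifold.maximalAtlas (𝓡 2) ∞ M)
    {x v : Coord} (hx : x ∈ e.target) (hv : v ≠ 0) (i : Fin 2) :
    DifferentiableAt ℝ (fun q : Coord × Coord => forceDown F e q.1 q.2 i) (x, v) :=
  ((contDiffOn_forceDown F he i).contDiffAt ((isOpen_phaseDomain e).mem_nhds ⟨hx, hv⟩)).differentiableAt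
    (by simp)

lemma differentiableAt_forceDown_vel (F : ForceField M)
    (he : e ∈ IsManifold.maximalAtlas (𝓡 2) ∞ M)
    {x v : Coord} (hx : x ∈ e.target) (hv : v ≠ 0) (i : Fin 2) :
    DifferentiableAt ℝ (fun w => forceDown F e x w i) v :=
  (differentiableAt_forceDown F he hx hv i).comp v (f := fun w => (x, w)) (by fun_prop)

lemma differentiableAt_speed (he : e ∈ IsManifold.maximalAtlas (𝓡 2) ∞ M) {x v : Coord}
    (hx : x ∈ e.target) (hv : v ≠ 0) : DifferentiableAt ℝ (fun w => speed e x w) v := by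
  unfold speed
  refine DifferentiableAt.sqrt ?_ (scalarProd_self_pos he hx hv).ne'
  simp only [scalarProd_eq_sum, Fin.sum_univ_two]
  fun_prop

/-- To first order the speed does not change if the velocity is moved in a perpendicular
direction, and so the normalization of `Nʲ = vʲ / |v|` is inessential there. -/
lemma fderiv_sum_dirUp_mul_forceDown (F : ForceField M)
    (he : e ∈ IsManifold.maximalAtlas (𝓡 2) ∞ M) {x v z : Coord} (hx : x ∈ e.target) (hv : v ≠ 0)
    (hz : scalarProd e x v z = 0) :
    fderiv ℝ (fun w => ∑ j, dirUp e x w j * forceDown F e x w j) v z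
      = (speed e x v)⁻¹ * (∑ j, z j * forceDown F e x v j
        + ∑ j, v j * ∑ i, z i * velGrad F e x v i j) := by
  have hs := (speed_pos he hx hv).ne'
  have hdF := differentiableAt_forceDown_vel F he hx hv
  have hds := differentiableAt_speed he hx hv
  have hdN : ∀ j, DifferentiableAt ℝ (fun w => dirUp e x w j) v := by
    intro j
    unfold dirUp
    have hj : DifferentiableAt ℝ (fun w : Coord => w j) v :=
      (contDiff_coord j).differentiable (by simp) v
    have h := hj.mul (hds.inv hs)
    exact h
  have hd : DifferentiableAt ℝ (fun w => ∑ j, dirUp e x w j * forceDown F e x w j) v :=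
    DifferentiableAt.fun_sum fun j _ => (hdN j).mul (hdF j)
  have hc : HasDerivAt (fun t : ℝ => v + t • z) z 0 := by
    simpa using ((hasDerivAt_id (0 : ℝ)).smul_const z).const_add v
  have hline : ∀ {h : Coord → ℝ}, DifferentiableAt ℝ h v →
      HasDerivAt (fun t : ℝ => h (v + t • z)) (fderiv ℝ h v z) 0 := by
    intro h hh
    have hh' : HasFDerivAt h (fderiv ℝ h v) (v + (0 : ℝ) • z) := by simpa using hh.hasFDerivAt
    exact hh'.comp_hasDerivAt 0 hc
  have hsp : HasDerivAt (fun t : ℝ => speed e x (v + t • z)) 0 0 := by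
    have hq : ∀ t : ℝ, scalarProd e x (v + t • z) (v + t • z)
        = scalarProd e x v v + t ^ 2 * scalarProd e x z z := by
      intro t
      rw [scalarProd_add_left, scalarProd_add_right, scalarProd_add_right, scalarProd_smul_left,
        scalarProd_smul_left, scalarProd_smul_right, scalarProd_smul_right, scalarProd_comm e x z v,
        hz]
      ring
    have h1 : HasDerivAt (fun t : ℝ => scalarProd e x v v + t ^ 2 * scalarProd e x z z) 0 0 := by
      simpa using (((hasDerivAt_id (0 : ℝ)).pow 2).mul_const (scalarProd e x z z)).const_add
        (scalarProd e x v v)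
    have h2 := h1.sqrt (by simpa using (scalarProd_self_pos he hx hv).ne')
    unfold speed
    simp only [hq]
    simpa using h2
  have hN : ∀ j, HasDerivAt (fun t : ℝ => dirUp e x (v + t • z) j) ((speed e x v)⁻¹ * z j) 0 := by
    intro j
    have h1 : HasDerivAt (fun t : ℝ => (v + t • z) j) (z j) 0 := by
      simpa using ((hasDerivAt_id (0 : ℝ)).mul_const (z j)).const_add (v j)
    have h2 := h1.div hsp (by simpa using hs)
    unfold dirUp
    refine h2.congr_deriv ?_
    simp
    field_simp
  have hsum : HasDerivAt (fun t : ℝ => ∑ j, dirUp e x (v + t • z) j * forceDown F e x (v + t • z) j)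
      (∑ j, ((speed e x v)⁻¹ * z j * forceDown F e x v j
        + dirUp e x v j * fderiv ℝ (fun w => forceDown F e x w j) v z)) 0 := by
    refine HasDerivAt.fun_sum fun j _ => ?_
    have h := (hN j).fun_mul (hline (hdF j))
    simp only [zero_smul, add_zero] at h
    exact h
  rw [(hline hd).unique hsum]
  simp only [← sum_mul_partialDeriv, velGrad, dirUp, Fin.sum_univ_two]
  field_simp
  ring

/-- On vectors perpendicular to `v` the covector of the first weak normality equation agrees with
`velCoeff` up to a factor. -/
lemma sum_firstCoeff (F : ForceField M) (he : e ∈ IsManifold.maximalAtlas (𝓡 2) ∞ M)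
    {x v z : Coord} (hx : x ∈ e.target) (hv : v ≠ 0) (hz : scalarProd e x v z = 0) :
    ∑ i, ((speed e x v)⁻¹ * forceDown F e x v i
        + partialDeriv i (fun w => ∑ j, dirUp e x w j * forceDown F e x w j) v) * z i
      = (speed e x v)⁻¹ * ∑ i, velCoeff F e x v i * z i := by
  have h1 := sum_mul_partialDeriv (fun w => ∑ j, dirUp e x w j * forceDown F e x w j) v z
  rw [fderiv_sum_dirUp_mul_forceDown F he hx hv hz] at h1
  have h2 : ∀ a b : Fin 2 → ℝ, ∑ i, (a i + b i) * z i = ∑ i, a i * z i + ∑ i, z i * b i := by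
    intro a b
    simp only [Fin.sum_univ_two]; ring
  rw [h2, h1]
  simp only [velCoeff, Fin.sum_univ_two]
  ring

/-- The coefficients of the second weak normality equation before the projection. -/
def secondCoeff (F : ForceField M) (e : OpenPartialHomeomorph M Coord) (x v : Coord) (i : Fin 2) :
    ℝ :=
  ∑ j, (spatGrad F e x v i j + spatGrad F e x v j i
      - 2 * (speed e x v)⁻¹ ^ 2 * forceDown F e x v i * forceDown F e x v j) * dirUp e x v j
    + ∑ j, (forceUp F e x v j * velGrad F e x v j i / speed e x v
      - ∑ r, dirUp e x v r * dirUp e x v j * velGrad F e x v j r / speed e x v * forceDown F e x v i)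

lemma secondCoeff_eq (F : ForceField M) (he : e ∈ IsManifold.maximalAtlas (𝓡 2) ∞ M)
    {x v : Coord} (hx : x ∈ e.target) (hv : v ≠ 0) (i : Fin 2) :
    secondCoeff F e x v i = (speed e x v)⁻¹ * posCoeff' F e x v i := by
  unfold secondCoeff posCoeff' posCoeff radialCoeff velCoeff
  rw [← speed_sq he hx hv]
  simp only [dirUp, Fin.sum_univ_two]
  ring

/-- The weak normality equations say that two covectors vanish on the vectors perpendicular to the
velocity. -/
theorem weakNormality_iff (F : ForceField M) :
    WeakNormality F ↔ ∀ e ∈ IsManifold.maximalAtlas (𝓡 2) ∞ M, ∀ x ∈ e.target, ∀ v : Coord, v ≠ 0 →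
      ∀ z, scalarProd e x v z = 0 →
        ∑ i, velCoeff F e x v i * z i = 0 ∧ ∑ i, posCoeff' F e x v i * z i = 0 := by
  have hsec : ∀ (e : OpenPartialHomeomorph M Coord) (x v : Coord) (k : Fin 2),
      ∑ i, ∑ j, (spatGrad F e x v i j + spatGrad F e x v j i
          - 2 * (speed e x v)⁻¹ ^ 2 * forceDown F e x v i * forceDown F e x v j)
          * dirUp e x v j * proj e x v i k
      + ∑ i, ∑ j, (forceUp F e x v j * velGrad F e x v j i / speed e x v
          - ∑ r, dirUp e x v r * dirUp e x v j * velGrad F e x v j r / speed e x v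
              * forceDown F e x v i) * proj e x v i k
      = ∑ i, secondCoeff F e x v i * proj e x v i k := by
    intro e x v k
    simp only [secondCoeff, ← Finset.sum_add_distrib, add_mul, Finset.sum_mul]
  constructor
  · intro h e he x hx v hv z hz
    have hs := (inv_pos.2 (speed_pos he hx hv)).ne'
    have h1 := sum_mul_proj hz (fun i => (speed e x v)⁻¹ * forceDown F e x v i
        + partialDeriv i (fun w => ∑ j, dirUp e x w j * forceDown F e x w j) v)
    have h2 := sum_mul_proj hz (secondCoeff F e x v)
    rw [Finset.sum_eq_zero fun k _ => by rw [(h e he x hx v hv k).1, zero_mul],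
      sum_firstCoeff F he hx hv hz] at h1
    rw [Finset.sum_eq_zero fun k _ => by rw [← hsec, (h e he x hx v hv k).2, zero_mul]] at h2
    simp only [secondCoeff_eq F he hx hv, mul_assoc] at h2
    rw [← Finset.mul_sum] at h2
    exact ⟨(mul_eq_zero.1 h1.symm).resolve_left hs, (mul_eq_zero.1 h2.symm).resolve_left hs⟩
  · intro h e he x hx v hv k
    have hz := scalarProd_projVec he hx hv k
    obtain ⟨h1, h2⟩ := h e he x hx v hv _ hz
    rw [hsec]
    constructor
    · have := sum_firstCoeff F he hx hv hz
      rw [h1, mul_zero] at this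
      simpa only [projVec_apply] using this
    · simp only [secondCoeff_eq F he hx hv, mul_assoc]
      rw [← Finset.mul_sum]
      simp only [projVec_apply] at h2
      rw [h2, mul_zero]

end

/-! ### Derivatives along curves in local coordinates -/

section PartialDerivatives

variable {E : Type*} [NormedAddCommGroup E] [NormedSpace ℝ E] {X : ℝ × ℝ → E} {W : Set (ℝ × ℝ)}
  {q : ℝ × ℝ}

/-- The partial derivative with respect to the first variable. -/
def du (X : ℝ × ℝ → E) (q : ℝ × ℝ) : E := fderiv ℝ X q (1, 0)

/-- The partial derivative with respect to the second variable. -/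
def dt (X : ℝ × ℝ → E) (q : ℝ × ℝ) : E := fderiv ℝ X q (0, 1)

lemma hasDerivAt_du (h : DifferentiableAt ℝ X q) : HasDerivAt (fun w => X (w, q.2)) (du X q) q.1 := by
  have h1 : HasDerivAt (fun w : ℝ => (w, q.2)) ((1 : ℝ), (0 : ℝ)) q.1 :=
    (hasDerivAt_id q.1).prodMk (hasDerivAt_const q.1 q.2)
  exact h.hasFDerivAt.comp_hasDerivAt q.1 h1

lemma hasDerivAt_dt (h : DifferentiableAt ℝ X q) : HasDerivAt (fun s => X (q.1, s)) (dt X q) q.2 := by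
  have h1 : HasDerivAt (fun s : ℝ => (q.1, s)) ((0 : ℝ), (1 : ℝ)) q.2 :=
    (hasDerivAt_const q.2 q.1).prodMk (hasDerivAt_id q.2)
  exact h.hasFDerivAt.comp_hasDerivAt q.2 h1

lemma contDiffOn_du (hW : IsOpen W) (h : ContDiffOn ℝ ∞ X W) : ContDiffOn ℝ ∞ (du X) W :=
  (h.fderiv_of_isOpen hW (m := ∞) (by simp)).clm_apply contDiffOn_const

lemma contDiffOn_dt (hW : IsOpen W) (h : ContDiffOn ℝ ∞ X W) : ContDiffOn ℝ ∞ (dt X) W :=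
  (h.fderiv_of_isOpen hW (m := ∞) (by simp)).clm_apply contDiffOn_const

lemma differentiableAt_of_contDiffOn (hW : IsOpen W) (h : ContDiffOn ℝ ∞ X W) (hq : q ∈ W) :
    DifferentiableAt ℝ X q :=
  (h.contDiffAt (hW.mem_nhds hq)).differentiableAt (by simp)

/-- Mixed partial derivatives are equal. -/
lemma du_dt_eq (hW : IsOpen W) (h : ContDiffOn ℝ ∞ X W) (hq : q ∈ W) : du (dt X) q = dt (du X) q := by
  have hc := h.contDiffAt (hW.mem_nhds hq)
  have hs : IsSymmSndFDerivAt ℝ X q := hc.isSymmSndFDerivAt (by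
    rw [minSmoothness_of_isRCLikeNormedField]; exact WithTop.coe_le_coe.2 le_top)
  have hd : DifferentiableAt ℝ (fderiv ℝ X) q :=
    (hc.fderiv_right (m := ∞) (by simp)).differentiableAt (by simp)
  have key : ∀ a b : ℝ × ℝ, fderiv ℝ (fun q => fderiv ℝ X q a) q b = fderiv ℝ (fderiv ℝ X) q b a := by
    intro a b
    have h1 := hd.hasFDerivAt.clm_apply (hasFDerivAt_const a q)
    rw [h1.fderiv]
    simp
  show fderiv ℝ (fun q => fderiv ℝ X q (0, 1)) q (1, 0) = fderiv ℝ (fun q => fderiv ℝ X q (1, 0)) q (0, 1)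
  rw [key, key]
  exact hs.eq _ _

end PartialDerivatives

section

variable {M : Type*} [TopologicalSpace M] [ChartedSpace Coord M]
  [Bundle.RiemannianBundle (fun p : M => TangentSpace (𝓡 2) p)]
  [IsManifold (𝓡 2) ∞ M] {e : OpenPartialHomeomorph M Coord}
  [IsContMDiffRiemannianBundle (𝓡 2) ∞ Coord (fun p : M => TangentSpace (𝓡 2) p)]

/-- The derivative of the metric in the direction `y`, evaluated at the vectors `w` and `z`. -/
def metricDeriv (e : OpenPartialHomeomorph M Coord) (x y w z : Coord) : ℝ :=
  ∑ i, ∑ j, (∑ k, y k * partialDeriv k (fun p => metric e p i j) x) * w i * z j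

lemma hasDerivAt_comp_coord {h : Coord → ℝ} {c : ℝ → Coord} {c' : Coord} {t : ℝ}
    (hh : DifferentiableAt ℝ h (c t)) (hc : HasDerivAt c c' t) :
    HasDerivAt (fun s => h (c s)) (∑ k, c' k * partialDeriv k h (c t)) t := by
  rw [sum_mul_partialDeriv]
  exact hh.hasFDerivAt.comp_hasDerivAt t hc

lemma hasDerivAt_coord {c : ℝ → Coord} {c' : Coord} {t : ℝ} (hc : HasDerivAt c c' t) (i : Fin 2) :
    HasDerivAt (fun s => c s i) (c' i) t :=
  (EuclideanSpace.proj i : Coord →L[ℝ] ℝ).hasFDerivAt.comp_hasDerivAt t hc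

lemma hasDerivAt_scalarProd (he : e ∈ IsManifold.maximalAtlas (𝓡 2) ∞ M) {c w z : ℝ → Coord}
    {c' w' z' : Coord} {t : ℝ} (hx : c t ∈ e.target) (hc : HasDerivAt c c' t)
    (hw : HasDerivAt w w' t) (hz : HasDerivAt z z' t) :
    HasDerivAt (fun s => scalarProd e (c s) (w s) (z s))
      (metricDeriv e (c t) c' (w t) (z t) + scalarProd e (c t) w' (z t)
        + scalarProd e (c t) (w t) z') t := by
  have hg : ∀ i j, DifferentiableAt ℝ (fun p => metric e p i j) (c t) := fun i j =>
    ((contDiffOn_metric he i j).contDiffAt (e.open_target.mem_nhds hx)).differentiableAt (by simp)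
  have h : HasDerivAt (fun s => ∑ i, ∑ j, metric e (c s) i j * w s i * z s j)
      (∑ i, ∑ j, (((∑ k, c' k * partialDeriv k (fun p => metric e p i j) (c t)) * w t i
        + metric e (c t) i j * w' i) * z t j + metric e (c t) i j * w t i * z' j)) t :=
    HasDerivAt.fun_sum fun i _ => HasDerivAt.fun_sum fun j _ =>
      ((hasDerivAt_comp_coord (hg i j) hc).fun_mul (hasDerivAt_coord hw i)).fun_mul
        (hasDerivAt_coord hz j)
  simp only [scalarProd_eq_sum]
  refine h.congr_deriv ?_
  simp only [metricDeriv, Fin.sum_univ_two]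
  ring

lemma hasDerivAt_forceDown (F : ForceField M) (he : e ∈ IsManifold.maximalAtlas (𝓡 2) ∞ M)
    {c w : ℝ → Coord} {c' w' : Coord} {t : ℝ} (hx : c t ∈ e.target) (hw0 : w t ≠ 0)
    (hc : HasDerivAt c c' t) (hw : HasDerivAt w w' t) (i : Fin 2) :
    HasDerivAt (fun s => forceDown F e (c s) (w s) i)
      (∑ k, c' k * partialDeriv k (fun y => forceDown F e y (w t) i) (c t)
        + ∑ k, w' k * velGrad F e (c t) (w t) k i) t := by
  have hd := (differentiableAt_forceDown F he hx hw0 i).hasFDerivAt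
  have h1 := hd.comp_hasDerivAt t (hc.prodMk hw)
  refine h1.congr_deriv ?_
  have hx1 : fderiv ℝ (fun y => forceDown F e y (w t) i) (c t) c'
      = fderiv ℝ (fun q : Coord × Coord => forceDown F e q.1 q.2 i) (c t, w t) (c', 0) := by
    have h := HasFDerivAt.comp (f := fun y => (y, w t)) (c t) hd (hasFDerivAt_prodMk_left (c t) (w t))
    exact congrArg (fun L : Coord →L[ℝ] ℝ => L c') h.fderiv
  have hv1 : fderiv ℝ (fun y => forceDown F e (c t) y i) (w t) w'
      = fderiv ℝ (fun q : Coord × Coord => forceDown F e q.1 q.2 i) (c t, w t) (0, w') := by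
    have h := hd.comp (w t) (hasFDerivAt_prodMk_right (c t) (w t))
    exact congrArg (fun L : Coord →L[ℝ] ℝ => L w') h.fderiv
  unfold velGrad
  rw [sum_mul_partialDeriv, sum_mul_partialDeriv, hx1, hv1, ← map_add]
  simp

/-- The components of the covariant derivative `∇_v τ` along a curve with velocity `v`, where `w` is
the ordinary derivative of the components of `τ`. -/
def covDeriv (e : OpenPartialHomeomorph M Coord) (x v τ w : Coord) (k : Fin 2) : ℝ :=
  w k + ∑ a, ∑ b, christoffel e x k a b * v a * τ b

/-- The covariant derivative with the components `covDeriv`, as a vector. -/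
def covVec (e : OpenPartialHomeomorph M Coord) (x v τ w : Coord) : Coord :=
  ∑ k, covDeriv e x v τ w k • basisVec k

lemma covVec_apply (e : OpenPartialHomeomorph M Coord) (x v τ w : Coord) (k : Fin 2) :
    covVec e x v τ w k = covDeriv e x v τ w k := by
  unfold covVec
  fin_cases k <;> simp

lemma sum_forceDown_eq (F : ForceField M) (e : OpenPartialHomeomorph M Coord) (x v z : Coord) :
    ∑ i, forceDown F e x v i * z i = scalarProd e x (forceUp F e x v) z := by
  rw [scalarProd_eq_sum]
  simp only [forceDown, Fin.sum_univ_two, metric_symm e x 1 0]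
  ring

/-- The equations of motion with the lowered index (in the form of Lagrange), which avoids the
connection. -/
lemma scalarProd_accel (F : ForceField M) (he : e ∈ IsManifold.maximalAtlas (𝓡 2) ∞ M)
    {x : Coord} (hx : x ∈ e.target) (v z : Coord) :
    scalarProd e x (accel F e x v) z = ∑ i, forceDown F e x v i * z i
      + (1 / 2) * metricDeriv e x z v v - metricDeriv e x v v z := by
  rw [sum_forceDown_eq]
  have h := sum_metric_mul_christoffel he hx
  have h1 : scalarProd e x (accel F e x v) z = scalarProd e x (forceUp F e x v) z
      - ∑ l, ∑ i, ∑ j, z l * v i * v j * ∑ k, metric e x l k * christoffel e x k i j := by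
    simp only [scalarProd_eq_sum, accel_apply, Fin.sum_univ_two, metric_symm e x 1 0]
    ring
  have hsym : (fun p => metric e p 1 0) = fun p => metric e p 0 1 :=
    funext fun p => metric_symm e p 1 0
  rw [h1]
  simp only [h]
  simp only [metricDeriv, Fin.sum_univ_two, hsym]
  ring

/-- The metric connection is compatible with the metric. -/
lemma sum_covDeriv (he : e ∈ IsManifold.maximalAtlas (𝓡 2) ∞ M) {x : Coord} (hx : x ∈ e.target)
    (v τ w y : Coord) :
    ∑ i, ∑ j, metric e x i j * y i * covDeriv e x v τ w j = scalarProd e x y w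
      + (1 / 2) * (metricDeriv e x v y τ + metricDeriv e x τ y v - metricDeriv e x y v τ) := by
  have h := sum_metric_mul_christoffel he hx
  have h1 : ∑ i, ∑ j, metric e x i j * y i * covDeriv e x v τ w j = scalarProd e x y w
      + ∑ l, ∑ a, ∑ b, y l * v a * τ b * ∑ k, metric e x l k * christoffel e x k a b := by
    simp only [scalarProd_eq_sum, covDeriv, Fin.sum_univ_two]
    ring
  have hsym : (fun p => metric e p 1 0) = fun p => metric e p 0 1 :=
    funext fun p => metric_symm e p 1 0
  rw [h1]
  simp only [h]
  simp only [metricDeriv, Fin.sum_univ_two, hsym]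
  ring

/-- The sum of the variation of the power of the force and of the time derivative of its work on the
variation vector, in terms of the spatial and velocity gradients. The terms with `Γ` that come from
the components of the gradients cancel those from `accel` and `covDeriv`. -/
lemma sum_force_derivs (F : ForceField M) (e : OpenPartialHomeomorph M Coord) (x v τ w : Coord) :
    ∑ i, ((∑ k, τ k * partialDeriv k (fun y => forceDown F e y v i) x
        + ∑ k, w k * velGrad F e x v k i) * v i + forceDown F e x v i * w i)
      + ∑ i, ((∑ k, v k * partialDeriv k (fun y => forceDown F e y v i) x
        + ∑ k, accel F e x v k * velGrad F e x v k i) * τ i + forceDown F e x v i * w i)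
    = ∑ i, posCoeff F e x v i * τ i + ∑ i, velCoeff F e x v i * covDeriv e x v τ w i := by
  have hs : ∀ k, christoffel e x k 1 0 = christoffel e x k 0 1 := fun k =>
    christoffel_symm e x k 1 0
  simp only [posCoeff, velCoeff, covDeriv, spatGrad, accel_apply, Fin.sum_univ_two, hs]
  ring

end

/-! ### Families of trajectories and their deviation -/

/-- A solution of a homogeneous linear equation of the second order with zero initial data
vanishes. -/
lemma eq_zero_of_linear_second_order {A B φ ψ : ℝ → ℝ} {ε : ℝ} (hA : ContinuousOn A (Ioo (-ε) ε))
    (hB : ContinuousOn B (Ioo (-ε) ε)) (hφ : ∀ t ∈ Ioo (-ε) ε, HasDerivAt φ (ψ t) t)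
    (hψ : ∀ t ∈ Ioo (-ε) ε, HasDerivAt ψ (A t * ψ t + B t * φ t) t) (h0 : φ 0 = 0) (h1 : ψ 0 = 0) :
    ∀ t ∈ Ioo (-ε) ε, φ t = 0 := by
  intro t ht
  obtain ⟨b, htb, hbε⟩ := exists_between (abs_lt.2 ht)
  have hsub : Icc (-b) b ⊆ Ioo (-ε) ε := fun s hs => ⟨by linarith [hs.1], by linarith [hs.2]⟩
  have hb0 : 0 < b := (abs_nonneg t).trans_lt htb
  obtain ⟨CA, hCA⟩ := isCompact_Icc.exists_bound_of_continuousOn (hA.mono hsub)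
  obtain ⟨CB, hCB⟩ := isCompact_Icc.exists_bound_of_continuousOn (hB.mono hsub)
  have h0b : (0 : ℝ) ∈ Icc (-b) b := ⟨by linarith, hb0.le⟩
  have hCA0 : 0 ≤ CA := (norm_nonneg _).trans (hCA 0 h0b)
  have hCB0 : 0 ≤ CB := (norm_nonneg _).trans (hCB 0 h0b)
  -- the equation is a linear system for `(φ, ψ)` with the Lipschitz constant `K` near `t`
  let K : NNReal := ⟨1 + CA + CB, by positivity⟩
  have hlip : ∀ s ∈ Ioo (-b) b,
      LipschitzOnWith K (fun p : ℝ × ℝ => (p.2, A s * p.2 + B s * p.1)) univ := by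
    intro s hs
    refine LipschitzWith.lipschitzOnWith (LipschitzWith.of_dist_le_mul fun p q => ?_)
    have hA' := hCA s (Ioo_subset_Icc_self hs)
    have hB' := hCB s (Ioo_subset_Icc_self hs)
    rw [Real.norm_eq_abs] at hA' hB'
    rw [Prod.dist_eq, Real.dist_eq, Real.dist_eq]
    have hp1 : |p.1 - q.1| ≤ dist p q := by rw [← Real.dist_eq]; exact le_max_left _ _
    have hp2 : |p.2 - q.2| ≤ dist p q := by rw [← Real.dist_eq]; exact le_max_right _ _
    have hd : 0 ≤ dist p q := dist_nonneg
    show _ ≤ (1 + CA + CB) * dist p q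
    refine max_le ?_ ?_
    · simp only
      nlinarith [mul_nonneg hCA0 hd, mul_nonneg hCB0 hd]
    · have : A s * p.2 + B s * p.1 - (A s * q.2 + B s * q.1)
          = A s * (p.2 - q.2) + B s * (p.1 - q.1) := by ring
      simp only [this]
      refine (abs_add_le _ _).trans ?_
      rw [abs_mul, abs_mul]
      have e1 := mul_le_mul hA' hp2 (abs_nonneg _) hCA0
      have e2 := mul_le_mul hB' hp1 (abs_nonneg _) hCB0
      linarith
  have huniq := ODE_solution_unique_of_mem_Ioo (v := fun s (p : ℝ × ℝ) => (p.2, A s * p.2 + B s * p.1))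
    (s := fun _ => univ) (K := K) (t₀ := 0) (a := -b) (b := b) (f := fun s => (φ s, ψ s))
    (g := fun _ => ((0 : ℝ), (0 : ℝ))) hlip ⟨by linarith, hb0⟩
    (fun s hs => ⟨(hφ s (hsub (Ioo_subset_Icc_self hs))).prodMk
      (hψ s (hsub (Ioo_subset_Icc_self hs))), mem_univ _⟩)
    (fun s hs => ⟨(hasDerivAt_const s ((0 : ℝ), (0 : ℝ))).congr_deriv (by ext <;> simp), mem_univ _⟩)
    (by simp [h0, h1])
  exact congrArg Prod.fst (huniq (abs_lt.1 htb))

section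

variable {M : Type*} [TopologicalSpace M] [ChartedSpace Coord M]
  [Bundle.RiemannianBundle (fun p : M => TangentSpace (𝓡 2) p)]
  [IsManifold (𝓡 2) ∞ M] {e : OpenPartialHomeomorph M Coord}
  [IsContMDiffRiemannianBundle (𝓡 2) ∞ Coord (fun p : M => TangentSpace (𝓡 2) p)]

/-- A smooth one-parameter family `t ↦ X(u, t)` of trajectories with nonzero velocity, defined
on an open set `W` of pairs `(u, t)`. -/
structure IsTrajectoryFamily (F : ForceField M) (e : OpenPartialHomeomorph M Coord)
    (X : ℝ × ℝ → Coord) (W : Set (ℝ × ℝ)) : Prop where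
  isOpen : IsOpen W
  smooth : ContDiffOn ℝ ∞ X W
  mem_target : ∀ q ∈ W, X q ∈ e.target
  velocity_ne_zero : ∀ q ∈ W, dt X q ≠ 0
  newton : ∀ q ∈ W, dt (dt X) q = accel F e (X q) (dt X q)

/-- The deviation `(∂ₜX | ∂ᵤX)`, which vanishes where the trajectories are orthogonal to the
curves `t = const`. -/
def deviation (e : OpenPartialHomeomorph M Coord) (X : ℝ × ℝ → Coord) (q : ℝ × ℝ) : ℝ :=
  scalarProd e (X q) (dt X q) (du X q)

/-- The kinetic energy `|∂ₜX|² / 2`. -/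
def kineticEnergy (e : OpenPartialHomeomorph M Coord) (X : ℝ × ℝ → Coord) (q : ℝ × ℝ) : ℝ :=
  (1 / 2) * scalarProd e (X q) (dt X q) (dt X q)

/-- The time derivative of the deviation (see `IsTrajectoryFamily.hasDerivAt_deviation`): the
variation of the kinetic energy plus the work of the force on the variation vector. -/
def deviationDeriv (F : ForceField M) (e : OpenPartialHomeomorph M Coord) (X : ℝ × ℝ → Coord)
    (q : ℝ × ℝ) : ℝ :=
  du (kineticEnergy e X) q + ∑ i, forceDown F e (X q) (dt X q) i * du X q i

/-- The covariant derivative of the variation vector along the trajectory. -/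
def covVariation (e : OpenPartialHomeomorph M Coord) (X : ℝ × ℝ → Coord) (q : ℝ × ℝ) : Coord :=
  covVec e (X q) (dt X q) (du X q) (dt (du X) q)

lemma covVariation_apply (e : OpenPartialHomeomorph M Coord) (X : ℝ × ℝ → Coord) (q : ℝ × ℝ)
    (k : Fin 2) :
    covVariation e X q k = covDeriv e (X q) (dt X q) (du X q) (dt (du X) q) k :=
  covVec_apply _ _ _ _ _ _

lemma contDiffOn_scalarProd (he : e ∈ IsManifold.maximalAtlas (𝓡 2) ∞ M) {G : Type*}
    [NormedAddCommGroup G] [NormedSpace ℝ G] {c w z : G → Coord} {s : Set G}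
    (hc : ContDiffOn ℝ ∞ c s) (hcs : ∀ q ∈ s, c q ∈ e.target) (hw : ContDiffOn ℝ ∞ w s)
    (hz : ContDiffOn ℝ ∞ z s) : ContDiffOn ℝ ∞ (fun q => scalarProd e (c q) (w q) (z q)) s := by
  simp only [scalarProd_eq_sum]
  exact ContDiffOn.sum fun i _ => ContDiffOn.sum fun j _ =>
    (((contDiffOn_metric he i j).comp hc hcs).mul ((contDiff_coord i).comp_contDiffOn hw)).mul
      ((contDiff_coord j).comp_contDiffOn hz)

namespace IsTrajectoryFamily

variable {F : ForceField M} {X : ℝ × ℝ → Coord} {W : Set (ℝ × ℝ)} {q : ℝ × ℝ}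

lemma contDiffOn_kineticEnergy (h : IsTrajectoryFamily F e X W)
    (he : e ∈ IsManifold.maximalAtlas (𝓡 2) ∞ M) : ContDiffOn ℝ ∞ (kineticEnergy e X) W :=
  contDiffOn_const.mul (contDiffOn_scalarProd he h.smooth h.mem_target
    (contDiffOn_dt h.isOpen h.smooth) (contDiffOn_dt h.isOpen h.smooth))

lemma hasDerivAt_fst (h : IsTrajectoryFamily F e X W) (hq : q ∈ W) :
    HasDerivAt (fun w => X (w, q.2)) (du X q) q.1 :=
  hasDerivAt_du (differentiableAt_of_contDiffOn h.isOpen h.smooth hq)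

lemma hasDerivAt_snd (h : IsTrajectoryFamily F e X W) (hq : q ∈ W) :
    HasDerivAt (fun s => X (q.1, s)) (dt X q) q.2 :=
  hasDerivAt_dt (differentiableAt_of_contDiffOn h.isOpen h.smooth hq)

lemma hasDerivAt_velocity_fst (h : IsTrajectoryFamily F e X W) (hq : q ∈ W) :
    HasDerivAt (fun w => dt X (w, q.2)) (dt (du X) q) q.1 := by
  rw [← du_dt_eq h.isOpen h.smooth hq]
  exact hasDerivAt_du
    (differentiableAt_of_contDiffOn h.isOpen (contDiffOn_dt h.isOpen h.smooth) hq)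

lemma hasDerivAt_velocity_snd (h : IsTrajectoryFamily F e X W) (hq : q ∈ W) :
    HasDerivAt (fun s => dt X (q.1, s)) (accel F e (X q) (dt X q)) q.2 := by
  rw [← h.newton q hq]
  exact hasDerivAt_dt
    (differentiableAt_of_contDiffOn h.isOpen (contDiffOn_dt h.isOpen h.smooth) hq)

lemma hasDerivAt_variation (h : IsTrajectoryFamily F e X W) (hq : q ∈ W) :
    HasDerivAt (fun s => du X (q.1, s)) (dt (du X) q) q.2 :=
  hasDerivAt_dt (differentiableAt_of_contDiffOn h.isOpen (contDiffOn_du h.isOpen h.smooth) hq)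

lemma du_kineticEnergy (h : IsTrajectoryFamily F e X W)
    (he : e ∈ IsManifold.maximalAtlas (𝓡 2) ∞ M) (hq : q ∈ W) :
    du (kineticEnergy e X) q = (1 / 2) * metricDeriv e (X q) (du X q) (dt X q) (dt X q)
      + scalarProd e (X q) (dt X q) (dt (du X) q) := by
  have h1 := (hasDerivAt_scalarProd he (h.mem_target q hq) (h.hasDerivAt_fst hq)
    (h.hasDerivAt_velocity_fst hq) (h.hasDerivAt_velocity_fst hq)).const_mul (1 / 2 : ℝ)
  have h2 := hasDerivAt_du (differentiableAt_of_contDiffOn h.isOpen (h.contDiffOn_kineticEnergy he) hq)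
  rw [h2.unique h1, scalarProd_comm e (X (q.1, q.2)) (dt (du X) q)]
  ring

/-- The power of the force. -/
lemma dt_kineticEnergy (h : IsTrajectoryFamily F e X W)
    (he : e ∈ IsManifold.maximalAtlas (𝓡 2) ∞ M) (hq : q ∈ W) :
    dt (kineticEnergy e X) q = ∑ i, forceDown F e (X q) (dt X q) i * dt X q i := by
  have h1 := (hasDerivAt_scalarProd he (h.mem_target q hq) (h.hasDerivAt_snd hq)
    (h.hasDerivAt_velocity_snd hq) (h.hasDerivAt_velocity_snd hq)).const_mul (1 / 2 : ℝ)
  have h2 := hasDerivAt_dt (differentiableAt_of_contDiffOn h.isOpen (h.contDiffOn_kineticEnergy he) hq)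
  rw [h2.unique h1, scalarProd_comm e (X (q.1, q.2)) (dt X _) (accel _ _ _ _)]
  have h3 := scalarProd_accel F he (h.mem_target q hq) (dt X q) (dt X q)
  simp only [Prod.mk.eta] at h3 ⊢
  rw [h3]
  ring

lemma hasDerivAt_deviation (h : IsTrajectoryFamily F e X W)
    (he : e ∈ IsManifold.maximalAtlas (𝓡 2) ∞ M) (hq : q ∈ W) :
    HasDerivAt (fun s => deviation e X (q.1, s)) (deviationDeriv F e X q) q.2 := by
  have h1 := hasDerivAt_scalarProd he (h.mem_target q hq) (h.hasDerivAt_snd hq)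
    (h.hasDerivAt_velocity_snd hq) (h.hasDerivAt_variation hq)
  refine h1.congr_deriv ?_
  rw [deviationDeriv, h.du_kineticEnergy he hq]
  have h3 := scalarProd_accel F he (h.mem_target q hq) (dt X q) (du X q)
  simp only [Prod.mk.eta] at h3 ⊢
  rw [h3]
  ring

lemma hasDerivAt_deviationDeriv (h : IsTrajectoryFamily F e X W)
    (he : e ∈ IsManifold.maximalAtlas (𝓡 2) ∞ M) (hq : q ∈ W) :
    HasDerivAt (fun s => deviationDeriv F e X (q.1, s))
      (∑ i, posCoeff F e (X q) (dt X q) i * du X q i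
        + ∑ i, velCoeff F e (X q) (dt X q) i * covVariation e X q i) q.2 := by
  have hT := h.contDiffOn_kineticEnergy he
  -- the variation of the power of the force
  have h1 : HasDerivAt (fun w => ∑ i, forceDown F e (X (w, q.2)) (dt X (w, q.2)) i * dt X (w, q.2) i)
      (∑ i, ((∑ k, du X q k * partialDeriv k (fun y => forceDown F e y (dt X q) i) (X q)
        + ∑ k, dt (du X) q k * velGrad F e (X q) (dt X q) k i) * dt X q i
        + forceDown F e (X q) (dt X q) i * dt (du X) q i)) q.1 :=
    HasDerivAt.fun_sum fun i _ =>
      (hasDerivAt_forceDown F he (h.mem_target q hq) (h.velocity_ne_zero q hq) (h.hasDerivAt_fst hq)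
        (h.hasDerivAt_velocity_fst hq) i).fun_mul (hasDerivAt_coord (h.hasDerivAt_velocity_fst hq) i)
  have h2 : HasDerivAt (fun s => ∑ i, forceDown F e (X (q.1, s)) (dt X (q.1, s)) i * du X (q.1, s) i)
      (∑ i, ((∑ k, dt X q k * partialDeriv k (fun y => forceDown F e y (dt X q) i) (X q)
        + ∑ k, accel F e (X q) (dt X q) k * velGrad F e (X q) (dt X q) k i) * du X q i
        + forceDown F e (X q) (dt X q) i * dt (du X) q i)) q.2 :=
    HasDerivAt.fun_sum fun i _ =>
      (hasDerivAt_forceDown F he (h.mem_target q hq) (h.velocity_ne_zero q hq) (h.hasDerivAt_snd hq)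
        (h.hasDerivAt_velocity_snd hq) i).fun_mul (hasDerivAt_coord (h.hasDerivAt_variation hq) i)
  have h3 : HasDerivAt (fun s => du (kineticEnergy e X) (q.1, s))
      (∑ i, ((∑ k, du X q k * partialDeriv k (fun y => forceDown F e y (dt X q) i) (X q)
        + ∑ k, dt (du X) q k * velGrad F e (X q) (dt X q) k i) * dt X q i
        + forceDown F e (X q) (dt X q) i * dt (du X) q i)) q.2 := by
    have h4 := hasDerivAt_dt (differentiableAt_of_contDiffOn h.isOpen (contDiffOn_du h.isOpen hT) hq)
    rw [← du_dt_eq h.isOpen hT hq] at h4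
    have h5 := hasDerivAt_du (differentiableAt_of_contDiffOn h.isOpen (contDiffOn_dt h.isOpen hT) hq)
    have hev : ∀ᶠ w in 𝓝 q.1, (w, q.2) ∈ W :=
      (by fun_prop : Continuous fun w : ℝ => (w, q.2)).continuousAt.eventually
        (h.isOpen.mem_nhds hq)
    have h6 := h5.congr_of_eventuallyEq (f₁ := fun w =>
      ∑ i, forceDown F e (X (w, q.2)) (dt X (w, q.2)) i * dt X (w, q.2) i)
      (hev.mono fun w hw => (h.dt_kineticEnergy he hw).symm)
    rwa [h6.unique h1] at h4
  refine (h3.add h2).congr_deriv ?_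
  rw [sum_force_derivs]
  simp only [covVariation_apply]

lemma scalarProd_covVariation (h : IsTrajectoryFamily F e X W)
    (he : e ∈ IsManifold.maximalAtlas (𝓡 2) ∞ M) (hq : q ∈ W) :
    scalarProd e (X q) (dt X q) (covVariation e X q) = du (kineticEnergy e X) q := by
  rw [scalarProd_eq_sum]
  simp only [covVariation_apply]
  rw [sum_covDeriv he (h.mem_target q hq), h.du_kineticEnergy he hq]
  ring

end IsTrajectoryFamily

/-- The component of `τ` perpendicular to `v`. -/
def perpPart (e : OpenPartialHomeomorph M Coord) (x v τ : Coord) : Coord :=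
  τ - (scalarProd e x v τ / scalarProd e x v v) • v

lemma scalarProd_perpPart (he : e ∈ IsManifold.maximalAtlas (𝓡 2) ∞ M) {x v : Coord}
    (hx : x ∈ e.target) (hv : v ≠ 0) (τ : Coord) : scalarProd e x v (perpPart e x v τ) = 0 := by
  have h := (scalarProd_self_pos he hx hv).ne'
  unfold perpPart
  rw [sub_eq_add_neg, ← neg_smul, scalarProd_add_right, scalarProd_smul_right]
  field_simp
  ring

/-- The decomposition of the second derivative of the deviation into terms proportional to the
deviation and its first derivative, and terms that the weak normality equations annihilate. -/
lemma sum_posCoeff_add_sum_velCoeff (F : ForceField M) (e : OpenPartialHomeomorph M Coord)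
    (x v τ w : Coord) :
    ∑ i, posCoeff F e x v i * τ i + ∑ i, velCoeff F e x v i * w i
      = radialCoeff F e x v * (scalarProd e x v w + ∑ i, forceDown F e x v i * τ i)
        + ((∑ i, posCoeff' F e x v i * v i) / scalarProd e x v v) * scalarProd e x v τ
        + (∑ i, posCoeff' F e x v i * perpPart e x v τ i
          + ∑ i, velCoeff F e x v i * perpPart e x v w i) := by
  simp only [perpPart, posCoeff', radialCoeff, Fin.sum_univ_two, PiLp.sub_apply, PiLp.smul_apply,
    smul_eq_mul]
  ring

end

section

variable {M : Type*} [TopologicalSpace M] [ChartedSpace Coord M]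
  [Bundle.RiemannianBundle (fun p : M => TangentSpace (𝓡 2) p)]
  [IsManifold (𝓡 2) ∞ M] {e : OpenPartialHomeomorph M Coord}
  [IsContMDiffRiemannianBundle (𝓡 2) ∞ Coord (fun p : M => TangentSpace (𝓡 2) p)]

lemma contDiffOn_velGrad (F : ForceField M) (he : e ∈ IsManifold.maximalAtlas (𝓡 2) ∞ M)
    (i j : Fin 2) :
    ContDiffOn ℝ ∞ (fun q : Coord × Coord => velGrad F e q.1 q.2 i j) (phaseDomain e) := by
  have h : ContDiffOn ℝ ∞ (fun q : Coord × Coord =>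
      fderiv ℝ (fun q : Coord × Coord => forceDown F e q.1 q.2 j) q (0, basisVec i))
      (phaseDomain e) :=
    ((contDiffOn_forceDown F he j).fderiv_of_isOpen (isOpen_phaseDomain e) (m := ∞)
      (by simp)).clm_apply contDiffOn_const
  refine h.congr fun q hq => ?_
  have h1 := (differentiableAt_forceDown F he hq.1 hq.2 j).hasFDerivAt.comp q.2
    (hasFDerivAt_prodMk_right q.1 q.2)
  exact congrArg (fun L : Coord →L[ℝ] ℝ => L (basisVec i)) h1.fderiv

lemma contDiffOn_spatGrad (F : ForceField M) (he : e ∈ IsManifold.maximalAtlas (𝓡 2) ∞ M)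
    (i j : Fin 2) :
    ContDiffOn ℝ ∞ (fun q : Coord × Coord => spatGrad F e q.1 q.2 i j) (phaseDomain e) := by
  have h : ContDiffOn ℝ ∞ (fun q : Coord × Coord =>
      fderiv ℝ (fun q : Coord × Coord => forceDown F e q.1 q.2 j) q (basisVec i, 0))
      (phaseDomain e) :=
    ((contDiffOn_forceDown F he j).fderiv_of_isOpen (isOpen_phaseDomain e) (m := ∞)
      (by simp)).clm_apply contDiffOn_const
  have h' : ContDiffOn ℝ ∞ (fun q : Coord × Coord =>
      partialDeriv i (fun y => forceDown F e y q.2 j) q.1) (phaseDomain e) := by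
    refine h.congr fun q hq => ?_
    have h1 := HasFDerivAt.comp (f := fun y => (y, q.2)) q.1
      (differentiableAt_forceDown F he hq.1 hq.2 j).hasFDerivAt (hasFDerivAt_prodMk_left q.1 q.2)
    exact congrArg (fun L : Coord →L[ℝ] ℝ => L (basisVec i)) h1.fderiv
  have hΓ := fun k i j => contDiffOn_phase_fst (contDiffOn_christoffel (M := M) he k i j)
  unfold spatGrad
  refine (h'.sub (ContDiffOn.sum fun a _ => ContDiffOn.sum fun b _ => ?_)).sub
    (ContDiffOn.sum fun a _ => (hΓ a i j).mul (contDiffOn_forceDown F he a))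
  exact ((hΓ b i a).mul ((contDiff_coord a).comp contDiff_snd).contDiffOn).mul
    (contDiffOn_velGrad F he b j)

lemma contDiffOn_vel (i : Fin 2) (s : Set (Coord × Coord)) :
    ContDiffOn ℝ ∞ (fun q : Coord × Coord => q.2 i) s :=
  ((contDiff_coord i).comp contDiff_snd).contDiffOn

lemma contDiffOn_velCoeff (F : ForceField M) (he : e ∈ IsManifold.maximalAtlas (𝓡 2) ∞ M)
    (i : Fin 2) :
    ContDiffOn ℝ ∞ (fun q : Coord × Coord => velCoeff F e q.1 q.2 i) (phaseDomain e) := by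
  unfold velCoeff
  exact (ContDiffOn.sum fun j _ => (contDiffOn_vel j _).mul (contDiffOn_velGrad F he i j)).add
    (contDiffOn_const.mul (contDiffOn_forceDown F he i))

lemma contDiffOn_div_scalarProd (he : e ∈ IsManifold.maximalAtlas (𝓡 2) ∞ M)
    {h : Coord × Coord → ℝ} (hh : ContDiffOn ℝ ∞ h (phaseDomain e)) :
    ContDiffOn ℝ ∞ (fun q => h q / scalarProd e q.1 q.2 q.2) (phaseDomain e) :=
  hh.div (contDiffOn_scalarProd he contDiffOn_fst (fun _ hq => hq.1) contDiffOn_snd contDiffOn_snd)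
    fun _ hq => (scalarProd_self_pos he hq.1 hq.2).ne'

lemma contDiffOn_radialCoeff (F : ForceField M) (he : e ∈ IsManifold.maximalAtlas (𝓡 2) ∞ M) :
    ContDiffOn ℝ ∞ (fun q : Coord × Coord => radialCoeff F e q.1 q.2) (phaseDomain e) :=
  contDiffOn_div_scalarProd he (ContDiffOn.sum fun i _ =>
    (contDiffOn_velCoeff F he i).mul (contDiffOn_vel i _))

lemma contDiffOn_posCoeff' (F : ForceField M) (he : e ∈ IsManifold.maximalAtlas (𝓡 2) ∞ M)
    (i : Fin 2) :
    ContDiffOn ℝ ∞ (fun q : Coord × Coord => posCoeff' F e q.1 q.2 i) (phaseDomain e) := by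
  have hS := contDiffOn_spatGrad F he
  unfold posCoeff' posCoeff
  refine ((ContDiffOn.sum fun j _ => (contDiffOn_vel j _).mul ((hS i j).add (hS j i))).add
    (ContDiffOn.sum fun j _ => ?_)).sub
    ((contDiffOn_radialCoeff F he).mul (contDiffOn_forceDown F he i))
  exact ((contDiff_coord j).comp_contDiffOn (contDiffOn_forceUp F he)).mul
    (contDiffOn_velGrad F he j i)

namespace IsTrajectoryFamily

variable {F : ForceField M} {X : ℝ × ℝ → Coord} {W : Set (ℝ × ℝ)} {q : ℝ × ℝ}

lemma contDiffOn_phase (h : IsTrajectoryFamily F e X W) :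
    ContDiffOn ℝ ∞ (fun q => (X q, dt X q)) W :=
  h.smooth.prodMk (contDiffOn_dt h.isOpen h.smooth)

lemma mapsTo_phase (h : IsTrajectoryFamily F e X W) :
    MapsTo (fun q => (X q, dt X q)) W (phaseDomain e) :=
  fun q hq => ⟨h.mem_target q hq, h.velocity_ne_zero q hq⟩

/-- A continuous function of position and velocity is continuous along each trajectory. -/
lemma continuousOn_comp (h : IsTrajectoryFamily F e X W) {G : Coord × Coord → ℝ}
    (hG : ContDiffOn ℝ ∞ G (phaseDomain e)) {u : ℝ} {I : Set ℝ} (hI : ∀ t ∈ I, (u, t) ∈ W) :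
    ContinuousOn (fun t => G (X (u, t), dt X (u, t))) I :=
  (hG.comp h.contDiffOn_phase h.mapsTo_phase).continuousOn.comp
    (f := fun t : ℝ => (u, t)) (by fun_prop) hI

lemma isTrajectoryOn (h : IsTrajectoryFamily F e X W) {u : ℝ} {I : Set ℝ} (hIo : IsOpen I)
    (hI : ∀ t ∈ I, (u, t) ∈ W) :
    IsTrajectoryOn F e (fun t => X (u, t)) I := by
  have hd : ∀ t ∈ I, deriv (fun t => X (u, t)) t = dt X (u, t) := fun t ht =>
    (h.hasDerivAt_snd (hI t ht)).deriv
  have hdd : ∀ t ∈ I, deriv (deriv fun t => X (u, t)) t = accel F e (X (u, t)) (dt X (u, t)) := by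
    intro t ht
    rw [Filter.EventuallyEq.deriv_eq (f := fun t => dt X (u, t))
      (Filter.eventually_of_mem (hIo.mem_nhds ht) hd)]
    exact (h.hasDerivAt_velocity_snd (hI t ht)).deriv
  refine ⟨?_, fun t ht => ⟨h.mem_target _ (hI t ht), fun k => ?_⟩⟩
  · exact (h.smooth.comp (f := fun t : ℝ => (u, t)) (contDiff_const.prodMk contDiff_id).contDiffOn
      hI).of_le (WithTop.coe_le_coe.2 le_top)
  · rw [hdd t ht, hd t ht, accel_apply]
    ring

/-- The second derivative of the deviation, sorted by powers of the deviation. -/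
lemma hasDerivAt_deviationDeriv' (h : IsTrajectoryFamily F e X W)
    (he : e ∈ IsManifold.maximalAtlas (𝓡 2) ∞ M) (hq : q ∈ W) :
    HasDerivAt (fun s => deviationDeriv F e X (q.1, s))
      (radialCoeff F e (X q) (dt X q) * deviationDeriv F e X q
        + ((∑ i, posCoeff' F e (X q) (dt X q) i * dt X q i) / scalarProd e (X q) (dt X q) (dt X q))
          * deviation e X q
        + (∑ i, posCoeff' F e (X q) (dt X q) i * perpPart e (X q) (dt X q) (du X q) i
          + ∑ i, velCoeff F e (X q) (dt X q) i
            * perpPart e (X q) (dt X q) (covVariation e X q) i)) q.2 := by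
  refine (h.hasDerivAt_deviationDeriv he hq).congr_deriv ?_
  rw [sum_posCoeff_add_sum_velCoeff, h.scalarProd_covVariation he hq]
  rfl

/-- Under the weak normality equations the deviation satisfies a homogeneous linear equation of the
second order along each trajectory, so that it vanishes together with its initial data. -/
lemma deviation_eq_zero (h : IsTrajectoryFamily F e X W)
    (he : e ∈ IsManifold.maximalAtlas (𝓡 2) ∞ M) (hF : WeakNormality F) {u ε : ℝ}
    (hI : ∀ t ∈ Ioo (-ε) ε, (u, t) ∈ W) (h0 : deviation e X (u, 0) = 0)
    (h1 : deviationDeriv F e X (u, 0) = 0) :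
    ∀ t ∈ Ioo (-ε) ε, deviation e X (u, t) = 0 := by
  rw [weakNormality_iff] at hF
  refine eq_zero_of_linear_second_order (φ := fun t => deviation e X (u, t))
    (ψ := fun t => deviationDeriv F e X (u, t))
    (h.continuousOn_comp (contDiffOn_radialCoeff F he) hI)
    (h.continuousOn_comp (contDiffOn_div_scalarProd he (ContDiffOn.sum (s := Finset.univ) fun i _ =>
      (contDiffOn_posCoeff' F he i).mul (contDiffOn_vel i _))) hI)
    (fun t ht => h.hasDerivAt_deviation he (hI t ht)) (fun t ht => ?_) h0 h1
  refine (h.hasDerivAt_deviationDeriv' he (hI t ht)).congr_deriv ?_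
  have hx := h.mem_target _ (hI t ht)
  have hv := h.velocity_ne_zero _ (hI t ht)
  rw [(hF e he _ hx _ hv _ (scalarProd_perpPart he hx hv _)).1,
    (hF e he _ hx _ hv _ (scalarProd_perpPart he hx hv _)).2, add_zero, add_zero]

/-- Conversely, where the deviation vanishes for a while, so does the part of its second derivative
that the weak normality equations concern. -/
lemma sum_perpPart_eq_zero (h : IsTrajectoryFamily F e X W)
    (he : e ∈ IsManifold.maximalAtlas (𝓡 2) ∞ M) (hq : q ∈ W) {η : ℝ} (hη : 0 < η)
    (h0 : ∀ t ∈ Ioo q.2 (q.2 + η), deviation e X (q.1, t) = 0) :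
    ∑ i, posCoeff' F e (X q) (dt X q) i * du X q i
      + ∑ i, velCoeff F e (X q) (dt X q) i
        * perpPart e (X q) (dt X q) (covVariation e X q) i = 0 := by
  have hcont : Continuous fun t : ℝ => (q.1, t) := by fun_prop
  have hpre : IsOpen {t : ℝ | (q.1, t) ∈ W} := h.isOpen.preimage hcont
  have hqt : q.2 ∈ {t : ℝ | (q.1, t) ∈ W} := hq
  have hIoo : Ioo q.2 (q.2 + η) ∈ 𝓝[>] q.2 := Ioo_mem_nhdsGT (by linarith)
  have h1 : ∀ t ∈ Ioo q.2 (q.2 + η), (q.1, t) ∈ W → deviationDeriv F e X (q.1, t) = 0 := by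
    intro t ht htW
    have h2 := (h.hasDerivAt_deviation he htW).congr_of_eventuallyEq (f₁ := fun _ => 0)
      (by filter_upwards [isOpen_Ioo.mem_nhds ht] with s hs using (h0 s hs).symm)
    exact h2.unique (hasDerivAt_const t 0)
  -- a function continuous at `q.2` that vanishes immediately to the right of it vanishes there
  have hlim : ∀ {f : ℝ → ℝ}, ContinuousAt f q.2 → (∀ᶠ t in 𝓝[>] q.2, f t = 0) → f q.2 = 0 := by
    intro f hf hf0
    exact tendsto_nhds_unique (hf.mono_left nhdsWithin_le_nhds)
      (tendsto_const_nhds.congr' (hf0.mono fun t ht => ht.symm))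
  have hW : ∀ᶠ t in 𝓝[>] q.2, (q.1, t) ∈ W := nhdsWithin_le_nhds (hpre.mem_nhds hqt)
  have h1' : ∀ᶠ t in 𝓝[>] q.2, deviationDeriv F e X (q.1, t) = 0 := by
    filter_upwards [hIoo, hW] with t ht htW using h1 t ht htW
  have h00 : deviation e X q = 0 := hlim (h.hasDerivAt_deviation he hq).continuousAt
    (by filter_upwards [hIoo] with t ht using h0 t ht)
  have h11 : deviationDeriv F e X q = 0 :=
    hlim (h.hasDerivAt_deviationDeriv' he hq).continuousAt h1'
  have h2 := (h.hasDerivAt_deviationDeriv' he hq).hasDerivWithinAt (s := Ioi q.2)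
  have h3 : HasDerivWithinAt (fun s => deviationDeriv F e X (q.1, s)) 0 (Ioi q.2) q.2 :=
    (hasDerivWithinAt_const q.2 _ (0 : ℝ)).congr_of_eventuallyEq h1' h11
  have h4 := (uniqueDiffWithinAt_Ioi q.2).eq_deriv _ h2 h3
  have hperp : perpPart e (X q) (dt X q) (du X q) = du X q := by
    have : scalarProd e (X q) (dt X q) (du X q) = 0 := h00
    rw [perpPart, this, zero_div, zero_smul, sub_zero]
  rw [h00, h11, hperp] at h4
  simpa using h4

end IsTrajectoryFamily

/-- The trajectories in the sense of Newton's equations form a family, as long as their velocity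
does not vanish. -/
lemma isTrajectoryFamily_of_isTrajectoryOn {F : ForceField M} {x : ℝ → ℝ → Coord} {J I : Set ℝ}
    (hJ : IsOpen J) (hI : IsOpen I)
    (hx : ContDiffOn ℝ ∞ (fun q : ℝ × ℝ => x q.1 q.2) (J ×ˢ I))
    (htr : ∀ u ∈ J, IsTrajectoryOn F e (x u) I) :
    IsTrajectoryFamily F e (fun q : ℝ × ℝ => x q.1 q.2)
      {q | q ∈ J ×ˢ I ∧ dt (fun q : ℝ × ℝ => x q.1 q.2) q ≠ 0} := by
  set X : ℝ × ℝ → Coord := fun q => x q.1 q.2 with hX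
  have hop : IsOpen (J ×ˢ I) := hJ.prod hI
  have hd : ∀ q ∈ J ×ˢ I, deriv (x q.1) q.2 = dt X q := fun q hq =>
    (hasDerivAt_dt (differentiableAt_of_contDiffOn hop hx hq)).deriv
  refine ⟨(contDiffOn_dt hop hx).continuousOn.isOpen_inter_preimage hop isOpen_ne,
    hx.mono fun q hq => hq.1, fun q hq => ((htr q.1 hq.1.1).2 q.2 hq.1.2).1, fun q hq => hq.2, ?_⟩
  intro q hq
  have h2 : deriv (deriv (x q.1)) q.2 = dt (dt X) q := by
    rw [Filter.EventuallyEq.deriv_eq (f := fun t => dt X (q.1, t))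
      (Filter.eventually_of_mem (hI.mem_nhds hq.1.2) fun t ht => hd (q.1, t) ⟨hq.1.1, ht⟩)]
    exact (hasDerivAt_dt (differentiableAt_of_contDiffOn hop (contDiffOn_dt hop hx) hq.1)).deriv
  ext k
  have h3 := ((htr q.1 hq.1.1).2 q.2 hq.1.2).2 k
  rw [h2, hd q hq.1] at h3
  rw [accel_apply]
  show _ = forceUp F e (x q.1 q.2) _ k - _
  rw [← h3]
  ring

/-- Trajectories with given smooth initial data, for initial data in a compact set. -/
lemma exists_isTrajectoryFamily (F : ForceField M) (he : e ∈ IsManifold.maximalAtlas (𝓡 2) ∞ M)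
    {C : Set (Coord × Coord)} (hC : IsCompact C) (hCe : C ⊆ phaseDomain e) :
    ∃ V, IsOpen V ∧ C ⊆ V ∧ ∃ δ > 0, ∀ (J : Set ℝ) (r w : ℝ → Coord), IsOpen J →
      ContDiffOn ℝ ∞ r J → ContDiffOn ℝ ∞ w J → (∀ u ∈ J, (r u, w u) ∈ V) →
      ∃ Φ : Coord × Coord → ℝ → Coord,
        IsTrajectoryFamily F e (fun q => Φ (r q.1, w q.1) q.2) (J ×ˢ Ioo (-δ) δ) ∧
        (∀ u ∈ J, Φ (r u, w u) 0 = r u) ∧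
        ∀ u ∈ J, dt (fun q : ℝ × ℝ => Φ (r q.1, w q.1) q.2) (u, 0) = w u := by
  have hf : ContDiffOn ℝ ∞ (fun q : Coord × Coord => (q.2, accel F e q.1 q.2)) (phaseDomain e) :=
    contDiffOn_snd.prodMk (contDiffOn_accel F he)
  obtain ⟨V, hV, hCV, δ, hδ, φ, hφ, hφ0, hφd⟩ :=
    SmoothFlow.exists_contDiffOn_local_flow (isOpen_phaseDomain e) hC hCe hf
  refine ⟨V, hV, hCV, δ, hδ, fun J r w hJ hr hw hrw => ⟨fun p t => (φ p t).1, ?_⟩⟩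
  have hop : IsOpen (J ×ˢ Ioo (-δ) δ) := hJ.prod isOpen_Ioo
  have hY : ContDiffOn ℝ ∞ (fun q : ℝ × ℝ => φ (r q.1, w q.1) q.2) (J ×ˢ Ioo (-δ) δ) := by
    refine hφ.comp (f := fun q : ℝ × ℝ => ((r q.1, w q.1), q.2)) ?_ fun q hq => ⟨hrw _ hq.1, hq.2⟩
    exact ((hr.comp contDiffOn_fst fun q hq => hq.1).prodMk
      (hw.comp contDiffOn_fst fun q hq => hq.1)).prodMk contDiffOn_snd
  have hX : ContDiffOn ℝ ∞ (fun q : ℝ × ℝ => (φ (r q.1, w q.1) q.2).1) (J ×ˢ Ioo (-δ) δ) :=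
    contDiff_fst.comp_contDiffOn hY
  have hXt : ∀ q ∈ J ×ˢ Ioo (-δ) δ,
      dt (fun q : ℝ × ℝ => (φ (r q.1, w q.1) q.2).1) q = (φ (r q.1, w q.1) q.2).2 := fun q hq =>
    (hasDerivAt_dt (differentiableAt_of_contDiffOn hop hX hq)).unique
      (hφd _ (hrw _ hq.1) _ hq.2).2.fst
  have h0 : (0 : ℝ) ∈ Ioo (-δ) δ := ⟨by linarith, hδ⟩
  refine ⟨⟨hop, hX, fun q hq => (hφd _ (hrw _ hq.1) _ hq.2).1.1, fun q hq => ?_, fun q hq => ?_⟩,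
    fun u hu => by simp only [hφ0], fun u hu => by rw [hXt (u, 0) ⟨hu, h0⟩, hφ0]⟩
  · rw [hXt q hq]
    exact (hφd _ (hrw _ hq.1) _ hq.2).1.2
  · have h1 := hasDerivAt_dt (differentiableAt_of_contDiffOn hop (contDiffOn_dt hop hX) hq)
    have h2 := (hφd _ (hrw _ hq.1) _ hq.2).2.snd
    rw [hXt q hq]
    refine (h1.congr_of_eventuallyEq ?_).unique h2
    filter_upwards [isOpen_Ioo.mem_nhds hq.2] with t ht
    exact (hXt (q.1, t) ⟨hq.1, ht⟩).symm

end

/-! ### The weak normality equations from the blow-up of points -/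

section

variable {M : Type*} [TopologicalSpace M] [ChartedSpace Coord M]
  [Bundle.RiemannianBundle (fun p : M => TangentSpace (𝓡 2) p)]
  [IsManifold (𝓡 2) ∞ M] {e : OpenPartialHomeomorph M Coord}
  [IsContMDiffRiemannianBundle (𝓡 2) ∞ Coord (fun p : M => TangentSpace (𝓡 2) p)]

/-- The covector `m` turned by a right angle: a vector on which `m` vanishes. -/
def rot (m : Fin 2 → ℝ) : Coord := -m 1 • basisVec 0 + m 0 • basisVec 1

@[simp] lemma rot_zero (m : Fin 2 → ℝ) : rot m 0 = -m 1 := by simp [rot]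

@[simp] lemma rot_one (m : Fin 2 → ℝ) : rot m 1 = m 0 := by simp [rot]

/-- The covector `∑ⱼ gᵢⱼ wʲ` turned by a right angle: a vector perpendicular to `w`. -/
def perpVec (e : OpenPartialHomeomorph M Coord) (x w : Coord) : Coord :=
  rot fun i => ∑ j, metric e x i j * w j

lemma scalarProd_perpVec (e : OpenPartialHomeomorph M Coord) (x w : Coord) :
    scalarProd e x w (perpVec e x w) = 0 := by
  simp only [scalarProd_eq_sum, perpVec, Fin.sum_univ_two, rot_zero, rot_one, metric_symm e x 1 0]
  ring

lemma perpVec_ne_zero (he : e ∈ IsManifold.maximalAtlas (𝓡 2) ∞ M) {x w : Coord}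
    (hx : x ∈ e.target) (hw : w ≠ 0) : perpVec e x w ≠ 0 := by
  intro h
  have h0 := congrArg (fun p : Coord => p 0) h
  have h1 := congrArg (fun p : Coord => p 1) h
  simp only [perpVec, rot_zero, rot_one, Fin.sum_univ_two, PiLp.zero_apply] at h0 h1
  have hp := scalarProd_self_pos he hx hw
  have : scalarProd e x w w = 0 := by
    simp only [scalarProd_eq_sum, Fin.sum_univ_two]
    linear_combination w 0 * h1 - w 1 * h0
  exact hp.ne' this

/-- In dimension two the vectors perpendicular to `v` are proportional, so that a covector vanishes
on all of them if it vanishes on a nonzero one. -/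
lemma sum_mul_eq_zero_of_perp (he : e ∈ IsManifold.maximalAtlas (𝓡 2) ∞ M) {x v w z : Coord}
    (hx : x ∈ e.target) (hv : v ≠ 0) (hw : w ≠ 0) (hvw : scalarProd e x v w = 0)
    (hvz : scalarProd e x v z = 0) {a : Fin 2 → ℝ} (ha : ∑ i, a i * w i = 0) :
    ∑ i, a i * z i = 0 := by
  have hp := (scalarProd_self_pos he hx hv).ne'
  simp only [scalarProd_eq_sum, Fin.sum_univ_two] at *
  set p0 := metric e x 0 0 * v 0 + metric e x 1 0 * v 1
  set p1 := metric e x 0 1 * v 0 + metric e x 1 1 * v 1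
  have h1 : p0 * w 0 + p1 * w 1 = 0 := by linear_combination hvw
  have h2 : p0 * z 0 + p1 * z 1 = 0 := by linear_combination hvz
  have hdet : z 0 * w 1 - z 1 * w 0 = 0 := by
    by_contra hne
    have e0 : p0 = 0 := by
      have : p0 * (z 0 * w 1 - z 1 * w 0) = 0 := by linear_combination w 1 * h2 - z 1 * h1
      exact (mul_eq_zero.1 this).resolve_right hne
    have e1 : p1 = 0 := by
      have : p1 * (z 0 * w 1 - z 1 * w 0) = 0 := by linear_combination z 0 * h1 - w 0 * h2
      exact (mul_eq_zero.1 this).resolve_right hne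
    exact hp (by linear_combination v 0 * e0 + v 1 * e1)
  by_contra hne
  have hw0 : w 0 = 0 := by
    have : (a 0 * z 0 + a 1 * z 1) * w 0 = 0 := by linear_combination z 0 * ha - a 1 * hdet
    exact (mul_eq_zero.1 this).resolve_left hne
  have hw1 : w 1 = 0 := by
    have : (a 0 * z 0 + a 1 * z 1) * w 1 = 0 := by linear_combination z 1 * ha + a 0 * hdet
    exact (mul_eq_zero.1 this).resolve_left hne
  exact hw (by ext i; fin_cases i <;> simp [hw0, hw1])

lemma perpPart_eq_self {x v τ : Coord} (h : scalarProd e x v τ = 0) : perpPart e x v τ = τ := by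
  rw [perpPart, h, zero_div, zero_smul, sub_zero]

lemma scalarProd_unit {x v : Coord} (he : e ∈ IsManifold.maximalAtlas (𝓡 2) ∞ M)
    (hx : x ∈ e.target) (hv : v ≠ 0) :
    scalarProd e x ((speed e x v)⁻¹ • v) ((speed e x v)⁻¹ • v) = 1 := by
  have hs := (speed_pos he hx hv).ne'
  rw [scalarProd_smul_left, scalarProd_smul_right, ← speed_sq he hx hv]
  field_simp

lemma hasDerivAt_circlePoint (a b : Coord) (θ : ℝ) :
    HasDerivAt (circlePoint a b) (circlePoint b (-a) θ) θ := by
  have h := ((Real.hasDerivAt_cos θ).smul_const a).add ((Real.hasDerivAt_sin θ).smul_const b)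
  refine h.congr_deriv ?_
  simp only [circlePoint, smul_neg, neg_smul]
  abel

lemma covVariation_eq_of_du_eq_zero {X : ℝ × ℝ → Coord} {q : ℝ × ℝ} (h : du X q = 0) :
    covVariation e X q = dt (du X) q := by
  ext k
  simp [covVariation_apply, covDeriv, h]

/-- The first weak normality equation comes from the initial moment of the blow-up: the variation
vector vanishes there, its derivative is tangent to the circle of initial velocities. -/
lemma sum_velCoeff_eq_zero_of_blowUp {F : ForceField M} (hF : AdmitsNormalBlowUp F)
    (he : e ∈ IsManifold.maximalAtlas (𝓡 2) ∞ M) {x₀ v₀ : Coord} (hx₀ : x₀ ∈ e.target)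
    (hv₀ : v₀ ≠ 0) :
    (∀ z, scalarProd e x₀ v₀ z = 0 → ∑ i, velCoeff F e x₀ v₀ i * z i = 0) ∧
    ∃ (X : ℝ × ℝ → Coord) (W : Set (ℝ × ℝ)) (ε : ℝ), IsTrajectoryFamily F e X W ∧
      ((0 : ℝ), (0 : ℝ)) ∈ W ∧ X (0, 0) = x₀ ∧ dt X (0, 0) = v₀ ∧ 0 < ε ∧
      (∀ t ∈ Ioo 0 ε, (0, t) ∈ W) ∧ (∀ t ∈ Ioo 0 ε, du X (0, t) ≠ 0) ∧
      ∀ t ∈ Ioo 0 ε, deviation e X (0, t) = 0 := by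
  have hs := speed_pos he hx₀ hv₀
  set s := speed e x₀ v₀ with hs_def
  set w := perpVec e x₀ v₀ with hw_def
  have hw : w ≠ 0 := perpVec_ne_zero he hx₀ hv₀
  have hvw : scalarProd e x₀ v₀ w = 0 := scalarProd_perpVec e x₀ v₀
  have hsw := speed_pos he hx₀ hw
  set a := s⁻¹ • v₀ with ha_def
  set b := (speed e x₀ w)⁻¹ • w with hb_def
  have hb : b ≠ 0 := smul_ne_zero (inv_pos.2 hsw).ne' hw
  have hxe : e (e.symm x₀) = x₀ := e.right_inv hx₀
  have haa : scalarProd e x₀ a a = 1 := scalarProd_unit he hx₀ hv₀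
  have hbb : scalarProd e x₀ b b = 1 := scalarProd_unit he hx₀ hw
  have hab : scalarProd e x₀ a b = 0 := by
    rw [ha_def, hb_def, scalarProd_smul_left, scalarProd_smul_right, hvw, mul_zero, mul_zero]
  obtain ⟨ε, hε, x, hx⟩ := hF (e.symm x₀) e he (e.map_target hx₀) a b (by rwa [hxe]) (by rwa [hxe])
    (by rwa [hxe]) s hs
  have hfam := isTrajectoryFamily_of_isTrajectoryOn isOpen_univ isOpen_Ioo hx.smooth
    (fun θ _ => hx.trajectory θ)
  set X : ℝ × ℝ → Coord := fun q => x q.1 q.2 with hX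
  set W := {q : ℝ × ℝ | q ∈ univ ×ˢ Ioo (-ε) ε ∧ dt X q ≠ 0} with hW
  have hop : IsOpen ((univ : Set ℝ) ×ˢ Ioo (-ε) ε) := isOpen_univ.prod isOpen_Ioo
  have h0I : (0 : ℝ) ∈ Ioo (-ε) ε := ⟨by linarith, hε⟩
  have hdX : ∀ q ∈ (univ : Set ℝ) ×ˢ Ioo (-ε) ε, DifferentiableAt ℝ X q := fun q hq =>
    differentiableAt_of_contDiffOn hop hx.smooth hq
  have hX0 : X (0, 0) = x₀ := by
    show x 0 0 = x₀
    rw [hx.initial_point, hxe]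
  have hV : ∀ θ, dt X (θ, 0) = s • circlePoint a b θ := by
    intro θ
    rw [← hx.initial_velocity θ]
    exact (hasDerivAt_dt (hdX (θ, 0) ⟨mem_univ _, h0I⟩)).deriv.symm
  have hV0 : dt X (0, 0) = v₀ := by
    rw [hV, circlePoint, ha_def]
    simp [smul_smul, mul_inv_cancel₀ hs.ne']
  have h0W : ((0 : ℝ), (0 : ℝ)) ∈ W := ⟨⟨mem_univ _, h0I⟩, by rw [hV0]; exact hv₀⟩
  have hτ0 : du X (0, 0) = 0 := by
    have h1 := hasDerivAt_du (hdX (0, 0) ⟨mem_univ _, h0I⟩)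
    have h2 : (fun w => X (w, 0)) = fun _ => e (e.symm x₀) := funext fun θ => hx.initial_point θ
    simp only [h2] at h1
    exact h1.unique (hasDerivAt_const _ _)
  have hτt : dt (du X) (0, 0) = s • b := by
    rw [← du_dt_eq hfam.isOpen hfam.smooth h0W]
    have h1 : HasDerivAt (fun w => dt X (w, 0)) (du (dt X) (0, 0)) 0 := hasDerivAt_du
      (differentiableAt_of_contDiffOn hop (contDiffOn_dt hop hx.smooth) ⟨mem_univ _, h0I⟩
        (q := ((0 : ℝ), (0 : ℝ))))
    rw [show (fun w => dt X (w, 0)) = fun θ => s • circlePoint a b θ from funext hV] at h1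
    rw [h1.unique ((hasDerivAt_circlePoint a b 0).fun_const_smul s)]
    simp [circlePoint]
  have hWt : ∀ᶠ t in 𝓝 (0 : ℝ), ((0 : ℝ), t) ∈ W :=
    (by fun_prop : Continuous fun t : ℝ => ((0 : ℝ), t)).continuousAt.eventually
      (hfam.isOpen.mem_nhds h0W)
  obtain ⟨η, hη, hηW⟩ := Metric.eventually_nhds_iff.1 hWt
  have hI : ∀ t ∈ Ioo 0 (min ε η), t ∈ Ioo 0 ε ∧ ((0 : ℝ), t) ∈ W := by
    intro t ht
    refine ⟨⟨ht.1, ht.2.trans_le (min_le_left _ _)⟩, hηW ?_⟩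
    rw [Real.dist_eq, sub_zero, abs_of_pos ht.1]
    exact ht.2.trans_le (min_le_right _ _)
  have hV' : ∀ t ∈ Ioo (-ε) ε, deriv (x 0) t = dt X (0, t) := fun t ht =>
    (hasDerivAt_dt (hdX (0, t) ⟨mem_univ _, ht⟩)).deriv
  have hU' : ∀ t ∈ Ioo (-ε) ε, deriv (fun w => x w t) 0 = du X (0, t) := fun t ht =>
    (hasDerivAt_du (hdX (0, t) ⟨mem_univ _, ht⟩)).deriv
  have hsubI : ∀ t ∈ Ioo 0 ε, t ∈ Ioo (-ε) ε := fun t ht => ⟨by linarith [ht.1], ht.2⟩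
  have hdev : ∀ t ∈ Ioo 0 ε, deviation e X (0, t) = 0 := by
    intro t ht
    have := hx.normal 0 t ht
    rwa [hV' t (hsubI t ht), hU' t (hsubI t ht)] at this
  refine ⟨fun z hz => ?_, X, W, min ε η, hfam, h0W, hX0, hV0, lt_min hε hη, fun t ht => (hI t ht).2,
    fun t ht => ?_, fun t ht => hdev t (hI t ht).1⟩
  · have h1 := hfam.sum_perpPart_eq_zero he h0W hε
      (fun t ht => hdev t (by simpa using ht))
    rw [covVariation_eq_of_du_eq_zero hτ0, hτ0, hτt, hX0, hV0] at h1
    have hvb : scalarProd e x₀ v₀ (s • b) = 0 := by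
      rw [scalarProd_smul_right, hb_def, scalarProd_smul_right, hvw, mul_zero, mul_zero]
    rw [perpPart_eq_self hvb] at h1
    exact sum_mul_eq_zero_of_perp he hx₀ hv₀ (smul_ne_zero hs.ne' hb) hvb hz (by simpa using h1)
  · rw [← hU' t (hsubI t (hI t ht).1)]
    exact hx.immersion 0 t (hI t ht).1

lemma contDiffOn_perpPart_apply (he : e ∈ IsManifold.maximalAtlas (𝓡 2) ∞ M) (z : Coord)
    (i : Fin 2) :
    ContDiffOn ℝ ∞ (fun q : Coord × Coord => perpPart e q.1 q.2 z i) (phaseDomain e) := by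
  have h := contDiffOn_div_scalarProd he (contDiffOn_scalarProd he contDiffOn_fst
    (fun q hq => hq.1) contDiffOn_snd (contDiffOn_const (c := z)) (s := phaseDomain e))
  exact (contDiffOn_const (c := z i)).sub (h.mul (contDiffOn_vel i _))

/-- A system that admits the normal blow-up of points satisfies the weak normality equations. The
second equation holds along the trajectories of the blow-up, where the variation vector does not
vanish, and by continuity at their initial points. -/
theorem weakNormality_of_admitsNormalBlowUp {F : ForceField M} (hF : AdmitsNormalBlowUp F) :
    WeakNormality F := by
  rw [weakNormality_iff]
  intro e he x₀ hx₀ v₀ hv₀ z hz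
  obtain ⟨hvel, X, W, ε, hfam, h0W, hX0, hV0, hε, hI, hτ, hdev⟩ :=
    sum_velCoeff_eq_zero_of_blowUp hF he hx₀ hv₀
  refine ⟨hvel z hz, ?_⟩
  have hzero : ∀ t ∈ Ioo 0 ε, ∑ i, posCoeff' F e (X (0, t)) (dt X (0, t)) i
      * perpPart e (X (0, t)) (dt X (0, t)) z i = 0 := by
    intro t ht
    have hx := hfam.mem_target _ (hI t ht)
    have hv := hfam.velocity_ne_zero _ (hI t ht)
    have h1 := hfam.sum_perpPart_eq_zero he (hI t ht) (η := ε - t) (by linarith [ht.2])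
      (fun t' ht' => hdev t' ⟨ht.1.trans ht'.1, by simpa using ht'.2⟩)
    rw [(sum_velCoeff_eq_zero_of_blowUp hF he hx hv).1 _ (scalarProd_perpPart he hx hv _),
      add_zero] at h1
    exact sum_mul_eq_zero_of_perp he hx hv (hτ t ht) (hdev t ht) (scalarProd_perpPart he hx hv _) h1
  have hcont : ContinuousOn (fun t => ∑ i, posCoeff' F e (X (0, t)) (dt X (0, t)) i
      * perpPart e (X (0, t)) (dt X (0, t)) z i) {t | ((0 : ℝ), t) ∈ W} :=
    hfam.continuousOn_comp (ContDiffOn.sum (s := Finset.univ) fun i _ =>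
      (contDiffOn_posCoeff' F he i).mul (contDiffOn_perpPart_apply he z i)) (fun t ht => ht)
  have hopen : IsOpen {t : ℝ | ((0 : ℝ), t) ∈ W} := hfam.isOpen.preimage (by fun_prop)
  have hlim := (hcont.continuousAt (hopen.mem_nhds (show (0 : ℝ) ∈ _ from h0W))).mono_left
    (nhdsWithin_le_nhds (s := Ioi 0))
  have h2 := tendsto_nhds_unique hlim (tendsto_const_nhds.congr' (by
    filter_upwards [Ioo_mem_nhdsGT hε] with t ht using (hzero t ht).symm))
  simp only [hX0, hV0, perpPart_eq_self hz] at h2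
  exact h2

end

/-! ### The weak normality equations from the shift of curves -/

section

variable {M : Type*} [TopologicalSpace M] [ChartedSpace Coord M]
  [Bundle.RiemannianBundle (fun p : M => TangentSpace (𝓡 2) p)]
  [IsManifold (𝓡 2) ∞ M] {e : OpenPartialHomeomorph M Coord}
  [IsContMDiffRiemannianBundle (𝓡 2) ∞ Coord (fun p : M => TangentSpace (𝓡 2) p)]

/-- The parabola through `x₀` with the tangent vector `w` and the acceleration `2 c v` at `x₀`. -/
def parabola (x₀ w v : Coord) (c u : ℝ) : Coord := x₀ + u • w + (c * u ^ 2) • v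

lemma contDiff_parabola (x₀ w v : Coord) (c : ℝ) : ContDiff ℝ ∞ (parabola x₀ w v c) := by
  unfold parabola
  fun_prop

lemma hasDerivAt_parabola (x₀ w v : Coord) (c u : ℝ) :
    HasDerivAt (parabola x₀ w v c) (w + (2 * c * u) • v) u := by
  have h1 := ((hasDerivAt_id u).smul_const w).const_add x₀
  have h2 := (((hasDerivAt_id u).pow 2).const_mul c).smul_const v
  refine (h1.add h2).congr_deriv ?_
  simp
  ring_nf

lemma deriv_parabola (x₀ w v : Coord) (c : ℝ) :
    deriv (parabola x₀ w v c) = fun u => w + (2 * c * u) • v :=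
  funext fun u => (hasDerivAt_parabola x₀ w v c u).deriv

/-- The unit vector perpendicular to `w`, on the side of `perpVec e x w`. -/
def unitNormal (e : OpenPartialHomeomorph M Coord) (x w : Coord) : Coord :=
  (speed e x (perpVec e x w))⁻¹ • perpVec e x w

lemma contDiff_rot {G : Type*} [NormedAddCommGroup G] [NormedSpace ℝ G] {s : Set G}
    {m : G → Fin 2 → ℝ} (hm : ∀ i, ContDiffOn ℝ ∞ (fun q => m q i) s) :
    ContDiffOn ℝ ∞ (fun q => rot (m q)) s := by
  unfold rot
  exact ((hm 1).neg.smul contDiffOn_const).add ((hm 0).smul contDiffOn_const)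

lemma contDiffOn_unitNormal (he : e ∈ IsManifold.maximalAtlas (𝓡 2) ∞ M) {r w : ℝ → Coord}
    {J : Set ℝ} (hr : ContDiffOn ℝ ∞ r J) (hw : ContDiffOn ℝ ∞ w J) (hre : ∀ u ∈ J, r u ∈ e.target)
    (hw0 : ∀ u ∈ J, w u ≠ 0) : ContDiffOn ℝ ∞ (fun u => unitNormal e (r u) (w u)) J := by
  have h1 : ContDiffOn ℝ ∞ (fun u => perpVec e (r u) (w u)) J :=
    contDiff_rot fun i => ContDiffOn.sum fun j _ =>
      ((contDiffOn_metric he i j).comp hr hre).mul ((contDiff_coord j).comp_contDiffOn hw)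
  have hne : ∀ u ∈ J, perpVec e (r u) (w u) ≠ 0 := fun u hu => perpVec_ne_zero he (hre u hu) (hw0 u hu)
  have h2 : ContDiffOn ℝ ∞ (fun u => speed e (r u) (perpVec e (r u) (w u))) J :=
    (contDiffOn_scalarProd he hr hre h1 h1).sqrt fun u hu =>
      (scalarProd_self_pos he (hre u hu) (hne u hu)).ne'
  exact (h2.inv fun u hu => (speed_pos he (hre u hu) (hne u hu)).ne').smul h1

/-- Every nonzero vector `v` is a positive multiple of the unit normal of some nonzero vector. -/
lemma exists_unitNormal_eq (he : e ∈ IsManifold.maximalAtlas (𝓡 2) ∞ M) {x v : Coord}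
    (hx : x ∈ e.target) (hv : v ≠ 0) :
    ∃ w : Coord, w ≠ 0 ∧ scalarProd e x v w = 0 ∧ speed e x v • unitNormal e x w = v := by
  -- turning twice by a right angle reverses the direction
  set w := -perpVec e x v with hw
  have hd := metric_det_pos he hx
  have hp : perpVec e x w = (metric e x).det • v := by
    rw [Matrix.det_fin_two]
    ext i
    fin_cases i
    · simp [perpVec, hw, Fin.sum_univ_two, metric_symm e x 1 0]; ring
    · simp [perpVec, hw, Fin.sum_univ_two, metric_symm e x 1 0]; ring
  refine ⟨w, neg_ne_zero.2 (perpVec_ne_zero he hx hv), ?_, ?_⟩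
  · rw [hw, ← neg_one_smul ℝ, scalarProd_smul_right, scalarProd_perpVec, mul_zero]
  · have hsp : speed e x ((metric e x).det • v) = (metric e x).det * speed e x v := by
      unfold speed
      rw [scalarProd_smul_left, scalarProd_smul_right, ← mul_assoc, ← pow_two,
        Real.sqrt_mul (sq_nonneg _), Real.sqrt_sq hd.le]
    have hs := (speed_pos he hx hv).ne'
    rw [unitNormal, hp, hsp, smul_smul, smul_smul, mul_assoc]
    have : speed e x v * (((metric e x).det * speed e x v)⁻¹ * (metric e x).det) = 1 := by
      have := hd.ne'
      field_simp
    rw [this, one_smul]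

lemma covVec_sub (e : OpenPartialHomeomorph M Coord) (x v τ w w' : Coord) :
    covVec e x v τ w - covVec e x v τ w' = w - w' := by
  unfold covVec covDeriv
  ext k
  fin_cases k <;> simp

/-- The normal shift of the parabola with the acceleration `2 c v₀` at `x₀`, at its initial moment:
`d` is the derivative of the field of initial velocities along the curve. -/
lemma exists_of_admitsNormalShift {F : ForceField M} (hF : AdmitsNormalShift F)
    (he : e ∈ IsManifold.maximalAtlas (𝓡 2) ∞ M) {x₀ v₀ w₀ : Coord} (hx₀ : x₀ ∈ e.target)
    (hv₀ : v₀ ≠ 0) (hw₀ : w₀ ≠ 0)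
    (hn : speed e x₀ v₀ • unitNormal e x₀ w₀ = v₀) (c : ℝ) :
    ∃ d : Coord, scalarProd e x₀ d w₀ = -metricDeriv e x₀ w₀ v₀ w₀ - 2 * c * scalarProd e x₀ v₀ v₀ ∧
      ∑ i, posCoeff' F e x₀ v₀ i * w₀ i
        + ∑ i, velCoeff F e x₀ v₀ i * perpPart e x₀ v₀ (covVec e x₀ v₀ w₀ d) i = 0 := by
  set r := parabola x₀ w₀ v₀ c with hr
  have hrs : ContDiff ℝ ∞ r := contDiff_parabola _ _ _ _
  have hr's : ContDiff ℝ ∞ (fun u : ℝ => w₀ + (2 * c * u) • v₀) := by fun_prop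
  have hr0 : r 0 = x₀ := by simp [hr, parabola]
  set J := {u : ℝ | r u ∈ e.target ∧ w₀ + (2 * c * u) • v₀ ≠ 0} with hJ
  have hJo : IsOpen J :=
    (e.open_target.preimage hrs.continuous).inter (isOpen_ne.preimage hr's.continuous)
  have h0J : (0 : ℝ) ∈ J := ⟨by rwa [hr0], by simpa using hw₀⟩
  set n : ℝ → Coord := fun u => unitNormal e (r u) (w₀ + (2 * c * u) • v₀) with hn_def
  have hS : IsHypersurface e J r n := by
    refine ⟨hJo, hrs.contDiffOn, fun u hu => hu.1, fun u hu => ?_,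
      contDiffOn_unitNormal he hrs.contDiffOn hr's.contDiffOn (fun u hu => hu.1) (fun u hu => hu.2),
      fun u hu => scalarProd_unit he hu.1 (perpVec_ne_zero he hu.1 hu.2), fun u hu => ?_⟩
    · rw [hr, deriv_parabola]; exact hu.2
    · rw [hr, deriv_parabola, hn_def]
      simp only [unitNormal]
      rw [scalarProd_smul_left, scalarProd_comm, scalarProd_perpVec, mul_zero]
  obtain ⟨J', hJJ', hJ'o, h0J', ν, hνs, -, hν0, ε, hε, x, hx⟩ :=
    hF e he J r n hS 0 h0J (speed e x₀ v₀) (speed_pos he hx₀ hv₀).ne'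
  have hfam := isTrajectoryFamily_of_isTrajectoryOn hJ'o isOpen_Ioo hx.smooth hx.trajectory
  set X : ℝ × ℝ → Coord := fun q => x q.1 q.2 with hX
  set W := {q : ℝ × ℝ | q ∈ J' ×ˢ Ioo (-ε) ε ∧ dt X q ≠ 0} with hW
  have hop : IsOpen (J' ×ˢ Ioo (-ε) ε) := hJ'o.prod isOpen_Ioo
  have h0I : (0 : ℝ) ∈ Ioo (-ε) ε := ⟨by linarith, hε⟩
  have hdX : ∀ q ∈ J' ×ˢ Ioo (-ε) ε, DifferentiableAt ℝ X q := fun q hq =>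
    differentiableAt_of_contDiffOn hop hx.smooth hq
  have hU : ∀ q ∈ J' ×ˢ Ioo (-ε) ε, deriv (fun w => x w q.2) q.1 = du X q := fun q hq =>
    (hasDerivAt_du (hdX q hq)).deriv
  have hV : ∀ q ∈ J' ×ˢ Ioo (-ε) ε, deriv (x q.1) q.2 = dt X q := fun q hq =>
    (hasDerivAt_dt (hdX q hq)).deriv
  have hdev : ∀ q ∈ J' ×ˢ Ioo (-ε) ε, deviation e X q = 0 := by
    intro q hq
    have := hx.normal q.1 hq.1 q.2 hq.2
    rwa [hU q hq, hV q hq] at this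
  have h00 : ((0 : ℝ), (0 : ℝ)) ∈ J' ×ˢ Ioo (-ε) ε := ⟨h0J', h0I⟩
  have hX0 : X (0, 0) = x₀ := by rw [← hr0]; exact hx.initial_point 0 h0J'
  have hV0 : dt X (0, 0) = v₀ := by
    rw [← hV _ h00, hx.initial_velocity 0 h0J', hν0, hn_def]
    simp only [hr0, mul_zero, zero_smul, add_zero, hn]
  have hU0 : ∀ u ∈ J', du X (u, 0) = w₀ + (2 * c * u) • v₀ := by
    intro u hu
    have h1 : HasDerivAt (fun w => X (w, 0)) (du X (u, 0)) u := hasDerivAt_du (hdX (u, 0) ⟨hu, h0I⟩)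
    refine h1.unique ((hasDerivAt_parabola x₀ w₀ v₀ c u).congr_of_eventuallyEq ?_)
    filter_upwards [hJ'o.mem_nhds hu] with u' hu' using hx.initial_point u' hu'
  have h0W : ((0 : ℝ), (0 : ℝ)) ∈ W := ⟨h00, by rw [hV0]; exact hv₀⟩
  have hw0 : du X (0, 0) = w₀ := by rw [hU0 0 h0J']; simp
  refine ⟨dt (du X) (0, 0), ?_, ?_⟩
  · have h1 : HasDerivAt (fun u => X (u, 0)) (du X (0, 0)) 0 := hasDerivAt_du (hdX _ h00)
    have h2 : HasDerivAt (fun u => dt X (u, 0)) (dt (du X) (0, 0)) 0 :=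
      hfam.hasDerivAt_velocity_fst h0W
    have h3 : HasDerivAt (fun u => du X (u, 0)) ((2 * c) • v₀) 0 := by
      have h4 : HasDerivAt (fun u : ℝ => w₀ + (2 * c * u) • v₀) ((2 * c) • v₀) 0 := by
        simpa using (((hasDerivAt_id (0 : ℝ)).const_mul (2 * c)).smul_const v₀).const_add w₀
      refine h4.congr_of_eventuallyEq ?_
      filter_upwards [hJ'o.mem_nhds h0J'] with u' hu' using hU0 u' hu'
    have h4 := hasDerivAt_scalarProd (c := fun u => X (u, 0)) (t := 0) he (hfam.mem_target _ h0W)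
      h1 h2 h3
    have h5 := h4.congr_of_eventuallyEq (f₁ := fun _ => 0) (by
      filter_upwards [hJ'o.mem_nhds h0J'] with u' hu' using (hdev (u', 0) ⟨hu', h0I⟩).symm)
    have h6 := h5.unique (hasDerivAt_const 0 0)
    rw [hX0, hw0, hV0, scalarProd_smul_right] at h6
    linarith
  · have h1 := hfam.sum_perpPart_eq_zero he h0W hε (fun t ht => hdev (0, t) ⟨h0J', by
      simp only [zero_add] at ht
      exact ⟨by linarith [ht.1], ht.2⟩⟩)
    unfold covVariation at h1
    rw [hX0, hV0, hw0] at h1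
    exact h1

/-- A system that admits the normal shift of hypersurfaces satisfies the weak normality equations:
two curves with the same tangent and different curvatures at a point separate the two equations. -/
theorem weakNormality_of_admitsNormalShift {F : ForceField M} (hF : AdmitsNormalShift F) :
    WeakNormality F := by
  rw [weakNormality_iff]
  intro e he x₀ hx₀ v₀ hv₀ z hz
  obtain ⟨w₀, hw₀, hvw, hn⟩ := exists_unitNormal_eq he hx₀ hv₀
  obtain ⟨d, hd, h1⟩ := exists_of_admitsNormalShift hF he hx₀ hv₀ hw₀ hn 0
  obtain ⟨d', hd', h2⟩ := exists_of_admitsNormalShift hF he hx₀ hv₀ hw₀ hn 1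
  have hvv := scalarProd_self_pos he hx₀ hv₀
  set y := perpPart e x₀ v₀ (covVec e x₀ v₀ w₀ d) with hy
  set y' := perpPart e x₀ v₀ (covVec e x₀ v₀ w₀ d') with hy'
  have hyy : scalarProd e x₀ v₀ (y - y') = 0 := by
    rw [sub_eq_add_neg, ← neg_one_smul ℝ, scalarProd_add_right, scalarProd_smul_right,
      scalarProd_perpPart he hx₀ hv₀, scalarProd_perpPart he hx₀ hv₀]
    ring
  have hne : y - y' ≠ 0 := by
    intro h0
    have h3 : y - y' = (d - d') + (scalarProd e x₀ v₀ (covVec e x₀ v₀ w₀ d') / scalarProd e x₀ v₀ v₀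
        - scalarProd e x₀ v₀ (covVec e x₀ v₀ w₀ d) / scalarProd e x₀ v₀ v₀) • v₀ := by
      rw [← covVec_sub e x₀ v₀ w₀ d d', hy, hy', perpPart, perpPart, sub_smul]
      abel
    have h4 : scalarProd e x₀ (y - y') w₀ = 2 * scalarProd e x₀ v₀ v₀ := by
      rw [h3, scalarProd_add_left, scalarProd_smul_left, hvw, sub_eq_add_neg, ← neg_one_smul ℝ d',
        scalarProd_add_left, scalarProd_smul_left, hd, hd']
      ring
    rw [h0, ← zero_smul ℝ w₀, scalarProd_smul_left, zero_mul] at h4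
    linarith
  have hvel : ∀ z, scalarProd e x₀ v₀ z = 0 → ∑ i, velCoeff F e x₀ v₀ i * z i = 0 := fun z hz =>
    sum_mul_eq_zero_of_perp he hx₀ hv₀ hne hyy hz (by
      simp only [Fin.sum_univ_two, PiLp.sub_apply] at h1 h2 ⊢
      linarith)
  refine ⟨hvel z hz, sum_mul_eq_zero_of_perp he hx₀ hv₀ hw₀ hvw hz ?_⟩
  rwa [hvel _ (scalarProd_perpPart he hx₀ hv₀ _), add_zero] at h1

end

/-! ### Construction of the normal shift -/

/-- A smooth local solution of a scalar differential equation `ν' = f(u, ν)`. -/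
lemma exists_scalar_solution {f : ℝ × ℝ → ℝ} {Ω : Set (ℝ × ℝ)} (hΩ : IsOpen Ω)
    (hf : ContDiffOn ℝ ∞ f Ω) {u₀ ν₀ : ℝ} (h0 : (u₀, ν₀) ∈ Ω) :
    ∃ δ > 0, ∃ ν : ℝ → ℝ, ContDiffOn ℝ ∞ ν (Ioo (u₀ - δ) (u₀ + δ)) ∧ ν u₀ = ν₀ ∧
      ∀ u ∈ Ioo (u₀ - δ) (u₀ + δ), (u, ν u) ∈ Ω ∧ HasDerivAt ν (f (u, ν u)) u := by
  have hg : ContDiffOn ℝ ∞ (fun q : ℝ × ℝ => ((1 : ℝ), f q)) Ω := contDiffOn_const.prodMk hf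
  obtain ⟨V, -, hCV, δ, hδ, φ, hφ, hφ0, hφd⟩ :=
    SmoothFlow.exists_contDiffOn_local_flow hΩ isCompact_singleton (singleton_subset_iff.2 h0) hg
  have hV : (u₀, ν₀) ∈ V := hCV rfl
  -- the first component of the solution is the independent variable
  have hd1 : ∀ t ∈ Ioo (-δ) δ, HasDerivAt (fun t => (φ (u₀, ν₀) t).1) 1 t := fun t ht =>
    (hφd _ hV t ht).2.fst
  have hfst : ∀ t ∈ Ioo (-δ) δ, (φ (u₀, ν₀) t).1 = u₀ + t := by
    have h1 : EqOn (fun t => (φ (u₀, ν₀) t).1) (fun t => u₀ + t) (Ioo (-δ) δ) := by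
      refine isOpen_Ioo.eqOn_of_deriv_eq (𝕜 := ℝ) isPreconnected_Ioo
        (fun t ht => (hd1 t ht).differentiableAt.differentiableWithinAt)
        (by fun_prop) (fun t ht => ?_) (x := 0) ⟨by linarith, hδ⟩ (by simp [hφ0])
      rw [(hd1 t ht).deriv, ((hasDerivAt_id' t).const_add u₀).deriv]
    exact h1
  have hsub : ∀ u ∈ Ioo (u₀ - δ) (u₀ + δ), u - u₀ ∈ Ioo (-δ) δ := fun u hu =>
    ⟨by linarith [hu.1], by linarith [hu.2]⟩
  refine ⟨δ, hδ, fun u => (φ (u₀, ν₀) (u - u₀)).2, ?_, by simp [hφ0], fun u hu => ?_⟩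
  · refine contDiff_snd.comp_contDiffOn (hφ.comp (f := fun u : ℝ => ((u₀, ν₀), u - u₀)) ?_
      fun u hu => ⟨hV, hsub u hu⟩)
    exact (contDiff_const.prodMk (contDiff_id.sub contDiff_const)).contDiffOn
  · have h1 := hφd _ hV _ (hsub u hu)
    have h2 : φ (u₀, ν₀) (u - u₀) = (u, (φ (u₀, ν₀) (u - u₀)).2) :=
      Prod.ext (by rw [hfst _ (hsub u hu)]; ring) rfl
    refine ⟨h2 ▸ h1.1, ?_⟩
    have h3 := h1.2.snd
    rw [h2] at h3
    have h4 := HasDerivAt.comp_sub_const u u₀ h3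
    exact h4

section

variable {M : Type*} [TopologicalSpace M] [ChartedSpace Coord M]
  [Bundle.RiemannianBundle (fun p : M => TangentSpace (𝓡 2) p)]
  [IsManifold (𝓡 2) ∞ M] {e : OpenPartialHomeomorph M Coord}
  [IsContMDiffRiemannianBundle (𝓡 2) ∞ Coord (fun p : M => TangentSpace (𝓡 2) p)]

/-- The moduli of the initial velocities of a normal shift: `ν` satisfies an ordinary differential
equation along the curve, which makes the initial value of the derivative of the deviation zero. -/
lemma exists_initial_speed (F : ForceField M) (he : e ∈ IsManifold.maximalAtlas (𝓡 2) ∞ M)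
    {J : Set ℝ} {r n : ℝ → Coord} (hS : IsHypersurface e J r n) {u₀ ν₀ : ℝ} (hu₀ : u₀ ∈ J)
    (hν₀ : ν₀ ≠ 0) :
    ∃ J' ⊆ J, IsOpen J' ∧ u₀ ∈ J' ∧ ∃ ν : ℝ → ℝ, ContDiffOn ℝ ∞ ν J' ∧ ν u₀ = ν₀ ∧
      ∀ u ∈ J', ν u ≠ 0 ∧ HasDerivAt ν
        (-(ν u)⁻¹ * ∑ i, forceDown F e (r u) (ν u • n u) i * deriv r u i) u := by
  have hn0 : ∀ u ∈ J, n u ≠ 0 := fun u hu =>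
    ne_zero_of_scalarProd_self_eq_one (hS.normal_unit u hu)
  set Ω : Set (ℝ × ℝ) := J ×ˢ {ν | ν ≠ 0}
  have hr : ContDiffOn ℝ ∞ (fun q : ℝ × ℝ => r q.1) Ω :=
    hS.smooth.comp contDiffOn_fst fun q hq => hq.1
  have hr' : ContDiffOn ℝ ∞ (fun q : ℝ × ℝ => deriv r q.1) Ω :=
    (hS.smooth.deriv_of_isOpen hS.isOpen (m := ∞) (by simp)).comp contDiffOn_fst fun q hq => hq.1
  have hn : ContDiffOn ℝ ∞ (fun q : ℝ × ℝ => n q.1) Ω :=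
    hS.normal_smooth.comp contDiffOn_fst fun q hq => hq.1
  have hf : ContDiffOn ℝ ∞ (fun q : ℝ × ℝ =>
      -(q.2)⁻¹ * ∑ i, forceDown F e (r q.1) (q.2 • n q.1) i * deriv r q.1 i) Ω := by
    refine (contDiffOn_snd.inv fun q hq => hq.2).neg.mul (ContDiffOn.sum fun i _ => ?_)
    refine ContDiffOn.mul ?_ ((contDiff_coord i).comp_contDiffOn hr')
    exact (contDiffOn_forceDown F he i).comp (f := fun q : ℝ × ℝ => (r q.1, q.2 • n q.1))
      (hr.prodMk (contDiffOn_snd.smul hn))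
      fun q hq => ⟨hS.mem_target _ hq.1, smul_ne_zero hq.2 (hn0 _ hq.1)⟩
  obtain ⟨δ, hδ, ν, hν, hν0, hνd⟩ := exists_scalar_solution (hS.isOpen.prod isOpen_ne) hf
    (show (u₀, ν₀) ∈ Ω from ⟨hu₀, hν₀⟩)
  exact ⟨Ioo (u₀ - δ) (u₀ + δ), fun u hu => (hνd u hu).1.1, isOpen_Ioo,
    ⟨by linarith, by linarith⟩, ν, hν, hν0, fun u hu => ⟨(hνd u hu).1.2, (hνd u hu).2⟩⟩

/-- If a family of trajectories starts with the kinetic energy `T`, the derivative of its deviation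
is initially `T'` plus the work of the force on the initial curve. -/
lemma deviationDeriv_eq {F : ForceField M} {X : ℝ × ℝ → Coord} {W : Set (ℝ × ℝ)}
    (h : IsTrajectoryFamily F e X W) (he : e ∈ IsManifold.maximalAtlas (𝓡 2) ∞ M) {q : ℝ × ℝ}
    (hq : q ∈ W) {T : ℝ → ℝ} {T' : ℝ}
    (hT : ∀ᶠ u in 𝓝 q.1, kineticEnergy e X (u, q.2) = T u) (hT' : HasDerivAt T T' q.1) :
    deviationDeriv F e X q = T' + ∑ i, forceDown F e (X q) (dt X q) i * du X q i := by
  have h1 := hasDerivAt_du (differentiableAt_of_contDiffOn h.isOpen (h.contDiffOn_kineticEnergy he) hq)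
  rw [deviationDeriv, h1.unique (hT'.congr_of_eventuallyEq hT)]

/-- A system that satisfies the weak normality equations admits the normal shift of
hypersurfaces. -/
theorem admitsNormalShift_of_weakNormality {F : ForceField M} (hF : WeakNormality F) :
    AdmitsNormalShift F := by
  intro e he J r n hS u₀ hu₀ ν₀ hν₀
  obtain ⟨J₁, hJ₁, hJ₁o, hu₀₁, ν, hν, hν0, hνd⟩ := exists_initial_speed F he hS hu₀ hν₀
  have hn0 : n u₀ ≠ 0 := ne_zero_of_scalarProd_self_eq_one (hS.normal_unit u₀ hu₀)
  obtain ⟨V, hV, hCV, δ, hδ, hfl⟩ := exists_isTrajectoryFamily F he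
    (isCompact_singleton (x := (r u₀, ν u₀ • n u₀)))
    (singleton_subset_iff.2 ⟨hS.mem_target _ hu₀, smul_ne_zero (hν0 ▸ hν₀) hn0⟩)
  have hr₁ := hS.smooth.mono hJ₁
  have hw₁ : ContDiffOn ℝ ∞ (fun u => ν u • n u) J₁ := hν.smul (hS.normal_smooth.mono hJ₁)
  set J₂ := J₁ ∩ (fun u => (r u, ν u • n u)) ⁻¹' V with hJ₂
  have hJ₂o : IsOpen J₂ := (hr₁.prodMk hw₁).continuousOn.isOpen_inter_preimage hJ₁o hV
  obtain ⟨Φ, hfam, hΦ0, hΦt⟩ := hfl J₂ r (fun u => ν u • n u) hJ₂o (hr₁.mono inter_subset_left)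
    (hw₁.mono inter_subset_left) (fun u hu => hu.2)
  set X : ℝ × ℝ → Coord := fun q => Φ (r q.1, ν q.1 • n q.1) q.2 with hX
  have h0I : (0 : ℝ) ∈ Ioo (-δ) δ := ⟨by linarith, hδ⟩
  have hu₀₂ : u₀ ∈ J₂ := ⟨hu₀₁, hCV rfl⟩
  have hdu0 : ∀ u ∈ J₂, du X (u, 0) = deriv r u := by
    intro u hu
    have h1 : HasDerivAt (fun w => X (w, 0)) (du X (u, 0)) u :=
      hfam.hasDerivAt_fst (q := (u, 0)) ⟨hu, h0I⟩
    rw [← h1.deriv]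
    refine Filter.EventuallyEq.deriv_eq ?_
    filter_upwards [hJ₂o.mem_nhds hu] with u' hu' using hΦ0 u' hu'
  -- the shift is an immersion for small times, since it is one at the initial moment
  have himm : IsOpen ((J₂ ×ˢ Ioo (-δ) δ) ∩ du X ⁻¹' {w | w ≠ 0}) :=
    (contDiffOn_du hfam.isOpen hfam.smooth).continuousOn.isOpen_inter_preimage hfam.isOpen isOpen_ne
  obtain ⟨J₃, I, hJ₃o, hIo, hu₀₃, h0I', hsub⟩ := isOpen_prod_iff.1 himm u₀ 0
    ⟨⟨hu₀₂, h0I⟩, by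
      show du X (u₀, 0) ≠ 0
      rw [hdu0 u₀ hu₀₂]
      exact hS.regular u₀ hu₀⟩
  obtain ⟨ε, hε, hεI⟩ := Metric.isOpen_iff.1 hIo 0 h0I'
  have hIε : ∀ t ∈ Ioo (-ε) ε, t ∈ I := fun t ht => hεI (by rw [Real.ball_eq_Ioo]; simpa using ht)
  have h0ε : (0 : ℝ) ∈ Ioo (-ε) ε := ⟨by linarith, hε⟩
  have hW : ∀ u ∈ J₃, ∀ t ∈ Ioo (-ε) ε, (u, t) ∈ J₂ ×ˢ Ioo (-δ) δ := fun u hu t ht =>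
    (hsub (show (u, t) ∈ J₃ ×ˢ I from ⟨hu, hIε t ht⟩)).1
  have hJ₃₂ : ∀ u ∈ J₃, u ∈ J₂ := fun u hu => (hW u hu 0 h0ε).1
  have hJ₃J : J₃ ⊆ J := fun u hu => hJ₁ (hJ₃₂ u hu).1
  have hdev : ∀ u ∈ J₃, ∀ t ∈ Ioo (-ε) ε, deviation e X (u, t) = 0 := by
    intro u hu
    have hu₂ := hJ₃₂ u hu
    have hdt0 : ∀ u ∈ J₂, dt X (u, 0) = ν u • n u := hΦt
    have hX0 : ∀ u ∈ J₂, X (u, 0) = r u := hΦ0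
    refine hfam.deviation_eq_zero he hF (hW u hu) ?_ ?_
    · rw [deviation, hX0 u hu₂, hdt0 u hu₂, hdu0 u hu₂, scalarProd_smul_left,
        hS.normal_perp u (hJ₃J hu), mul_zero]
    · have hT : ∀ᶠ u' in 𝓝 u, kineticEnergy e X (u', 0) = (1 / 2) * ν u' ^ 2 := by
        filter_upwards [hJ₂o.mem_nhds hu₂] with u' hu'
        rw [kineticEnergy, hX0 u' hu', hdt0 u' hu', scalarProd_smul_left, scalarProd_smul_right,
          hS.normal_unit u' (hJ₁ hu'.1)]
        ring
      obtain ⟨hνu, hνu'⟩ := hνd u hu₂.1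
      rw [deviationDeriv_eq hfam he (hW u hu 0 h0ε) hT ((hνu'.pow 2).const_mul (1 / 2)),
        hX0 u hu₂, hdt0 u hu₂, hdu0 u hu₂]
      simp only [Nat.cast_ofNat, Nat.add_one_sub_one, pow_one]
      field_simp
      ring
  have hd := fun u hu t ht => differentiableAt_of_contDiffOn hfam.isOpen hfam.smooth (hW u hu t ht)
  have hU : ∀ u ∈ J₃, ∀ t ∈ Ioo (-ε) ε, deriv (fun w => X (w, t)) u = du X (u, t) :=
    fun u hu t ht => (hasDerivAt_du (hd u hu t ht)).deriv
  have hVt : ∀ u ∈ J₃, ∀ t ∈ Ioo (-ε) ε, deriv (fun s => X (u, s)) t = dt X (u, t) :=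
    fun u hu t ht => (hasDerivAt_dt (hd u hu t ht)).deriv
  refine ⟨J₃, hJ₃J, hJ₃o, hu₀₃, ν, hν.mono fun u hu => (hJ₃₂ u hu).1,
    fun u hu => (hνd u (hJ₃₂ u hu).1).1, hν0, ε, hε, fun u t => X (u, t), ?_⟩
  refine ⟨hfam.smooth.mono fun q hq => hW q.1 hq.1 q.2 hq.2,
    fun u hu => hfam.isTrajectoryOn isOpen_Ioo (hW u hu), fun u hu => hΦ0 u (hJ₃₂ u hu),
    fun u hu => ?_, fun u hu t ht => ?_, fun u hu t ht => ?_⟩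
  · rw [hVt u hu 0 h0ε]
    exact hΦt u (hJ₃₂ u hu)
  · rw [hU u hu t ht]
    exact (hsub (show (u, t) ∈ J₃ ×ˢ I from ⟨hu, hIε t ht⟩)).2
  · rw [hVt u hu t ht, hU u hu t ht]
    exact hdev u hu t ht

end

/-! ### Construction of the normal blow-up -/

lemma circlePoint_periodic (a b : Coord) : Function.Periodic (circlePoint a b) (2 * Real.pi) :=
  fun θ => by simp [circlePoint]

lemma contDiff_circlePoint (a b : Coord) : ContDiff ℝ ∞ (circlePoint a b) :=
  (Real.contDiff_cos.smul contDiff_const).add (Real.contDiff_sin.smul contDiff_const)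

/-- A chord of the ellipse `θ ↦ circlePoint a b θ` is parallel to the tangent at the midpoint of its
arc. -/
lemma circlePoint_sub_circlePoint (a b : Coord) (θ θ' : ℝ) :
    circlePoint a b θ - circlePoint a b θ'
      = (2 * Real.sin ((θ - θ') / 2)) • circlePoint b (-a) ((θ + θ') / 2) := by
  have h1 := Real.cos_sub_cos θ θ'
  have h2 := Real.sin_sub_sin θ θ'
  have h3 : circlePoint a b θ - circlePoint a b θ'
      = (Real.cos θ - Real.cos θ') • a + (Real.sin θ - Real.sin θ') • b := by
    simp only [circlePoint, sub_smul]
    abel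
  rw [h3, h1, h2]
  simp only [circlePoint, smul_add, smul_neg, smul_smul, neg_mul, neg_smul]
  rw [add_comm, mul_assoc 2 (Real.sin ((θ + θ') / 2)), mul_comm (Real.sin ((θ + θ') / 2)),
    ← mul_assoc]

lemma exists_le_norm_circlePoint {a b : Coord} (h : ∀ θ, circlePoint a b θ ≠ 0) :
    ∃ m > 0, ∀ θ, m ≤ ‖circlePoint a b θ‖ := by
  have hc : Continuous fun θ => ‖circlePoint a b θ‖ := (contDiff_circlePoint a b).continuous.norm
  obtain ⟨θ₀, -, hθ₀⟩ := isCompact_Icc.exists_isMinOn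
    (nonempty_Icc.2 Real.two_pi_pos.le) hc.continuousOn
  refine ⟨_, norm_pos_iff.2 (h θ₀), fun θ => ?_⟩
  obtain ⟨θ₁, hθ₁, heq⟩ := (circlePoint_periodic a b).exists_mem_Ico₀ Real.two_pi_pos θ
  rw [heq]
  exact hθ₀ (Ico_subset_Icc_self hθ₁)

lemma fderiv_periodic {E : Type*} [NormedAddCommGroup E] [NormedSpace ℝ E] {X : ℝ × ℝ → E} {T : ℝ}
    (hX : ∀ q, X (q + (T, 0)) = X q) (q : ℝ × ℝ) : fderiv ℝ X (q + (T, 0)) = fderiv ℝ X q := by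
  rw [← fderiv_comp_add_right (T, (0 : ℝ)), show (fun q => X (q + (T, 0))) = X from funext hX]

/-- The mixed derivative of a family of curves that issue from one point stays close to that of its
linear part `t ν₀ n(θ)`, uniformly in `θ`. -/
lemma exists_norm_dt_du_sub_lt {X : ℝ × ℝ → Coord} {δ ν₀ : ℝ} {a b : Coord} (hδ : 0 < δ)
    (hX : ContDiffOn ℝ ∞ X (univ ×ˢ Ioo (-δ) δ))
    (hper : ∀ q, X (q + (2 * Real.pi, 0)) = X q)
    (hv : ∀ θ, dt X (θ, 0) = ν₀ • circlePoint a b θ) {c : ℝ} (hc : 0 < c) :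
    ∃ ε > 0, ε ≤ δ ∧ ∀ θ, ∀ t ∈ Ioo (-ε) ε,
      ‖dt (du X) (θ, t) - ν₀ • circlePoint b (-a) θ‖ < c := by
  have hop : IsOpen ((univ : Set ℝ) ×ˢ Ioo (-δ) δ) := isOpen_univ.prod isOpen_Ioo
  set g : ℝ × ℝ → Coord := fun q => dt (du X) q - ν₀ • circlePoint b (-a) q.1 with hg
  have hgc : ContinuousOn g (univ ×ˢ Ioo (-δ) δ) :=
    (contDiffOn_dt hop (contDiffOn_du hop hX)).continuousOn.sub
      (((contDiff_circlePoint b (-a)).continuous.comp continuous_fst).const_smul ν₀).continuousOn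
  have hg0 : ∀ θ, g (θ, 0) = 0 := by
    intro θ
    have hq : (θ, (0 : ℝ)) ∈ (univ : Set ℝ) ×ˢ Ioo (-δ) δ := ⟨mem_univ _, by linarith, hδ⟩
    have h1 : HasDerivAt (fun w => dt X (w, 0)) (du (dt X) (θ, 0)) θ :=
      hasDerivAt_du (differentiableAt_of_contDiffOn hop (contDiffOn_dt hop hX) hq)
    rw [show (fun w => dt X (w, 0)) = fun θ => ν₀ • circlePoint a b θ from funext hv] at h1
    have h2 := h1.unique ((hasDerivAt_circlePoint a b θ).fun_const_smul ν₀)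
    show dt (du X) (θ, 0) - _ = 0
    rw [← du_dt_eq hop hX hq, h2, sub_self]
  have hU : IsOpen ((univ ×ˢ Ioo (-δ) δ) ∩ g ⁻¹' Metric.ball 0 c) :=
    hgc.isOpen_inter_preimage hop Metric.isOpen_ball
  have hsub : Icc 0 (2 * Real.pi) ×ˢ {(0 : ℝ)} ⊆ (univ ×ˢ Ioo (-δ) δ) ∩ g ⁻¹' Metric.ball 0 c := by
    rintro ⟨θ, t⟩ ⟨-, rfl : t = 0⟩
    exact ⟨⟨mem_univ _, by linarith, hδ⟩, by
      rw [mem_preimage, hg0]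
      exact Metric.mem_ball_self hc⟩
  obtain ⟨u, v, -, hvo, hu, hv0, huv⟩ := generalized_tube_lemma isCompact_Icc isCompact_singleton
    hU hsub
  obtain ⟨ε, hε, hεv⟩ := Metric.isOpen_iff.1 hvo 0 (hv0 rfl)
  refine ⟨min ε δ, lt_min hε hδ, min_le_right _ _, fun θ t ht => ?_⟩
  have htv : t ∈ v := hεv (by
    rw [Real.ball_eq_Ioo, zero_sub, zero_add]
    exact ⟨by linarith [ht.1, min_le_left ε δ], ht.2.trans_le (min_le_left _ _)⟩)
  have hgp : Function.Periodic (fun θ => g (θ, t)) (2 * Real.pi) := by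
    intro θ
    have h1 : ∀ q, du X (q + (2 * Real.pi, 0)) = du X q := fun q =>
      congrArg (fun L : ℝ × ℝ →L[ℝ] Coord => L (1, 0)) (fderiv_periodic hper q)
    have h2 : dt (du X) ((θ, t) + (2 * Real.pi, 0)) = dt (du X) (θ, t) :=
      congrArg (fun L : ℝ × ℝ →L[ℝ] Coord => L (0, 1)) (fderiv_periodic h1 (θ, t))
    simp only [Prod.mk_add_mk, add_zero] at h2
    simp only [hg, h2, circlePoint_periodic b (-a) θ]
  obtain ⟨θ₁, hθ₁, heq⟩ := hgp.exists_mem_Ico₀ Real.two_pi_pos θ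
  have h3 := (huv (show (θ₁, t) ∈ u ×ˢ v from ⟨hu (Ico_subset_Icc_self hθ₁), htv⟩)).2
  rw [mem_preimage, mem_ball_zero_iff, ← heq] at h3
  exact h3

/-- For small positive times the curves that issue from one point with the velocities
`ν₀ n(θ)` form an embedded closed curve: it is a `C¹`-small perturbation of the ellipse
`t ν₀ n(θ)`. -/
lemma exists_immersion_injective {X : ℝ × ℝ → Coord} {δ ν₀ : ℝ} {a b x₀ : Coord} (hδ : 0 < δ)
    (hν₀ : 0 < ν₀) (hX : ContDiffOn ℝ ∞ X (univ ×ˢ Ioo (-δ) δ))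
    (hper : ∀ q, X (q + (2 * Real.pi, 0)) = X q) (hX0 : ∀ θ, X (θ, 0) = x₀)
    (hv : ∀ θ, dt X (θ, 0) = ν₀ • circlePoint a b θ) (hb : ∀ θ, circlePoint b (-a) θ ≠ 0) :
    ∃ ε > 0, ε ≤ δ ∧ ∀ t ∈ Ioo 0 ε, (∀ θ, du X (θ, t) ≠ 0) ∧
      ∀ θ θ', X (θ, t) = X (θ', t) → circlePoint a b θ = circlePoint a b θ' := by
  obtain ⟨m, hm, hmn⟩ := exists_le_norm_circlePoint hb
  have hop : IsOpen ((univ : Set ℝ) ×ˢ Ioo (-δ) δ) := isOpen_univ.prod isOpen_Ioo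
  -- the chord of an arc of length `|Δ| ≤ π` is at least `(2 m / π) |Δ|`, and `1 / 2 < 2 / π`
  set c := ν₀ * m / 2 with hc_def
  have hc : 0 < c := by positivity
  obtain ⟨ε, hε, hεδ, hg⟩ := exists_norm_dt_du_sub_lt hδ hX hper hv hc
  refine ⟨ε, hε, hεδ, fun t ht => ?_⟩
  have hsub : ∀ s ∈ Icc 0 t, s ∈ Ioo (-ε) ε := fun s hs =>
    ⟨by linarith [hs.1], hs.2.trans_lt ht.2⟩
  have hW : ∀ θ, ∀ s ∈ Icc 0 t, (θ, s) ∈ (univ : Set ℝ) ×ˢ Ioo (-δ) δ := fun θ s hs =>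
    ⟨mem_univ _, by linarith [(hsub s hs).1], (hsub s hs).2.trans_le hεδ⟩
  have h0t : (0 : ℝ) ∈ Icc 0 t := left_mem_Icc.2 ht.1.le
  have htt : t ∈ Icc 0 t := right_mem_Icc.2 ht.1.le
  have hdu0 : ∀ θ, du X (θ, 0) = 0 := by
    intro θ
    have h1 : HasDerivAt (fun w => X (w, 0)) (du X (θ, 0)) θ :=
      hasDerivAt_du (differentiableAt_of_contDiffOn hop hX (hW θ 0 h0t))
    rw [show (fun w => X (w, 0)) = fun _ => x₀ from funext hX0] at h1
    exact h1.unique (hasDerivAt_const _ _)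
  have hY : ∀ θ, ‖du X (θ, t) - t • ν₀ • circlePoint b (-a) θ‖ ≤ c * t := by
    intro θ
    have h1 : ∀ s ∈ Icc 0 t, HasDerivWithinAt (fun s => du X (θ, s) - s • ν₀ • circlePoint b (-a) θ)
        (dt (du X) (θ, s) - (1 : ℝ) • ν₀ • circlePoint b (-a) θ) (Icc 0 t) s := fun s hs =>
      ((hasDerivAt_dt (differentiableAt_of_contDiffOn hop (contDiffOn_du hop hX) (hW θ s hs))).sub
        ((hasDerivAt_id' s).smul_const _)).hasDerivWithinAt
    have h2 := (convex_Icc 0 t).norm_image_sub_le_of_norm_hasDerivWithin_le h1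
      (fun s hs => by rw [one_smul]; exact (hg θ s (hsub s hs)).le) h0t htt
    simpa [hdu0, abs_of_pos ht.1] using h2
  refine ⟨fun θ h0 => ?_, ?_⟩
  · have h1 := hY θ
    rw [h0, zero_sub, norm_neg, norm_smul, norm_smul, Real.norm_of_nonneg ht.1.le,
      Real.norm_of_nonneg hν₀.le] at h1
    have h2 : t * (ν₀ * m) ≤ t * (ν₀ * ‖circlePoint b (-a) θ‖) := by
      have := ht.1
      gcongr
      exact hmn θ
    have h3 : 0 < t * (ν₀ * m) := mul_pos ht.1 (mul_pos hν₀ hm)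
    rw [hc_def] at h1
    linarith
  have hψ : ∀ θ θ', X (θ, t) = X (θ', t) →
      t * (ν₀ * ‖circlePoint a b θ - circlePoint a b θ'‖) ≤ c * t * |θ - θ'| := by
    intro θ θ' heq
    have h1 : ∀ s ∈ (univ : Set ℝ), HasDerivWithinAt (fun s => X (s, t) - t • ν₀ • circlePoint a b s)
        (du X (s, t) - t • ν₀ • circlePoint b (-a) s) univ s := fun s _ =>
      ((hasDerivAt_du (differentiableAt_of_contDiffOn hop hX (hW s t htt))).sub
        (((hasDerivAt_circlePoint a b s).fun_const_smul ν₀).fun_const_smul t)).hasDerivWithinAt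
    have h2 := convex_univ.norm_image_sub_le_of_norm_hasDerivWithin_le h1
      (fun s _ => hY s) (mem_univ θ) (mem_univ θ')
    rw [heq, sub_sub_sub_cancel_left, ← smul_sub, ← smul_sub, norm_smul, norm_smul,
      Real.norm_of_nonneg ht.1.le, Real.norm_of_nonneg hν₀.le, Real.norm_eq_abs,
      abs_sub_comm θ' θ] at h2
    exact h2
  intro θ θ₁ heq
  -- replace `θ₁` by the nearest representative of the same point of the circle
  set k := round ((θ - θ₁) / (2 * Real.pi)) with hk
  set θ' := θ₁ + k * (2 * Real.pi) with hθ'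
  have hXp : Function.Periodic (fun θ => X (θ, t)) (2 * Real.pi) := fun θ => by
    simpa using hper (θ, t)
  have hnear : |θ - θ'| ≤ Real.pi := by
    have h1 := abs_sub_round ((θ - θ₁) / (2 * Real.pi))
    have h2 : θ - θ' = ((θ - θ₁) / (2 * Real.pi) - k) * (2 * Real.pi) := by
      rw [hθ']
      field_simp
      ring
    rw [h2, abs_mul, abs_of_pos Real.two_pi_pos]
    nlinarith [Real.pi_pos]
  have h1 := hψ θ θ' (heq.trans (hXp.int_mul k θ₁).symm)
  rw [circlePoint_sub_circlePoint, norm_smul, Real.norm_eq_abs, abs_mul, abs_two] at h1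
  have h2 := Real.mul_abs_le_abs_sin (x := (θ - θ') / 2) (by
    rw [abs_div, abs_two]
    linarith)
  rw [abs_div, abs_two] at h2
  have h3 : |θ - θ'| = 0 := by
    have h4 : |θ - θ'| / Real.pi * m
        ≤ |Real.sin ((θ - θ') / 2)| * ‖circlePoint b (-a) ((θ + θ') / 2)‖ := by
      refine mul_le_mul ?_ (hmn _) hm.le (abs_nonneg _)
      calc |θ - θ'| / Real.pi = 2 / Real.pi * (|θ - θ'| / 2) := by ring
        _ ≤ _ := h2
    have h5 : t * (ν₀ * (2 * (|θ - θ'| / Real.pi * m))) ≤ c * t * |θ - θ'| := by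
      refine le_trans ?_ h1
      have := ht.1
      rw [mul_assoc 2]
      gcongr
    have h6 : (t * ν₀ * m) * (2 * (|θ - θ'| / Real.pi)) ≤ (t * ν₀ * m) * (|θ - θ'| / 2) := by
      rw [hc_def] at h5
      linarith
    have h7 := le_of_mul_le_mul_left h6 (mul_pos (mul_pos ht.1 hν₀) hm)
    rw [← mul_div_assoc, div_le_div_iff₀ Real.pi_pos two_pos] at h7
    nlinarith [Real.pi_lt_d2, abs_nonneg (θ - θ')]
  rw [sub_eq_zero.1 (abs_eq_zero.1 h3), hθ', (circlePoint_periodic a b).int_mul k]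

section

variable {M : Type*} [TopologicalSpace M] [ChartedSpace Coord M]
  [Bundle.RiemannianBundle (fun p : M => TangentSpace (𝓡 2) p)]
  [IsManifold (𝓡 2) ∞ M] {e : OpenPartialHomeomorph M Coord}
  [IsContMDiffRiemannianBundle (𝓡 2) ∞ Coord (fun p : M => TangentSpace (𝓡 2) p)]

lemma scalarProd_circlePoint_self {x a b : Coord} (haa : scalarProd e x a a = 1)
    (hbb : scalarProd e x b b = 1) (hab : scalarProd e x a b = 0) (θ : ℝ) :
    scalarProd e x (circlePoint a b θ) (circlePoint a b θ) = 1 := by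
  simp only [circlePoint, scalarProd_add_left, scalarProd_add_right, scalarProd_smul_left,
    scalarProd_smul_right, haa, hbb, hab, scalarProd_comm e x b a]
  linear_combination Real.cos_sq_add_sin_sq θ

/-- A system that satisfies the weak normality equations admits the normal blow-up of points. -/
theorem admitsNormalBlowUp_of_weakNormality {F : ForceField M} (hF : WeakNormality F) :
    AdmitsNormalBlowUp F := by
  intro p₀ e he hp₀ a b haa hbb hab ν₀ hν₀
  set x₀ := e p₀ with hx₀_def
  have hx₀ : x₀ ∈ e.target := e.map_source hp₀
  have hn1 := scalarProd_circlePoint_self haa hbb hab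
  have hn0 : ∀ θ, circlePoint a b θ ≠ 0 := fun θ => ne_zero_of_scalarProd_self_eq_one (hn1 θ)
  have hn0' : ∀ θ, circlePoint b (-a) θ ≠ 0 := by
    have hneg : -a = (-1 : ℝ) • a := by rw [neg_one_smul]
    refine fun θ => ne_zero_of_scalarProd_self_eq_one (scalarProd_circlePoint_self hbb ?_ ?_ θ)
    · rw [hneg, scalarProd_smul_left, scalarProd_smul_right, haa]
      norm_num
    · rw [hneg, scalarProd_smul_right, scalarProd_comm, hab, mul_zero]
  have hw : ContDiff ℝ ∞ (fun θ => ν₀ • circlePoint a b θ) := (contDiff_circlePoint a b).const_smul ν₀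
  have hwp : Function.Periodic (fun θ => ν₀ • circlePoint a b θ) (2 * Real.pi) :=
    fun θ => congrArg (ν₀ • ·) (circlePoint_periodic a b θ)
  -- the initial data form a compact set, since the circle is compact
  have hC : IsCompact ((fun θ => (x₀, ν₀ • circlePoint a b θ)) '' Icc 0 (2 * Real.pi)) :=
    isCompact_Icc.image (continuous_const.prodMk hw.continuous)
  obtain ⟨V, -, hCV, δ, hδ, hfl⟩ := exists_isTrajectoryFamily F he hC (by
    rintro _ ⟨θ, -, rfl⟩
    exact ⟨hx₀, smul_ne_zero hν₀.ne' (hn0 θ)⟩)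
  obtain ⟨Φ, hfam, hΦ0, hΦt⟩ := hfl univ (fun _ => x₀) (fun θ => ν₀ • circlePoint a b θ) isOpen_univ
    contDiffOn_const hw.contDiffOn (fun θ _ => by
      obtain ⟨θ₁, hθ₁, heq⟩ := hwp.exists_mem_Ico₀ Real.two_pi_pos θ
      exact hCV ⟨θ₁, Ico_subset_Icc_self hθ₁, by simp only [heq]⟩)
  set X : ℝ × ℝ → Coord := fun q => Φ (x₀, ν₀ • circlePoint a b q.1) q.2 with hX
  have hX0 : ∀ θ, X (θ, 0) = x₀ := fun θ => hΦ0 θ (mem_univ θ)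
  have hV0 : ∀ θ, dt X (θ, 0) = ν₀ • circlePoint a b θ := fun θ => hΦt θ (mem_univ θ)
  have hper : ∀ q, X (q + (2 * Real.pi, 0)) = X q := fun q => by
    simp only [hX, Prod.fst_add, Prod.snd_add, add_zero, circlePoint_periodic a b q.1]
  obtain ⟨ε, hε, hεδ, himm⟩ := exists_immersion_injective hδ hν₀ hfam.smooth hper hX0 hV0 hn0'
  have hI : ∀ t ∈ Ioo (-ε) ε, t ∈ Ioo (-δ) δ := fun t ht => ⟨by linarith [ht.1], ht.2.trans_le hεδ⟩
  have hW : ∀ θ, ∀ t ∈ Ioo (-ε) ε, (θ, t) ∈ (univ : Set ℝ) ×ˢ Ioo (-δ) δ := fun θ t ht =>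
    ⟨mem_univ θ, hI t ht⟩
  have h0 : (0 : ℝ) ∈ Ioo (-ε) ε := ⟨by linarith, hε⟩
  have hd := fun θ t ht => differentiableAt_of_contDiffOn hfam.isOpen hfam.smooth (hW θ t ht)
  have hU : ∀ θ, ∀ t ∈ Ioo (-ε) ε, deriv (fun w => X (w, t)) θ = du X (θ, t) :=
    fun θ t ht => (hasDerivAt_du (hd θ t ht)).deriv
  have hVt : ∀ θ, ∀ t ∈ Ioo (-ε) ε, deriv (fun s => X (θ, s)) t = dt X (θ, t) :=
    fun θ t ht => (hasDerivAt_dt (hd θ t ht)).deriv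
  have hdu0 : ∀ θ, du X (θ, 0) = 0 := by
    intro θ
    rw [← hU θ 0 h0, show (fun w => X (w, 0)) = fun _ => x₀ from funext hX0, deriv_const]
  have hzero : ∀ x w : Coord, scalarProd e x w 0 = 0 := fun x w => by
    rw [← zero_smul ℝ (0 : Coord), scalarProd_smul_right, zero_mul]
  have hdev : ∀ θ, ∀ t ∈ Ioo (-ε) ε, deviation e X (θ, t) = 0 := by
    intro θ
    refine hfam.deviation_eq_zero he hF (hW θ) (by rw [deviation, hdu0, hzero]) ?_
    -- the kinetic energy is constant at the initial moment
    have hT : ∀ᶠ u in 𝓝 θ, kineticEnergy e X (u, 0) = (1 / 2) * ν₀ ^ 2 := by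
      refine Eventually.of_forall fun u => ?_
      rw [kineticEnergy, hX0, hV0, scalarProd_smul_left, scalarProd_smul_right, hn1]
      ring
    rw [deviationDeriv_eq hfam he (hW θ 0 h0) hT (hasDerivAt_const _ _), hdu0]
    simp
  have hpos : ∀ t ∈ Ioo 0 ε, t ∈ Ioo (-ε) ε := fun t ht => ⟨by linarith [ht.1], ht.2⟩
  refine ⟨ε, hε, fun θ t => X (θ, t), ?_⟩
  refine ⟨hfam.smooth.mono fun q hq => hW q.1 q.2 hq.2, fun θ t _ => by simpa using hper (θ, t),
    fun θ => hfam.isTrajectoryOn isOpen_Ioo (hW θ), hX0, fun θ => ?_, fun θ t ht => ?_,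
    fun t ht => (himm t ht).2, fun θ t ht => ?_⟩
  · rw [hVt θ 0 h0, hV0]
  · rw [hU θ t (hpos t ht)]
    exact (himm t ht).1 θ
  · rw [hVt θ t (hpos t ht), hU θ t (hpos t ht)]
    exact hdev θ t (hpos t ht)

end

end

end NewtonianDynamics

theorem proposition5p1 {M : Type*} [TopologicalSpace M] [ChartedSpace NewtonianDynamics.Coord M]
    [IsManifold (𝓡 2) ∞ M] [Bundle.RiemannianBundle (fun p : M => TangentSpace (𝓡 2) p)]
    [IsContMDiffRiemannianBundle (𝓡 2) ∞ NewtonianDynamics.Coord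
      (fun p : M => TangentSpace (𝓡 2) p)] :
    {F : NewtonianDynamics.ForceField M | NewtonianDynamics.AdmitsNormalShift F}
        = {F : NewtonianDynamics.ForceField M | NewtonianDynamics.AdmitsNormalBlowUp F} ∧
      {F : NewtonianDynamics.ForceField M | NewtonianDynamics.AdmitsNormalShift F}
        = {F : NewtonianDynamics.ForceField M | NewtonianDynamics.WeakNormality F} ∧
      {F : NewtonianDynamics.ForceField M | NewtonianDynamics.AdmitsNormalBlowUp F}
        = {F : NewtonianDynamics.ForceField M | NewtonianDynamics.WeakNormality F} := by
  have hs : {F : NewtonianDynamics.ForceField M | NewtonianDynamics.AdmitsNormalShift F}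
      = {F : NewtonianDynamics.ForceField M | NewtonianDynamics.WeakNormality F} :=
    Set.ext fun _ => ⟨NewtonianDynamics.weakNormality_of_admitsNormalShift,
      NewtonianDynamics.admitsNormalShift_of_weakNormality⟩
  have hb : {F : NewtonianDynamics.ForceField M | NewtonianDynamics.AdmitsNormalBlowUp F}
      = {F : NewtonianDynamics.ForceField M | NewtonianDynamics.WeakNormality F} :=
    Set.ext fun _ => ⟨NewtonianDynamics.weakNormality_of_admitsNormalBlowUp,
      NewtonianDynamics.admitsNormalBlowUp_of_weakNormality⟩
  exact ⟨hs.trans hb.symm, hs, hb⟩
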